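/- **Setting.** All objects are families indexed by a security parameter $\lambda\in\mathbb N$. A function $f(\lambda)$ is negligible if $|f(\lambda)|$ decays faster than every inverse polynomial, and non-negligible otherwise. A quantum circuit is a sequence of unitaries on at most three qubits, introductions of a qubit in state $|0\rangle$, and discardings of a qubit; its size is the number of these operations. The complexity of a quantum channel is the minimal size of a circuit that implements it, and the complexity of a state is the minimal complexity of a channel that generates it from an empty register. A family of channels (or of states) is efficient (or efficiently generatable) if its complexity is at most polynomial in $\lambda$. A distinguisher is a channel $\mathcal D$ with a one-bit output; its advantage for $(\rho_0,\rho_1)$ is $\Pr[\mathcal D(\rho_1)=1]-\Pr[\mathcal D(\rho_0)=1]$; the statistical distance of $\rho_0,\rho_1$ is the maximal advantage of a distinguisher. Let $|\psi\rangle_{HBR}$ be a pure state of qubit registers $H,B,R$, where $B$ is a single qubit, and let $|\mathrm{epr}\rangle=(|00\rangle+|11\rangle)/\sqrt2$. For $\gamma,\epsilon\in[0,1]$, a channel $\mathcal A$ from $R$ to two qubits $D,F$ is a $(\gamma,\epsilon)$-decoder against $|\psi\rangle$ if, after it is applied to the register $R$ of $|\psi\rangle$, the reduced state of $FBD$ is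 $\gamma'|0\rangle\langle0|_F\otimes(\rho_0)_{BD}+(1-\gamma')|1\rangle\langle1|_F\otimes(\rho_1)_{BD}$ for some $\gamma'\ge\gamma$ and density operators $\rho_0,\rho_1$ with $\langle\mathrm{epr}|\rho_0|\mathrm{epr}\rangle\ge\frac14+\frac34\epsilon$. A strong decoder for an ensemble of states is a (possibly inefficient) family of $(1,1-\eta)$-decoders with negligible $\eta$. A high confidence decoder is an efficient family of $(\gamma,\epsilon)$-decoders such that $\gamma\epsilon$ is non-negligible and $\epsilon=1-o(1)$. **Construction.** Given an ensemble $|\psi\rangle$ of such states and $n=n(\lambda)$, the state $\rho_b$, $b\in\{0,1\}$, is defined as follows. Take $n$ copies $|\psi\rangle_{H_iB_iR_i}$, sample $\vec x,\vec z,\vec a,\vec a'\in\{0,1\}^n$ uniformly at random, apply $X^{x_i}Z^{z_i}$ to $B_i$ for every $i$, and output $\big(\{B_iR_i\}_{i\in[n]},(\vec a,\vec a'),c\oplus b\big)$ with $c=(\vec a\cdot\vec x)\oplus(\vec a'\cdot\vec z)$, inner products being over the binary field. **Lemma (amplification).** Let $|\psi\rangle$ be an efficiently generatable ensemble of such states.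 1. Let $n(\lambda)\ge1$ for all $\lambda$. If $\mathcal D$ is an efficient distinguisher between $\rho_0$ and $\rho_1$ with non-negligible advantage, then there are an efficient family $\mathcal A$ of channels and functions $\gamma,\epsilon:\mathbb N\to[0,1]$ such that for every $\lambda$ the channel $\mathcal A_\lambda$ is a $(\gamma(\lambda),\epsilon(\lambda))$-decoder against $|\psi\rangle$, $\gamma$ is non-negligible, and $\epsilon=1-O(\log\lambda/n)$. The complexity of $\mathcal A$ is polynomially related to that of $\mathcal D$: it is at most $c\,(1+\mathrm{complexity}(\mathcal D)+\mathrm{complexity}(|\psi\rangle))^k$ for universal constants $c,k$. 2. Consequently, if $|\psi\rangle$ has a strong decoder but no high confidence decoder, and $n$ is polynomially bounded with $n=\omega(\log\lambda)$, then $(\rho_0,\rho_1)$ is an EFI pair: each of $\rho_0,\rho_1$ is efficiently generatable, their statistical distance is non-negligible, and every efficient distinguisher has negligible advantage. -/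

import Mathlib

open Filter Asymptotics Matrix
open scoped ComplexOrder

namespace BHRD

noncomputable section

/-! ### Qubit registers and operators

A register is a finite type `ι` of qubit labels. Its computational basis is `ι → ZMod 2`, and the
concatenation of registers is the disjoint sum of the label types. -/

/-- Computational basis labels of the register `ι`. -/
abbrev Bits (ι : Type) : Type := ι → ZMod 2

/-- Linear operators on the Hilbert space of the register `ι`, in the computational basis. -/
abbrev Op (ι : Type) : Type := Matrix (Bits ι) (Bits ι) ℂ

section Operators

variable {ι κ μ : Type}

/-- Renaming of the qubits of a register. -/
def relabel (e : ι ≃ κ) (ρ : Op ι) : Op κ :=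
  Matrix.of fun u v => ρ (u ∘ e) (v ∘ e)

/-- The tensor product of operators on two registers. -/
def tensor (ρ : Op ι) (σ : Op κ) : Op (ι ⊕ κ) :=
  Matrix.of fun u v =>
    ρ (u ∘ Sum.inl) (v ∘ Sum.inl) * σ (u ∘ Sum.inr) (v ∘ Sum.inr)

/-- The tensor product of `n` operators, the `i`-th one acting on the `i`-th copy of `ι`. -/
def tensorFamily {n : ℕ} (ρ : Fin n → Op ι) : Op (Fin n × ι) :=
  Matrix.of fun u v => ∏ i, ρ i (fun q => u (i, q)) (fun q => v (i, q))

/-- The partial trace over the second register. -/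
def traceRight [Fintype κ] [DecidableEq κ] (ρ : Op (ι ⊕ κ)) : Op ι :=
  Matrix.of fun u v => ∑ w : Bits κ, ρ (Sum.elim u w) (Sum.elim v w)

/-- The projector `|w⟩⟨w|` on a computational basis state. -/
def basisProj [DecidableEq (Bits ι)] (w : Bits ι) : Op ι := Matrix.single w w 1

/-- Density operators: positive semidefinite of trace one. -/
def IsDensity [Fintype ι] [DecidableEq ι] (ρ : Op ι) : Prop :=
  ρ.PosSemidef ∧ ρ.trace = 1

/-- The map `Φ ⊗ id` on the registers `ι ⊕ μ`. -/
def tensorId (Φ : Op ι →ₗ[ℂ] Op κ) (ρ : Op (ι ⊕ μ)) : Op (κ ⊕ μ) :=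
  Matrix.of fun u v =>
    Φ (Matrix.of fun i j => ρ (Sum.elim i (u ∘ Sum.inr)) (Sum.elim j (v ∘ Sum.inr)))
      (u ∘ Sum.inl) (v ∘ Sum.inl)

end Operators

/-- A quantum channel (completely positive trace preserving map) from register `ι` to register
`κ`. -/
structure Channel (ι κ : Type) [Fintype ι] [DecidableEq ι] [Fintype κ] [DecidableEq κ] where
  map : Op ι →ₗ[ℂ] Op κ
  trace_map : ∀ ρ, (map ρ).trace = ρ.trace
  completelyPositive : ∀ (m : ℕ) (ρ : Op (ι ⊕ Fin m)),
    ρ.PosSemidef → (tensorId map ρ).PosSemidef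

/-! ### Quantum circuits and complexity -/

/-- The operator `U` applied to the wires `S 0, …, S (k - 1)` among `n` wires, and the identity
on all the other wires. -/
def onWires {k n : ℕ} (S : Fin k ↪ Fin n) (U : Op (Fin k)) : Op (Fin n) :=
  Matrix.of fun u v =>
    open Classical in if ∀ j, j ∉ Set.range S → u j = v j then U (u ∘ S) (v ∘ S) else 0

/-- Adding a last wire, initialized to `|0⟩`. -/
def addZero {n : ℕ} (ρ : Op (Fin n)) : Op (Fin (n + 1)) :=
  Matrix.of fun u v =>
    if u (Fin.last n) = 0 ∧ v (Fin.last n) = 0 then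
      ρ (fun i => u i.castSucc) (fun i => v i.castSucc) else 0

/-- Tracing out the last wire. -/
def dropLast {n : ℕ} (ρ : Op (Fin (n + 1))) : Op (Fin n) :=
  Matrix.of fun u v => ∑ b : ZMod 2,
    ρ (Fin.snoc (α := fun _ => ZMod 2) u b) (Fin.snoc (α := fun _ => ZMod 2) v b)

/-- Quantum circuits from `n` wires to `m` wires. The atomic operations are a unitary on at most
three qubits, the introduction of a qubit in state `|0⟩`, and the discarding of a qubit. The
operation that stands in front is applied first. -/
inductive Circuit : ℕ → ℕ → Type
  | nil (n : ℕ) : Circuit n n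
  | gate {n m k : ℕ} (hk : k ≤ 3) (S : Fin k ↪ Fin n)
      (U : Matrix.unitaryGroup (Bits (Fin k)) ℂ) (C : Circuit n m) : Circuit n m
  | init {n m : ℕ} (C : Circuit (n + 1) m) : Circuit n m
  | discard {n m : ℕ} (C : Circuit n m) : Circuit (n + 1) m

/-- The number of atomic operations of a circuit. -/
def Circuit.size : {n m : ℕ} → Circuit n m → ℕ
  | _, _, .nil _ => 0
  | _, _, .gate _ _ _ C => C.size + 1
  | _, _, .init C => C.size + 1
  | _, _, .discard C => C.size + 1

/-- The action of a circuit on operators. -/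
def Circuit.run : {n m : ℕ} → Circuit n m → Op (Fin n) → Op (Fin m)
  | _, _, .nil _, ρ => ρ
  | _, _, .gate _ S U C, ρ => C.run (onWires S U.1 * ρ * (onWires S U.1)ᴴ)
  | _, _, .init C, ρ => C.run (addZero ρ)
  | _, _, .discard C, ρ => C.run (dropLast ρ)

section Complexity

variable {ι κ : Type} [Fintype ι] [DecidableEq ι] [Fintype κ] [DecidableEq κ]

/-- The circuit `C` implements the channel `Φ`, for some assignment of the qubits of the source
and target registers to the input and output wires. -/
def Implements {n m : ℕ} (C : Circuit n m) (Φ : Channel ι κ) : Prop :=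
  ∃ (e : ι ≃ Fin n) (f : κ ≃ Fin m), ∀ ρ, relabel f (Φ.map ρ) = C.run (relabel e ρ)

/-- The computational complexity of a channel: the minimal size of a circuit that implements
it. -/
def complexity (Φ : Channel ι κ) : ℕ∞ :=
  ⨅ (n : ℕ) (m : ℕ) (C : Circuit n m) (_ : Implements C Φ), (C.size : ℕ∞)

/-- The complexity of generating a state: the minimal complexity of a channel that generates it
from an empty register. -/
def genComplexity (ρ : Op ι) : ℕ∞ :=
  ⨅ (Φ : Channel (Fin 0) ι) (_ : Φ.map 1 = ρ), complexity Φ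

end Complexity

/-! ### Asymptotic notions, indexed by the security parameter -/

/-- Negligible functions of the security parameter: decay faster than every inverse polynomial. -/
def Negligible (f : ℕ → ℝ) : Prop :=
  SuperpolynomialDecay atTop (fun s : ℕ => (s : ℝ)) f

/-- Functions bounded by a polynomial in the security parameter. -/
def PolyBounded (f : ℕ → ℕ∞) : Prop :=
  ∃ p : Polynomial ℕ, ∀ s, f s ≤ ((p.eval s : ℕ) : ℕ∞)

section Ensembles

variable {ι κ : ℕ → Type} [∀ s, Fintype (ι s)] [∀ s, DecidableEq (ι s)]
  [∀ s, Fintype (κ s)] [∀ s, DecidableEq (κ s)]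

/-- An ensemble of channels of polynomially bounded complexity. -/
def Efficient (Φ : ∀ s, Channel (ι s) (κ s)) : Prop :=
  PolyBounded fun s => complexity (Φ s)

/-- An ensemble of states that is generated by channels of polynomially bounded complexity. -/
def EfficientlyGeneratable (ρ : ∀ s, Op (ι s)) : Prop :=
  PolyBounded fun s => genComplexity (ρ s)

end Ensembles

/-! ### Distinguishers and EFI pairs -/

section Distinguishers

variable {ι : Type} [Fintype ι] [DecidableEq ι]

/-- The signed advantage of a distinguisher: the probability that the output bit (measured in the
computational basis) is `1` on `ρ₁`, minus this probability on `ρ₀`. -/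
def advantage (D : Channel ι Unit) (ρ₀ ρ₁ : Op ι) : ℝ :=
  (D.map ρ₁ (fun _ => 1) (fun _ => 1)).re - (D.map ρ₀ (fun _ => 1) (fun _ => 1)).re

/-- The statistical distance: the maximal distinguishing advantage. -/
def statDist (ρ₀ ρ₁ : Op ι) : ℝ :=
  sSup (Set.range fun D : Channel ι Unit => advantage D ρ₀ ρ₁)

end Distinguishers

/-- EFI pairs: efficiently generatable, not statistically indistinguishable, and computationally
indistinguishable. -/
structure IsEFI {ι : ℕ → Type} [∀ s, Fintype (ι s)] [∀ s, DecidableEq (ι s)]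
    (ρ₀ ρ₁ : ∀ s, Op (ι s)) : Prop where
  generatable₀ : EfficientlyGeneratable ρ₀
  generatable₁ : EfficientlyGeneratable ρ₁
  far : ¬ Negligible fun s => statDist (ρ₀ s) (ρ₁ s)
  indistinguishable : ∀ D : ∀ s, Channel (ι s) Unit, Efficient D →
    Negligible fun s => advantage (D s) (ρ₀ s) (ρ₁ s)

/-! ### Radiation decoders -/

/-- The qubits of `R` and of the single-qubit register `B`. -/
abbrev RegRB (r : ℕ) : Type := Fin r ⊕ Unit

/-- The qubits of `R`, `B` and `H`. -/
abbrev RegRBH (r h : ℕ) : Type := RegRB r ⊕ Fin h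

/-- The failure qubit `F` and the decoded qubit `D`. -/
abbrev RegFD : Type := Unit ⊕ Unit

/-- A pure state on the registers `HBR`, with `h` qubits in `H`, one in `B` and `r` in `R`. -/
structure PureState (r h : ℕ) where
  vec : Bits (RegRBH r h) → ℂ
  normalized : star vec ⬝ᵥ vec = 1

/-- The density operator `|ψ⟩⟨ψ|`. -/
def PureState.density {r h : ℕ} (ψ : PureState r h) : Op (RegRBH r h) :=
  vecMulVec ψ.vec (star ψ.vec)

/-- An ensemble of pure states on registers `HBR`, indexed by the security parameter. -/
structure StateEnsemble where
  r : ℕ → ℕ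
  h : ℕ → ℕ
  state : ∀ s, PureState (r s) (h s)

/-- The vector `|epr⟩ = (|00⟩ + |11⟩) / √2`. -/
def epr : Bits (Unit ⊕ Unit) → ℂ :=
  fun u => if u (Sum.inl ()) = u (Sum.inr ()) then ((1 / Real.sqrt 2 : ℝ) : ℂ) else 0

/-- The number `⟨epr|ρ|epr⟩`. -/
def eprFidelity (ρ : Op (Unit ⊕ Unit)) : ℝ := (star epr ⬝ᵥ (ρ *ᵥ epr)).re

/-- The reduced state on `F`, `D`, `B` after applying `A` to the register `R` of `ψ`. The register
`H`, which `A` does not touch, is traced out. -/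
def decodedState {r h : ℕ} (A : Channel (Fin r) RegFD) (ψ : PureState r h) :
    Op (Unit ⊕ (Unit ⊕ Unit)) :=
  relabel (Equiv.sumAssoc Unit Unit Unit) (tensorId A.map (traceRight ψ.density))

/-- `A` is a `(γ, ε)`-decoder against `ψ`: the state of `F`, `D`, `B` has the form
`γ' |0⟩⟨0| ⊗ ρ₀ + (1 - γ') |1⟩⟨1| ⊗ ρ₁` with `γ' ≥ γ` and
`⟨epr|ρ₀|epr⟩ ≥ 1/4 + (3/4) ε`. -/
def IsDecoder {r h : ℕ} (γ ε : ℝ) (A : Channel (Fin r) RegFD) (ψ : PureState r h) : Prop :=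
  γ ∈ Set.Icc (0 : ℝ) 1 ∧ ε ∈ Set.Icc (0 : ℝ) 1 ∧
  ∃ (γ' : ℝ) (ρ₀ ρ₁ : Op (Unit ⊕ Unit)), γ ≤ γ' ∧ IsDensity ρ₀ ∧ IsDensity ρ₁ ∧
    decodedState A ψ =
      (γ' : ℂ) • tensor (basisProj fun _ => 0) ρ₀ +
        ((1 - γ' : ℝ) : ℂ) • tensor (basisProj fun _ => 1) ρ₁ ∧
    1 / 4 + 3 / 4 * ε ≤ eprFidelity ρ₀

namespace StateEnsemble

variable (Ψ : StateEnsemble)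

/-- Decodability by possibly inefficient `(1, 1 - η)`-decoders with negligible `η`. -/
def StronglyDecodable : Prop :=
  ∃ (A : ∀ s, Channel (Fin (Ψ.r s)) RegFD) (η : ℕ → ℝ), Negligible η ∧
    ∀ s, IsDecoder 1 (1 - η s) (A s) (Ψ.state s)

/-- `A` is a high confidence decoder: an efficient `(γ, ε)`-decoder for which `γ ε` is
non-negligible and `ε = 1 - o(1)`. -/
def IsHighConfidenceDecoder (A : ∀ s, Channel (Fin (Ψ.r s)) RegFD) : Prop :=
  Efficient A ∧ ∃ γ ε : ℕ → ℝ, (∀ s, IsDecoder (γ s) (ε s) (A s) (Ψ.state s)) ∧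
    ¬ Negligible (fun s => γ s * ε s) ∧ (fun s => 1 - ε s) =o[atTop] fun _ => (1 : ℝ)

end StateEnsemble

/-! ### The `n`-fold construction -/

/-- The Pauli operator `X`. -/
def pauliX : Op Unit := Matrix.of fun u v => if u () = v () + 1 then 1 else 0

/-- The Pauli operator `Z`. -/
def pauliZ : Op Unit := Matrix.diagonal fun u => if u () = 0 then 1 else -1

/-- The Pauli mask `X ^ x * Z ^ z`. -/
def pauliMask (x z : ZMod 2) : Op Unit := pauliX ^ x.val * pauliZ ^ z.val

/-- The state of the registers `R` and `B` after the Pauli mask `X ^ x * Z ^ z` is applied to the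
register `B` of `ψ`. -/
def maskedState {r h : ℕ} (ψ : PureState r h) (x z : ZMod 2) : Op (RegRB r) :=
  let W : Op (RegRBH r h) := tensor (tensor 1 (pauliMask x z)) 1
  traceRight (W * ψ.density * Wᴴ)

/-- The qubits of the `n` pairs of registers `B_i R_i`, of the strings `a`, `a'`, and of the bit
`c'`. -/
abbrev RegOut (r n : ℕ) : Type := (Fin n × RegRB r) ⊕ ((Fin n ⊕ Fin n) ⊕ Unit)

/-- The state `ρ_b` of the `n`-fold construction: uniformly random `x`, `z`, `a`, `a'` in
`{0, 1}ⁿ`, the `i`-th of `n` copies of `ψ` masked by `X ^ x_i * Z ^ z_i`, together with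
`a`, `a'` and the bit `a ⬝ x ⊕ a' ⬝ z ⊕ b`. -/
def amplified {r h : ℕ} (ψ : PureState r h) (n : ℕ) (b : ZMod 2) : Op (RegOut r n) :=
  ((2 : ℂ) ^ (4 * n))⁻¹ •
    ∑ x : Fin n → ZMod 2, ∑ z : Fin n → ZMod 2,
      ∑ a : Fin n → ZMod 2, ∑ a' : Fin n → ZMod 2,
        tensor (tensorFamily fun i => maskedState ψ (x i) (z i))
          (basisProj (Sum.elim (Sum.elim a a') fun _ => a ⬝ᵥ x + a' ⬝ᵥ z + b))

end

end BHRD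

open BHRD

set_option linter.unusedSectionVars false
set_option linter.unnecessarySeqFocus false
set_option linter.unusedSimpArgs false

/-! Part 1 combines three ideas. The first is the quantum Goldreich-Levin argument. A distinguisher
of advantage `δ` predicts the inner product of the hidden masks with a random public string. Pulled
back through its circuit, the observable `Z` on its output bit becomes a product `T` of gates,
compressed to zero ancillas (`exists_heisenberg`). Such a `T` is a unitary that a new circuit can
apply. Conjugated by a Hadamard transform of the public register, it sends `|0⟩` to `|x, z, 1⟩` with
mean amplitude `δ` in absolute value. By Cauchy-Schwarz, measuring this register yields all `n`
masks of `n` masked copies with mean probability at least `δ ^ 2` (`exists_predictor`). The public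
register need not be preserved by `T`; random sign shifts of the Hadamard transform cancel the
unwanted terms, and one good shift is kept.

The second is a chain rule. If all `n` symbols are guessed with probability `δ ^ 2 ≥ q ^ n + n * β`,
then for some position `i` and some choice of the other masks, the `i`-th symbol is right with
conditional probability at least `q`, given that the earlier guesses are right, up to a gain that
keeps the event itself of probability at least `β` (`exists_update_prefixProb`). Taking `q ^ n` and
`n * β` each equal to half of a lower bound `θ` on `δ ^ 2` makes `1 - q` at most `log (2 / θ) / n`.
This is where `1 - ε = O(log λ / n)` originates.

The third is teleportation. The decoder holds only `R`. It feeds `R` and half of a fresh EPR pair to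
the guessing procedure as the `i`-th copy, the other copies being prepared by itself, keeps the
other half as `D`, and applies to `D` the Pauli that was guessed. Projecting `BD` on a Bell state
replaces the EPR half by `B` with a Pauli mask. Hence the success probability is the acceptance
probability for a uniform mask, and the fidelity with `|epr⟩` given success is the conditional
probability of a right guess (`exists_decoder_of_goodProb`). Comparing earlier guesses with the
known masks gives the flag `F`.

For part 2, computational indistinguishability is part 1 read contrapositively: when `n = ω(log λ)`
the decoder obtained is of high confidence. For statistical distance, a strong decoder followed by a
Bell measurement finds the mask of each copy up to error `3 / 4 * η`, so all masks and the hidden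
bit are found up to error `n * η` times a constant (`le_statDist_amplified`). Efficient generation
is an explicit circuit (`genState_amplified`). All complexity bounds rest on counting gates for
products of small unitaries (`GateProd`) and for composed circuits (`Impl`, `GenState`). -/

namespace BHRD

/-! ### Registers, relabelling and tensor products -/

section Registers

variable {ι κ μ ν : Type}

/-- Restriction of computational basis labels along a relabelling. -/
def bitsEquiv (e : ι ≃ κ) : Bits κ ≃ Bits ι where
  toFun u := u ∘ e
  invFun v := v ∘ e.symm
  left_inv u := by ext i; simp
  right_inv v := by ext i; simp

theorem relabel_eq_submatrix (e : ι ≃ κ) (ρ : Op ι) :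
    relabel e ρ = ρ.submatrix (bitsEquiv e) (bitsEquiv e) := rfl

@[simp] theorem relabel_apply (e : ι ≃ κ) (ρ : Op ι) (u v : Bits κ) :
    relabel e ρ u v = ρ (u ∘ e) (v ∘ e) := rfl

@[simp] theorem tensor_apply (ρ : Op ι) (σ : Op κ) (u v : Bits (ι ⊕ κ)) :
    tensor ρ σ u v = ρ (u ∘ Sum.inl) (v ∘ Sum.inl) * σ (u ∘ Sum.inr) (v ∘ Sum.inr) := rfl

theorem tensor_elim (ρ : Op ι) (σ : Op κ) (a c : Bits ι) (b d : Bits κ) :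
    tensor ρ σ (Sum.elim a b) (Sum.elim c d) = ρ a c * σ b d := rfl

theorem relabel_relabel (e : ι ≃ κ) (f : κ ≃ μ) (ρ : Op ι) :
    relabel f (relabel e ρ) = relabel (e.trans f) ρ := rfl

@[simp] theorem relabel_refl (ρ : Op ι) : relabel (Equiv.refl ι) ρ = ρ := rfl

theorem relabel_symm_relabel (e : ι ≃ κ) (ρ : Op ι) : relabel e.symm (relabel e ρ) = ρ := by
  rw [relabel_relabel, Equiv.self_trans_symm, relabel_refl]

theorem relabel_relabel_symm (e : ι ≃ κ) (ρ : Op κ) : relabel e (relabel e.symm ρ) = ρ := by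
  rw [relabel_relabel, Equiv.symm_trans_self, relabel_refl]

theorem relabel_conjTranspose (e : ι ≃ κ) (ρ : Op ι) :
    relabel e ρᴴ = (relabel e ρ)ᴴ := rfl

theorem relabel_one [DecidableEq (Bits ι)] [DecidableEq (Bits κ)] (e : ι ≃ κ) :
    relabel e (1 : Op ι) = 1 := by
  rw [relabel_eq_submatrix, Matrix.submatrix_one_equiv]

variable [Fintype ι] [DecidableEq ι] [Fintype κ] [DecidableEq κ] [Fintype μ] [DecidableEq μ]

theorem relabel_mul (e : ι ≃ κ) (ρ σ : Op ι) :
    relabel e (ρ * σ) = relabel e ρ * relabel e σ := by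
  simp only [relabel_eq_submatrix, Matrix.submatrix_mul_equiv]

theorem sum_bits_equiv {M : Type*} [AddCommMonoid M] (e : ι ≃ κ) (f : Bits ι → M) :
    ∑ u : Bits κ, f (u ∘ e) = ∑ u : Bits ι, f u :=
  Equiv.sum_comp (bitsEquiv e) f

theorem trace_relabel (e : ι ≃ κ) (ρ : Op ι) : (relabel e ρ).trace = ρ.trace :=
  sum_bits_equiv e fun u => ρ u u

theorem posSemidef_relabel (e : ι ≃ κ) {ρ : Op ι} (h : ρ.PosSemidef) :
    (relabel e ρ).PosSemidef :=
  h.submatrix _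

theorem sum_bits_sum {M : Type*} [AddCommMonoid M] (f : Bits (ι ⊕ κ) → M) :
    ∑ u, f u = ∑ a : Bits ι, ∑ b : Bits κ, f (Sum.elim a b) := by
  rw [← Fintype.sum_prod_type']
  exact Fintype.sum_equiv (Equiv.sumArrowEquivProdArrow ι κ (ZMod 2)) _ _
    fun u => by simp [Equiv.sumArrowEquivProdArrow]

theorem tensor_mul_tensor (A B : Op ι) (C D : Op κ) :
    tensor A C * tensor B D = tensor (A * B) (C * D) := by
  ext u v
  simp only [Matrix.mul_apply, tensor_apply, sum_bits_sum, Finset.sum_mul_sum, Sum.elim_comp_inl,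
    Sum.elim_comp_inr]
  exact Finset.sum_congr rfl fun _ _ => Finset.sum_congr rfl fun _ _ => by ring

omit [Fintype ι] [DecidableEq ι] [Fintype κ] [DecidableEq κ] in
theorem tensor_conjTranspose (A : Op ι) (C : Op κ) : (tensor A C)ᴴ = tensor Aᴴ Cᴴ := by
  ext u v
  simp [Matrix.conjTranspose_apply]

omit [Fintype ι] [DecidableEq ι] [Fintype κ] [DecidableEq κ] in
theorem bits_sum_ext_iff {u v : Bits (ι ⊕ κ)} :
    u = v ↔ u ∘ Sum.inl = v ∘ Sum.inl ∧ u ∘ Sum.inr = v ∘ Sum.inr := by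
  constructor
  · rintro rfl; exact ⟨rfl, rfl⟩
  · rintro ⟨h1, h2⟩
    ext (i | i)
    · exact congrFun h1 i
    · exact congrFun h2 i

omit [Fintype ι] [DecidableEq ι] [Fintype κ] [DecidableEq κ] in
theorem tensor_one_one [DecidableEq (Bits ι)] [DecidableEq (Bits κ)]
    [DecidableEq (Bits (ι ⊕ κ))] : tensor (1 : Op ι) (1 : Op κ) = 1 := by
  ext u v
  simp only [tensor_apply, Matrix.one_apply, bits_sum_ext_iff (u := u)]
  split_ifs <;> simp_all

theorem trace_tensor (A : Op ι) (C : Op κ) : (tensor A C).trace = A.trace * C.trace := by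
  simp only [Matrix.trace, Matrix.diag, sum_bits_sum, Finset.sum_mul_sum, tensor_apply,
    Sum.elim_comp_inl, Sum.elim_comp_inr]

theorem posSemidef_tensor {A : Op ι} {C : Op κ} (hA : A.PosSemidef) (hC : C.PosSemidef) :
    (tensor A C).PosSemidef :=
  (hA.kronecker hC).submatrix (Equiv.sumArrowEquivProdArrow ι κ (ZMod 2))

theorem trace_basisProj (w : Bits ι) : (basisProj w : Op ι).trace = 1 := by
  simp [basisProj, Matrix.trace_single_eq_same]

theorem posSemidef_basisProj (w : Bits ι) : (basisProj w : Op ι).PosSemidef := by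
  have : (basisProj w : Op ι) = Matrix.vecMulVec (Pi.single w 1) (star (Pi.single w 1)) := by
    ext u v
    simp only [basisProj, Matrix.single_apply, Matrix.vecMulVec_apply, Pi.star_apply,
      Pi.single_apply]
    split_ifs <;> simp_all
  rw [this]
  exact Matrix.posSemidef_vecMulVec_self_star _

omit [Fintype ι] [Fintype κ] [DecidableEq ι] [DecidableEq κ] in
theorem basisProj_apply [DecidableEq (Bits ι)] (w u v : Bits ι) :
    basisProj w u v = if w = u ∧ w = v then 1 else 0 := by
  simp [basisProj, Matrix.single_apply]

end Registers

/-! ### Operators on some of the qubits, and products of gates -/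

section Gates

variable {ι κ μ : Type}

/-- The operator `U` on the qubits in the range of `S`, and the identity on all others. -/
noncomputable def place (S : κ ↪ ι) (U : Op κ) : Op ι :=
  Matrix.of fun u v =>
    open Classical in if ∀ j, j ∉ Set.range S → u j = v j then U (u ∘ S) (v ∘ S) else 0

theorem place_apply (S : κ ↪ ι) (U : Op κ) (u v : Bits ι) [Decidable (∀ j, j ∉ Set.range S → u j = v j)] :
    place S U u v = if ∀ j, j ∉ Set.range S → u j = v j then U (u ∘ S) (v ∘ S) else 0 := by
  simp only [place, Matrix.of_apply]
  congr

theorem onWires_eq_place {k n : ℕ} (S : Fin k ↪ Fin n) (U : Op (Fin k)) :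
    onWires S U = place S U := by
  ext u v
  simp only [onWires, place, Matrix.of_apply]
  congr

/-- The register `ι` split into the range of `S` and the rest. -/
noncomputable def splitEquiv (S : κ ↪ ι) : κ ⊕ ((Set.range S)ᶜ : Set ι) ≃ ι :=
  open Classical in
  (Equiv.sumCongr (Equiv.ofInjective S S.injective) (Equiv.refl _)).trans
    (Equiv.Set.sumCompl (Set.range S))

/-- This tensor form transfers identity, adjoint and product from `tensor U 1` to `place S U`. -/
theorem place_eq_relabel (S : κ ↪ ι) (U : Op κ) [DecidableEq (Bits ((Set.range S)ᶜ : Set ι))] :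
    place S U = relabel (splitEquiv S) (tensor U 1) := by
  classical
  ext u v
  rw [place_apply, relabel_apply, tensor_apply, Matrix.one_apply]
  have h1 : ∀ w : Bits ι, (w ∘ splitEquiv S) ∘ Sum.inl = w ∘ S := by
    intro w; ext i; simp [splitEquiv]
  have h2 : (∀ j, j ∉ Set.range S → u j = v j) ↔
      (u ∘ splitEquiv S) ∘ Sum.inr = (v ∘ splitEquiv S) ∘ Sum.inr := by
    constructor
    · intro h
      ext ⟨j, hj⟩
      simpa [splitEquiv] using h j hj
    · intro h j hj
      simpa [splitEquiv] using congrFun h ⟨j, hj⟩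
  rw [h1, h1]
  simp only [h2]
  split_ifs <;> simp_all

theorem place_one [DecidableEq (Bits κ)] [DecidableEq (Bits ι)] (S : κ ↪ ι) :
    place S (1 : Op κ) = 1 := by
  classical
  rw [place_eq_relabel, tensor_one_one, relabel_one]

theorem place_conjTranspose (S : κ ↪ ι) (U : Op κ) : (place S U)ᴴ = place S Uᴴ := by
  classical
  rw [place_eq_relabel, place_eq_relabel, ← relabel_conjTranspose, tensor_conjTranspose,
    Matrix.conjTranspose_one]

/-- A gate on a subregister is a gate on the whole register, so gate counts do not change when a
register is enlarged. -/
theorem place_place (S : κ ↪ ι) (S' : ι ↪ μ) (U : Op κ) :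
    place S' (place S U) = place (S.trans S') U := by
  classical
  ext u v
  simp only [place_apply]
  rw [← ite_and]
  refine if_congr ?_ rfl rfl
  constructor
  · rintro ⟨h1, h2⟩ j hj
    by_cases h : j ∈ Set.range S'
    · obtain ⟨i, rfl⟩ := h
      exact h2 i fun ⟨k, hk⟩ => hj ⟨k, by simp [← hk]⟩
    · exact h1 j h
  · refine fun h => ⟨fun j hj => h j fun ⟨k, hk⟩ => hj ⟨S k, by simpa using hk⟩,
      fun j hj => h _ fun ⟨k, hk⟩ => hj ⟨k, S'.injective (by simpa using hk)⟩⟩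

theorem relabel_eq_place (e : ι ≃ κ) (U : Op ι) : relabel e U = place e.toEmbedding U := by
  classical
  ext u v
  rw [place_apply, if_pos]
  · rfl
  · intro j hj
    exact absurd ⟨e.symm j, by simp⟩ hj

theorem tensor_one_eq_place [DecidableEq (Bits κ)] (U : Op ι) :
    tensor U (1 : Op κ) = place Function.Embedding.inl U := by
  classical
  ext u v
  rw [place_apply, tensor_apply, Matrix.one_apply]
  have h2 : (∀ j, j ∉ Set.range (Function.Embedding.inl : ι ↪ ι ⊕ κ) → u j = v j) ↔
      u ∘ Sum.inr = v ∘ Sum.inr := by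
    constructor
    · intro h; ext j; exact h _ (by simp)
    · rintro h (j | j) hj
      · simp at hj
      · exact congrFun h j
  simp only [h2]
  split_ifs <;> simp <;> rfl

theorem one_tensor_eq_place [DecidableEq (Bits κ)] (U : Op ι) :
    tensor (1 : Op κ) U = place Function.Embedding.inr U := by
  classical
  ext u v
  rw [place_apply, tensor_apply, Matrix.one_apply]
  have h2 : (∀ j, j ∉ Set.range (Function.Embedding.inr : ι ↪ κ ⊕ ι) → u j = v j) ↔
      u ∘ Sum.inl = v ∘ Sum.inl := by
    constructor
    · intro h; ext j; exact h _ (by simp)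
    · rintro h (j | j) hj
      · exact congrFun h j
      · simp at hj
  simp only [h2]
  split_ifs <;> simp <;> rfl

variable [Fintype ι] [DecidableEq ι] [Fintype κ] [DecidableEq κ] [Fintype μ] [DecidableEq μ]

theorem place_mul (S : κ ↪ ι) (U V : Op κ) : place S (U * V) = place S U * place S V := by
  classical
  rw [place_eq_relabel, place_eq_relabel, place_eq_relabel, ← relabel_mul, tensor_mul_tensor,
    mul_one]

theorem place_mem_unitaryGroup (S : κ ↪ ι) {U : Op κ}
    (hU : U ∈ Matrix.unitaryGroup (Bits κ) ℂ) :
    place S U ∈ Matrix.unitaryGroup (Bits ι) ℂ := by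
  rw [Matrix.mem_unitaryGroup_iff, Matrix.star_eq_conjTranspose] at hU ⊢
  rw [place_conjTranspose, ← place_mul, hU, place_one]

/-- `U` is a product of at most `c` unitaries, each of which acts on at most three qubits. -/
inductive GateProd : ℕ → Op ι → Prop
  | one (c : ℕ) : GateProd c 1
  | cons {c k : ℕ} (hk : k ≤ 3) (S : Fin k ↪ ι) (U : Matrix.unitaryGroup (Bits (Fin k)) ℂ)
      {M : Op ι} (hM : GateProd c M) : GateProd (c + 1) (place S U.1 * M)

namespace GateProd

theorem mono {c d : ℕ} {M : Op ι} (h : GateProd c M) (hcd : c ≤ d) : GateProd d M := by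
  induction h generalizing d with
  | one c => exact one d
  | cons hk S U _ ih =>
    obtain ⟨d, rfl⟩ : ∃ d', d = d' + 1 := ⟨d - 1, by omega⟩
    exact cons hk S U (ih (by omega))

theorem mul {c d : ℕ} {M N : Op ι} (hM : GateProd c M) (hN : GateProd d N) :
    GateProd (c + d) (M * N) := by
  induction hM with
  | one c => rw [one_mul]; exact hN.mono (by omega)
  | cons hk S U _ ih => rw [mul_assoc, Nat.add_right_comm]; exact cons hk S U ih

theorem place {c : ℕ} {M : Op ι} (h : GateProd c M) (S : ι ↪ κ) :
    GateProd c (BHRD.place S M) := by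
  induction h with
  | one c => rw [place_one]; exact one c
  | cons hk S' U _ ih => rw [place_mul, place_place]; exact cons hk _ U ih

theorem relabel {c : ℕ} {M : Op ι} (h : GateProd c M) (e : ι ≃ κ) :
    GateProd c (BHRD.relabel e M) := by
  rw [relabel_eq_place]; exact h.place _

theorem tensor_one {c : ℕ} {M : Op ι} (h : GateProd c M) :
    GateProd c (tensor M (1 : Op κ)) := by
  rw [tensor_one_eq_place]; exact h.place _

theorem one_tensor {c : ℕ} {M : Op ι} (h : GateProd c M) :
    GateProd c (tensor (1 : Op κ) M) := by
  rw [one_tensor_eq_place]; exact h.place _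

theorem single (hκ : Fintype.card κ ≤ 3) {U : Op κ}
    (hU : U ∈ Matrix.unitaryGroup (Bits κ) ℂ) : GateProd 1 U := by
  let e := Fintype.equivFin κ
  have h := cons hκ e.symm.toEmbedding
    ⟨BHRD.relabel e U, by rw [relabel_eq_place]; exact place_mem_unitaryGroup _ hU⟩ (one 0)
  rw [mul_one, ← relabel_eq_place, relabel_symm_relabel] at h
  exact h

theorem mem_unitaryGroup {c : ℕ} {M : Op ι} (h : GateProd c M) :
    M ∈ Matrix.unitaryGroup (Bits ι) ℂ := by
  induction h with
  | one c => exact one_mem _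
  | cons hk S U _ ih => exact mul_mem (place_mem_unitaryGroup S U.2) ih

theorem conjTranspose {c : ℕ} {M : Op ι} (h : GateProd c M) : GateProd c Mᴴ := by
  induction h with
  | one c => rw [Matrix.conjTranspose_one]; exact one c
  | cons hk S U _ ih =>
    rw [Matrix.conjTranspose_mul, place_conjTranspose]
    refine ih.mul (d := 1) ?_
    have := cons hk S (star U) (one 0)
    rwa [mul_one] at this

end GateProd

/-! ### Product operators -/

omit [DecidableEq ι] in
/-- The operator that acts on each qubit `j` by `h j`. -/
def piOp (h : ι → Matrix (ZMod 2) (ZMod 2) ℂ) : Op ι :=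
  Matrix.of fun u v => ∏ j, h j (u j) (v j)

omit [DecidableEq ι] in
theorem piOp_apply (h : ι → Matrix (ZMod 2) (ZMod 2) ℂ) (u v : Bits ι) :
    piOp h u v = ∏ j, h j (u j) (v j) := rfl

theorem piOp_mul (g h : ι → Matrix (ZMod 2) (ZMod 2) ℂ) :
    piOp g * piOp h = piOp (g * h) := by
  ext u v
  simp only [Matrix.mul_apply, piOp_apply, Pi.mul_apply, ← Finset.prod_mul_distrib,
    Finset.prod_univ_sum, Fintype.piFinset_univ]

omit [DecidableEq ι] in
theorem piOp_one [DecidableEq (Bits ι)] : piOp (1 : ι → Matrix (ZMod 2) (ZMod 2) ℂ) = 1 := by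
  ext u v
  simp only [piOp_apply, Pi.one_apply, Matrix.one_apply, Finset.prod_ite_zero, Finset.mem_univ,
    forall_const, funext_iff, Finset.prod_const_one]

omit [DecidableEq ι] in
theorem piOp_conjTranspose (h : ι → Matrix (ZMod 2) (ZMod 2) ℂ) :
    (piOp h)ᴴ = piOp fun j => (h j)ᴴ := by
  ext u v
  simp [piOp_apply, Matrix.conjTranspose_apply]

theorem piOp_mem_unitaryGroup {h : ι → Matrix (ZMod 2) (ZMod 2) ℂ}
    (hh : ∀ j, h j ∈ Matrix.unitaryGroup (ZMod 2) ℂ) :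
    piOp h ∈ Matrix.unitaryGroup (Bits ι) ℂ := by
  rw [Matrix.mem_unitaryGroup_iff, Matrix.star_eq_conjTranspose, piOp_conjTranspose, piOp_mul]
  rw [← piOp_one]
  congr 1
  funext j
  exact Matrix.mem_unitaryGroup_iff.1 (hh j)

theorem piOp_mulSingle (j : ι) (h : Matrix (ZMod 2) (ZMod 2) ℂ) :
    piOp (Pi.mulSingle j h) =
      place (⟨fun _ : Unit => j, fun _ _ _ => rfl⟩ : Unit ↪ ι) (piOp fun _ => h) := by
  classical
  ext u v
  rw [place_apply, piOp_apply, piOp_apply, ← Finset.mul_prod_erase _ _ (Finset.mem_univ j)]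
  have : ∏ i ∈ Finset.univ.erase j, Pi.mulSingle (M := fun _ => Matrix (ZMod 2) (ZMod 2) ℂ) j h i (u i) (v i)
      = ∏ i ∈ Finset.univ.erase j, if u i = v i then 1 else 0 := by
    refine Finset.prod_congr rfl fun i hi => ?_
    rw [Pi.mulSingle_eq_of_ne (Finset.ne_of_mem_erase hi), Matrix.one_apply]
  rw [this, Pi.mulSingle_eq_same, Finset.prod_ite_zero]
  have h2 : (∀ i, i ∉ Set.range (⟨fun _ : Unit => j, fun _ _ _ => rfl⟩ : Unit ↪ ι) → u i = v i) ↔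
      ∀ i ∈ Finset.univ.erase j, u i = v i := by
    simp only [Finset.mem_erase, Finset.mem_univ, and_true]
    refine forall_congr' fun i => imp_congr_left (not_congr ⟨?_, ?_⟩)
    · rintro ⟨_, rfl⟩; rfl
    · rintro rfl; exact ⟨(), rfl⟩
  simp only [h2, Finset.prod_const_one, mul_ite, mul_one, mul_zero]
  simp
  rfl

/-- One gate per qubit: the factors are switched on one at a time along a growing set of qubits. -/
theorem GateProd.piOp {h : ι → Matrix (ZMod 2) (ZMod 2) ℂ}
    (hh : ∀ j, h j ∈ Matrix.unitaryGroup (ZMod 2) ℂ) :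
    GateProd (Fintype.card ι) (BHRD.piOp h) := by
  have key : ∀ s : Finset ι, GateProd s.card (BHRD.piOp fun j => if j ∈ s then h j else 1) := by
    intro s
    induction s using Finset.induction_on with
    | empty =>
      simp only [Finset.notMem_empty, if_false]
      exact (piOp_one (ι := ι)) ▸ GateProd.one _
    | insert a s ha ih =>
      have : (BHRD.piOp fun j => if j ∈ insert a s then h j else 1) =
          BHRD.piOp (Pi.mulSingle a (h a)) * BHRD.piOp fun j => if j ∈ s then h j else 1 := by
        rw [piOp_mul]
        congr 1
        funext j
        by_cases hj : j = a
        · subst hj; simp [ha]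
        · simp [hj]
      rw [this, Finset.card_insert_of_notMem ha, add_comm, piOp_mulSingle]
      exact ((GateProd.single (by simp) (piOp_mem_unitaryGroup fun _ => hh a)).place _).mul ih
  simpa using key Finset.univ

end Gates

/-! ### Permutations of the computational basis -/

section BasisPerm

variable {ι κ : Type} [Fintype ι] [DecidableEq ι] [Fintype κ] [DecidableEq κ]

/-- The unitary `|v⟩ ↦ |π v⟩`. -/
def basisPerm (π : Equiv.Perm (Bits ι)) : Op ι :=
  Matrix.of fun u v => if π.symm u = v then 1 else 0

theorem basisPerm_apply (π : Equiv.Perm (Bits ι)) (u v : Bits ι) :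
    basisPerm π u v = if π.symm u = v then 1 else 0 := rfl

theorem basisPerm_conjTranspose (π : Equiv.Perm (Bits ι)) :
    (basisPerm π)ᴴ = basisPerm π.symm := by
  ext u v
  simp only [Matrix.conjTranspose_apply, basisPerm_apply, Equiv.symm_symm]
  rw [apply_ite star, star_one, star_zero]
  exact if_congr (by rw [Equiv.symm_apply_eq, eq_comm]) rfl rfl

theorem basisPerm_mul_apply (π : Equiv.Perm (Bits ι)) (ρ : Op ι) (u v : Bits ι) :
    (basisPerm π * ρ) u v = ρ (π.symm u) v := by
  simp [Matrix.mul_apply, basisPerm_apply]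

theorem mul_basisPerm_conjTranspose_apply (π : Equiv.Perm (Bits ι)) (ρ : Op ι) (u v : Bits ι) :
    (ρ * (basisPerm π)ᴴ) u v = ρ u (π.symm v) := by
  simp [Matrix.mul_apply, basisPerm_apply, Matrix.conjTranspose_apply, apply_ite star]

theorem basisPerm_conj_apply (π : Equiv.Perm (Bits ι)) (ρ : Op ι) (u v : Bits ι) :
    (basisPerm π * ρ * (basisPerm π)ᴴ) u v = ρ (π.symm u) (π.symm v) := by
  rw [mul_basisPerm_conjTranspose_apply, basisPerm_mul_apply]

theorem basisPerm_mul (π π' : Equiv.Perm (Bits ι)) :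
    basisPerm π * basisPerm π' = basisPerm (π * π') := by
  ext u v
  rw [basisPerm_mul_apply]
  rfl

theorem basisPerm_one : basisPerm (1 : Equiv.Perm (Bits ι)) = 1 := by
  ext u v
  rw [basisPerm_apply, Matrix.one_apply]
  rfl

theorem basisPerm_mem_unitaryGroup (π : Equiv.Perm (Bits ι)) :
    basisPerm π ∈ Matrix.unitaryGroup (Bits ι) ℂ := by
  rw [Matrix.mem_unitaryGroup_iff, Matrix.star_eq_conjTranspose, basisPerm_conjTranspose,
    basisPerm_mul, ← basisPerm_one]
  congr 1
  exact mul_inv_cancel π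

/-- The permutation of basis states given by a permutation of the qubits. -/
def wirePerm (σ : Equiv.Perm ι) : Equiv.Perm (Bits ι) := (bitsEquiv σ).symm

theorem wirePerm_symm_apply (σ : Equiv.Perm ι) (u : Bits ι) : (wirePerm σ).symm u = u ∘ σ := rfl

theorem wirePerm_mul (σ τ : Equiv.Perm ι) : wirePerm (σ * τ) = wirePerm σ * wirePerm τ := by
  ext u : 1
  rfl

theorem relabel_eq_conj (σ : Equiv.Perm ι) (ρ : Op ι) :
    relabel σ ρ = basisPerm (wirePerm σ) * ρ * (basisPerm (wirePerm σ))ᴴ := by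
  ext u v
  rw [basisPerm_conj_apply]
  rfl

theorem gateProd_wirePerm_swap (i j : ι) :
    GateProd 1 (basisPerm (wirePerm (Equiv.swap i j))) := by
  by_cases hij : i = j
  · subst hij
    rw [Equiv.swap_self]
    exact (basisPerm_one (ι := ι)) ▸ GateProd.one 1
  let S : Fin 2 ↪ ι := ⟨![i, j], by
    intro a b
    fin_cases a <;> fin_cases b <;> simp [hij, Ne.symm hij]⟩
  have hS0 : S 0 = i := rfl
  have hS1 : S 1 = j := rfl
  have h : basisPerm (wirePerm (Equiv.swap i j)) =
      place S (basisPerm (wirePerm (Equiv.swap 0 1))) := by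
    classical
    ext u v
    rw [place_apply, basisPerm_apply, basisPerm_apply, wirePerm_symm_apply, wirePerm_symm_apply,
      ← ite_and]
    refine if_congr ?_ rfl rfl
    have hS : ∀ k, k ∉ Set.range S ↔ k ≠ i ∧ k ≠ j := by
      intro k
      constructor
      · intro hk
        exact ⟨fun h => hk ⟨0, h.symm⟩, fun h => hk ⟨1, h.symm⟩⟩
      · rintro ⟨h1, h2⟩ ⟨a, rfl⟩
        fin_cases a
        · exact h1 rfl
        · exact h2 rfl
    simp only [hS]
    constructor
    · rintro rfl
      refine ⟨fun k hk => ?_, ?_⟩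
      · simp [Equiv.swap_apply_of_ne_of_ne hk.1 hk.2]
      · ext a
        fin_cases a <;> simp [hS0, hS1]
    · rintro ⟨h1, h2⟩
      ext k
      by_cases hi : k = i
      · subst hi; simpa [hS0, hS1] using congrFun h2 0
      by_cases hj : k = j
      · subst hj; simpa [hS0, hS1] using congrFun h2 1
      simpa [Equiv.swap_apply_of_ne_of_ne hi hj] using h1 k ⟨hi, hj⟩
  rw [h]
  exact (GateProd.single (by simp) (basisPerm_mem_unitaryGroup _)).place S

/-- Multiplying by the swap of `a` and `σ a` makes `a` a fixed point, so one gate shrinks the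
possible support by one point. This is the price of matching wire orders when circuits are composed.
-/
theorem gateProd_wirePerm (σ : Equiv.Perm ι) :
    GateProd (Fintype.card ι) (basisPerm (wirePerm σ)) := by
  have key : ∀ (s : Finset ι) (σ : Equiv.Perm ι), (∀ x ∉ s, σ x = x) →
      GateProd s.card (basisPerm (wirePerm σ)) := by
    intro s
    induction s using Finset.induction_on with
    | empty =>
      intro σ hσ
      have : σ = 1 := by ext x; exact hσ x (by simp)
      subst this
      exact (basisPerm_one (ι := ι)) ▸ GateProd.one 0
    | insert a s ha ih =>
      intro σ hσ
      have h1 : σ = Equiv.swap a (σ a) * (Equiv.swap a (σ a) * σ) := by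
        rw [← mul_assoc, Equiv.swap_mul_self, one_mul]
      rw [Finset.card_insert_of_notMem ha, add_comm, h1, wirePerm_mul, ← basisPerm_mul]
      refine (gateProd_wirePerm_swap _ _).mul (ih _ fun x hx => ?_)
      by_cases hxa : x = a
      · subst hxa; simp
      · have hx' : σ x = x := hσ x (by simp [hxa, hx])
        rw [Equiv.Perm.mul_apply, hx', Equiv.swap_apply_of_ne_of_ne hxa]
        intro h
        exact hxa (σ.injective (hx'.trans h))
  exact key Finset.univ σ fun x hx => absurd (Finset.mem_univ x) hx

end BasisPerm

/-! ### Kraus decompositions -/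

theorem sum_zmod_two {M : Type*} [AddCommMonoid M] (f : ZMod 2 → M) : ∑ x, f x = f 0 + f 1 :=
  Fin.sum_univ_two f

section Kraus

variable {ι κ μ : Type} [Fintype ι] [DecidableEq ι] [Fintype κ] [DecidableEq κ]
  [Fintype μ] [DecidableEq μ]

/-- The map `Φ` has a Kraus decomposition. -/
def IsKraus (Φ : Op ι → Op κ) : Prop :=
  ∃ (α : Type) (_ : Fintype α) (K : α → Matrix (Bits κ) (Bits ι) ℂ),
    (∀ ρ, Φ ρ = ∑ a, K a * ρ * (K a)ᴴ) ∧ ∑ a, (K a)ᴴ * K a = 1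

theorem IsKraus.single {Φ : Op ι → Op κ} (K : Matrix (Bits κ) (Bits ι) ℂ)
    (h : ∀ ρ, Φ ρ = K * ρ * Kᴴ) (hK : Kᴴ * K = 1) : IsKraus Φ :=
  ⟨Unit, inferInstance, fun _ => K, by simpa using h, by simpa using hK⟩

theorem IsKraus.comp {Ψ : Op κ → Op μ} {Φ : Op ι → Op κ} (hΨ : IsKraus Ψ) (hΦ : IsKraus Φ) :
    IsKraus (Ψ ∘ Φ) := by
  obtain ⟨α, _, K, hK, hK1⟩ := hΨ
  obtain ⟨β, _, L, hL, hL1⟩ := hΦ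
  refine ⟨β × α, inferInstance, fun p => K p.2 * L p.1, fun ρ => ?_, ?_⟩
  · rw [Function.comp_apply, hK, hL, Fintype.sum_prod_type_right]
    refine Finset.sum_congr rfl fun a _ => ?_
    rw [Matrix.mul_sum, Matrix.sum_mul]
    refine Finset.sum_congr rfl fun b _ => ?_
    simp only [Matrix.conjTranspose_mul, Matrix.mul_assoc]
  · rw [Fintype.sum_prod_type]
    rw [← hL1]
    refine Finset.sum_congr rfl fun b _ => ?_
    calc ∑ a, (K a * L b)ᴴ * (K a * L b) = (L b)ᴴ * (∑ a, (K a)ᴴ * K a) * L b := by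
          rw [Matrix.mul_sum, Matrix.sum_mul]
          refine Finset.sum_congr rfl fun a _ => ?_
          simp only [Matrix.conjTranspose_mul, Matrix.mul_assoc]
      _ = (L b)ᴴ * L b := by rw [hK1, Matrix.mul_one]

theorem IsKraus.map_add {Φ : Op ι → Op κ} (h : IsKraus Φ) (ρ σ : Op ι) :
    Φ (ρ + σ) = Φ ρ + Φ σ := by
  obtain ⟨α, _, K, hK, -⟩ := h
  simp only [hK, Matrix.mul_add, Matrix.add_mul, Finset.sum_add_distrib]

theorem IsKraus.map_smul {Φ : Op ι → Op κ} (h : IsKraus Φ) (c : ℂ) (ρ : Op ι) :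
    Φ (c • ρ) = c • Φ ρ := by
  obtain ⟨α, _, K, hK, -⟩ := h
  simp only [hK, Matrix.mul_smul, Matrix.smul_mul, Finset.smul_sum]

theorem IsKraus.trace_map {Φ : Op ι → Op κ} (h : IsKraus Φ) (ρ : Op ι) :
    (Φ ρ).trace = ρ.trace := by
  obtain ⟨α, _, K, hK, hK1⟩ := h
  rw [hK, Matrix.trace_sum]
  calc ∑ a, (K a * ρ * (K a)ᴴ).trace = ((∑ a, (K a)ᴴ * K a) * ρ).trace := by
        rw [Matrix.sum_mul, Matrix.trace_sum]
        refine Finset.sum_congr rfl fun a _ => ?_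
        rw [Matrix.trace_mul_comm, Matrix.mul_assoc]
    _ = ρ.trace := by rw [hK1, Matrix.one_mul]

/-- The map `Φ ⊗ id`. -/
def ampl (Φ : Op ι → Op κ) (ρ : Op (ι ⊕ μ)) : Op (κ ⊕ μ) :=
  Matrix.of fun u v =>
    Φ (Matrix.of fun i j => ρ (Sum.elim i (u ∘ Sum.inr)) (Sum.elim j (v ∘ Sum.inr)))
      (u ∘ Sum.inl) (v ∘ Sum.inl)

/-- The operator `K ⊗ 1`. -/
def extendKraus (μ : Type) [Fintype μ] [DecidableEq μ] (K : Matrix (Bits κ) (Bits ι) ℂ) :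
    Matrix (Bits (κ ⊕ μ)) (Bits (ι ⊕ μ)) ℂ :=
  Matrix.of fun u v => if u ∘ Sum.inr = v ∘ Sum.inr then K (u ∘ Sum.inl) (v ∘ Sum.inl) else 0

theorem extendKraus_elim (K : Matrix (Bits κ) (Bits ι) ℂ) (u : Bits (κ ⊕ μ)) (a : Bits ι)
    (b : Bits μ) :
    extendKraus μ K u (Sum.elim a b) = if u ∘ Sum.inr = b then K (u ∘ Sum.inl) a else 0 := rfl

theorem extendKraus_mul_apply (K : Matrix (Bits κ) (Bits ι) ℂ) (ρ : Op (ι ⊕ μ))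
    (u : Bits (κ ⊕ μ)) (v : Bits (ι ⊕ μ)) :
    (extendKraus μ K * ρ) u v = ∑ i, K (u ∘ Sum.inl) i * ρ (Sum.elim i (u ∘ Sum.inr)) v := by
  simp only [Matrix.mul_apply, sum_bits_sum, extendKraus_elim, ite_mul, zero_mul,
    Finset.sum_ite_eq, Finset.mem_univ, if_true]

theorem extendKraus_conj_apply (K : Matrix (Bits κ) (Bits ι) ℂ) (ρ : Op (ι ⊕ μ))
    (u v : Bits (κ ⊕ μ)) :
    (extendKraus μ K * ρ * (extendKraus μ K)ᴴ) u v =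
      (K * (Matrix.of fun i j => ρ (Sum.elim i (u ∘ Sum.inr)) (Sum.elim j (v ∘ Sum.inr))) * Kᴴ)
        (u ∘ Sum.inl) (v ∘ Sum.inl) := by
  rw [Matrix.mul_apply, sum_bits_sum, Matrix.mul_apply]
  refine Finset.sum_congr rfl fun i _ => ?_
  simp only [extendKraus_mul_apply, Matrix.conjTranspose_apply, extendKraus_elim,
    apply_ite star, star_zero, mul_ite, mul_zero, Finset.sum_ite_eq, Finset.mem_univ, if_true]
  rfl

/-- The Kraus operators of `Φ ⊗ id` are `K a ⊗ 1`, so complete positivity comes from the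
decomposition. Circuits therefore implement genuine channels. -/
theorem IsKraus.posSemidef_ampl {Φ : Op ι → Op κ} (h : IsKraus Φ) {ρ : Op (ι ⊕ μ)}
    (hρ : ρ.PosSemidef) : (ampl Φ ρ).PosSemidef := by
  obtain ⟨α, _, K, hK, -⟩ := h
  have : ampl Φ ρ = ∑ a, extendKraus μ (K a) * ρ * (extendKraus μ (K a))ᴴ := by
    ext u v
    simp only [ampl, hK, Matrix.of_apply, Matrix.sum_apply]
    exact Finset.sum_congr rfl fun a _ => (extendKraus_conj_apply _ _ _ _).symm
  rw [this]
  exact Matrix.posSemidef_sum _ fun a _ => hρ.mul_mul_conjTranspose_same _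

/-- The channel with a given Kraus decomposition. -/
def IsKraus.channel {Φ : Op ι → Op κ} (h : IsKraus Φ) : Channel ι κ where
  map := { toFun := Φ, map_add' := h.map_add, map_smul' := h.map_smul }
  trace_map := h.trace_map
  completelyPositive _ _ hρ := h.posSemidef_ampl hρ

theorem isKraus_conj {U : Op ι} (hU : U ∈ Matrix.unitaryGroup (Bits ι) ℂ) :
    IsKraus fun ρ => U * ρ * Uᴴ :=
  .single U (fun _ => rfl) (Matrix.mem_unitaryGroup_iff'.1 hU)

theorem isKraus_relabel (e : ι ≃ κ) : IsKraus (relabel e) := by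
  refine .single ((1 : Op ι).submatrix (bitsEquiv e) id) (fun ρ => ?_) ?_
  · rw [relabel_eq_submatrix]
    rw [Matrix.conjTranspose_submatrix, Matrix.conjTranspose_one]
    ext u v
    simp [Matrix.mul_apply, Matrix.one_apply]
  · rw [Matrix.conjTranspose_submatrix, Matrix.conjTranspose_one,
      Matrix.submatrix_mul_equiv, Matrix.one_mul, Matrix.submatrix_id_id]

theorem isKraus_addZero {n : ℕ} : IsKraus (addZero (n := n)) := by
  refine .single (Matrix.of fun u w => if u (Fin.last n) = 0 ∧ (fun i => u i.castSucc) = w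
    then 1 else 0) (fun ρ => ?_) ?_
  · ext u v
    by_cases hu : u (Fin.last n) = 0 <;> by_cases hv : v (Fin.last n) = 0 <;>
      simp [addZero, Matrix.mul_apply, hu, hv, Matrix.conjTranspose_apply, apply_ite star]
  · ext u v
    simp only [Matrix.mul_apply, Matrix.of_apply, Matrix.conjTranspose_apply,
      Matrix.one_apply, apply_ite star, star_one, star_zero]
    rw [← (Fin.snocEquiv fun _ : Fin (n + 1) => ZMod 2).sum_comp, Fintype.sum_prod_type]
    simp only [Fin.snocEquiv_apply, Fin.snoc_last, Fin.snoc_castSucc]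
    rw [sum_zmod_two]
    simp [eq_comm]

theorem isKraus_dropLast {n : ℕ} : IsKraus (dropLast (n := n)) := by
  refine ⟨ZMod 2, inferInstance, fun b => Matrix.of fun u w =>
    if Fin.snoc (α := fun _ => ZMod 2) u b = w then 1 else 0, fun ρ => ?_, ?_⟩
  · ext u v
    simp [dropLast, Matrix.sum_apply, Matrix.mul_apply, Matrix.conjTranspose_apply,
      apply_ite star]
  · ext u v
    simp only [Matrix.mul_apply, Matrix.of_apply, Matrix.conjTranspose_apply, Matrix.sum_apply,
      Matrix.one_apply, apply_ite star, star_one, star_zero]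
    have := (Fin.snocEquiv fun _ : Fin (n + 1) => ZMod 2).sum_comp
      fun w => (if w = u then (1 : ℂ) else 0) * if w = v then 1 else 0
    rw [Fintype.sum_prod_type] at this
    refine this.trans ?_
    simp [eq_comm]

end Kraus

/-! ### Composition of circuits -/

namespace Circuit

/-- Sequential composition. -/
def append : {n m l : ℕ} → Circuit n m → Circuit m l → Circuit n l
  | _, _, _, .nil _, D => D
  | _, _, _, .gate hk S U C, D => .gate hk S U (C.append D)
  | _, _, _, .init C, D => .init (C.append D)
  | _, _, _, .discard C, D => .discard (C.append D)

theorem size_append {n m l : ℕ} (C : Circuit n m) (D : Circuit m l) :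
    (C.append D).size = C.size + D.size := by
  induction C with
  | nil n => simp [append, size]
  | gate hk S U C ih => simp [append, size, ih]; omega
  | init C ih => simp [append, size, ih]; omega
  | discard C ih => simp [append, size, ih]; omega

theorem run_append {n m l : ℕ} (C : Circuit n m) (D : Circuit m l) (ρ : Op (Fin n)) :
    (C.append D).run ρ = D.run (C.run ρ) := by
  induction C with
  | nil n => rfl
  | gate hk S U C ih => exact ih _ _
  | init C ih => exact ih _ _
  | discard C ih => exact ih _ _

theorem isKraus_run {n m : ℕ} (C : Circuit n m) : IsKraus C.run := by
  induction C with
  | nil n => exact isKraus_relabel (Equiv.refl _)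
  | gate hk S U C ih =>
    exact ih.comp (isKraus_conj (by rw [onWires_eq_place]; exact place_mem_unitaryGroup S U.2))
  | init C ih => exact ih.comp isKraus_addZero
  | discard C ih => exact ih.comp isKraus_dropLast

/-- An operation changes the number of wires by at most one. Through this bound, register sizes, and
`n` itself, are controlled by complexities. -/
theorem width_le {n m : ℕ} (C : Circuit n m) : n ≤ m + C.size ∧ m ≤ n + C.size := by
  induction C with
  | nil n => simp
  | gate hk S U C ih => simp only [size]; omega
  | init C ih => simp only [size]; omega
  | discard C ih => simp only [size]; omega

/-- The circuit `C` on the last wires, with `k` further wires in front. -/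
def lift (k : ℕ) : {n m : ℕ} → Circuit n m → Circuit (k + n) (k + m)
  | _, _, .nil n => .nil (k + n)
  | _, _, .gate hk S U C => .gate hk (S.trans (Fin.natAddEmb k)) U (lift k C)
  | _, _, .init C => .init (lift k C)
  | _, _, .discard C => .discard (lift k C)

theorem size_lift (k : ℕ) {n m : ℕ} (C : Circuit n m) : (C.lift k).size = C.size := by
  induction C with
  | nil n => rfl
  | gate hk S U C ih => simp only [lift, size, ih]
  | init C ih => simp only [lift, size]; rw [← ih]
  | discard C ih => simp only [lift, size]; rw [← ih]

/-- The block of an operator at two fixed values of the first `k` wires. -/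
def block {k n : ℕ} (ρ : Op (Fin (k + n))) (a b : Bits (Fin k)) : Op (Fin n) :=
  Matrix.of fun u v => ρ (Fin.append a u) (Fin.append b v)

theorem append_eq_sumElim {k n : ℕ} (a : Bits (Fin k)) (u : Bits (Fin n)) :
    (Fin.append a u : Bits (Fin (k + n))) = Sum.elim a u ∘ finSumFinEquiv.symm := by
  ext i
  refine Fin.addCases (fun i => ?_) (fun i => ?_) i <;> simp

theorem sum_bits_append {M : Type*} [AddCommMonoid M] {k n : ℕ} (f : Bits (Fin (k + n)) → M) :
    ∑ u, f u = ∑ a : Bits (Fin k), ∑ b : Bits (Fin n), f (Fin.append a b) := by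
  rw [← sum_bits_equiv finSumFinEquiv.symm f, sum_bits_sum]
  simp only [append_eq_sumElim]

theorem place_natAdd_append {k n j : ℕ} (S : Fin j ↪ Fin n) (U : Op (Fin j))
    (a b : Bits (Fin k)) (u v : Bits (Fin n)) :
    place (S.trans (Fin.natAddEmb k)) U (Fin.append a u) (Fin.append b v) =
      if a = b then place S U u v else 0 := by
  have h : place (S.trans (Fin.natAddEmb k)) U =
      relabel finSumFinEquiv (tensor 1 (place S U)) := by
    rw [one_tensor_eq_place, relabel_eq_place, place_place, place_place]
    congr 1
  have h2 : ∀ (a : Bits (Fin k)) (u : Bits (Fin n)),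
      (Fin.append a u : Bits (Fin (k + n))) ∘ finSumFinEquiv = Sum.elim a u := by
    intro a u
    rw [append_eq_sumElim, Function.comp_assoc, Equiv.symm_comp_self, Function.comp_id]
  rw [h, relabel_apply, h2, h2, tensor_apply]
  rw [Matrix.one_apply, ite_mul, one_mul, zero_mul]
  exact if_congr Iff.rfl rfl rfl

theorem block_conj {k n j : ℕ} (S : Fin j ↪ Fin n) (U : Op (Fin j)) (ρ : Op (Fin (k + n)))
    (a b : Bits (Fin k)) :
    block (place (S.trans (Fin.natAddEmb k)) U * ρ * (place (S.trans (Fin.natAddEmb k)) U)ᴴ) a b =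
      place S U * block ρ a b * (place S U)ᴴ := by
  ext u v
  rw [Matrix.mul_apply]
  simp only [block, Matrix.of_apply, Matrix.mul_apply, sum_bits_append, place_natAdd_append,
    Matrix.conjTranspose_apply, ite_mul, zero_mul, apply_ite star, star_zero, mul_ite, mul_zero]
  rw [Finset.sum_comm]
  simp only [Finset.sum_ite_eq, Finset.mem_univ, if_true]
  refine Finset.sum_congr rfl fun i _ => ?_
  congr 1
  rw [Finset.sum_comm]
  simp only [Finset.sum_ite_eq, Finset.mem_univ, if_true]

theorem append_last {k n : ℕ} (a : Bits (Fin k)) (u : Bits (Fin (n + 1))) :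
    (Fin.append a u : Fin (k + (n + 1)) → ZMod 2) (Fin.last (k + n)) = u (Fin.last n) :=
  Fin.append_right a u (Fin.last n)

theorem append_castSucc {k n : ℕ} (a : Bits (Fin k)) (u : Bits (Fin (n + 1))) :
    (fun i : Fin (k + n) => (Fin.append a u : Fin (k + (n + 1)) → ZMod 2) i.castSucc) =
      Fin.append a fun i => u i.castSucc := by
  ext i
  refine Fin.addCases (fun i => ?_) (fun i => ?_) i
  · rw [Fin.append_left]
    exact Fin.append_left a u i
  · rw [Fin.append_right]
    exact Fin.append_right a u i.castSucc

theorem block_addZero {k n : ℕ} (ρ : Op (Fin (k + n))) (a b : Bits (Fin k)) :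
    block (k := k) (n := n + 1) (addZero ρ) a b = addZero (block ρ a b) := by
  ext u v
  exact if_congr (and_congr (iff_of_eq (congrArg (· = 0) (append_last a u)))
    (iff_of_eq (congrArg (· = 0) (append_last b v))))
    (congrArg₂ ρ (append_castSucc a u) (append_castSucc b v)) rfl

theorem block_dropLast {k n : ℕ} (ρ : Op (Fin (k + (n + 1)))) (a b : Bits (Fin k)) :
    block (dropLast (n := k + n) ρ) a b = dropLast (block ρ a b) := by
  ext u v
  simp only [block, dropLast, Matrix.of_apply]
  refine Finset.sum_congr rfl fun c _ => ?_
  rw [Fin.append_snoc, Fin.append_snoc]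

/-- A circuit that leaves the first `k` wires alone acts on each block separately. This is what
identifies the lifted circuit with `id ⊗ Φ`. -/
theorem block_run_lift (k : ℕ) {n m : ℕ} (C : Circuit n m) (ρ : Op (Fin (k + n)))
    (a b : Bits (Fin k)) : block ((C.lift k).run ρ) a b = C.run (block ρ a b) := by
  induction C with
  | nil n => rfl
  | gate hk S U C ih =>
    simp only [lift, run]
    rw [ih, onWires_eq_place, onWires_eq_place, block_conj]
  | init C ih => simp only [lift, run]; rw [← block_addZero]; exact ih _
  | discard C ih => simp only [lift, run]; rw [← block_dropLast]; exact ih _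

end Circuit

theorem GateProd.exists_circuit {n c : ℕ} {M : Op (Fin n)} (h : GateProd c M) :
    ∃ C : Circuit n n, C.size ≤ c ∧ ∀ ρ, C.run ρ = M * ρ * Mᴴ := by
  induction h with
  | one c => exact ⟨.nil n, Nat.zero_le _, fun ρ => by simp [Circuit.run]⟩
  | cons hk S U hM ih =>
    obtain ⟨C, hC, hr⟩ := ih
    refine ⟨C.append (.gate hk S U (.nil n)), ?_, fun ρ => ?_⟩
    · rw [Circuit.size_append]
      simpa [Circuit.size] using hC
    · rw [Circuit.run_append, hr]
      simp only [Circuit.run, onWires_eq_place, Matrix.conjTranspose_mul, Matrix.mul_assoc]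

/-- The circuit that discards the last `k` wires. -/
def discards (n : ℕ) : (k : ℕ) → Circuit (n + k) n
  | 0 => .nil n
  | k + 1 => .discard (discards n k)

theorem size_discards (n k : ℕ) : (discards n k).size = k := by
  induction k with
  | zero => rfl
  | succ k ih => simp only [discards, Circuit.size, ih]

theorem run_discards (n k : ℕ) (ρ : Op (Fin (n + k))) (u v : Bits (Fin n)) :
    (discards n k).run ρ u v =
      ∑ w : Bits (Fin k), ρ (Fin.append u w) (Fin.append v w) := by
  induction k with
  | zero =>
    have h : ∀ (u : Bits (Fin n)) (w : Bits (Fin 0)),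
        (Fin.append u w : Bits (Fin (n + 0))) = u :=
      fun u w => Fin.append_right_nil u w rfl
    rw [Fintype.sum_unique]
    exact (congrArg₂ ρ (h u _) (h v _)).symm
  | succ k ih =>
    simp only [discards, Circuit.run]
    rw [ih, ← (Fin.snocEquiv fun _ : Fin (k + 1) => ZMod 2).sum_comp, Fintype.sum_prod_type_right]
    refine Finset.sum_congr rfl fun w _ => ?_
    simp only [dropLast, Matrix.of_apply]
    exact Finset.sum_congr rfl fun b _ =>
      congrArg₂ ρ (Fin.append_snoc u w b).symm (Fin.append_snoc v w b).symm

/-- The circuit that introduces `k` wires. -/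
def inits : (k : ℕ) → Circuit 0 k
  | 0 => .nil 0
  | k + 1 => (inits k).append (.init (.nil (k + 1)))

theorem size_inits (k : ℕ) : (inits k).size = k := by
  induction k with
  | zero => rfl
  | succ k ih => simp only [inits, Circuit.size_append, Circuit.size, ih]

theorem run_inits (k : ℕ) : (inits k).run 1 = basisProj 0 := by
  induction k with
  | zero =>
    ext u v
    simp only [inits, Circuit.run, basisProj_apply, Subsingleton.elim u 0, Subsingleton.elim v 0]
    simp
  | succ k ih =>
    simp only [inits, Circuit.run_append, Circuit.run, ih]
    have h : ∀ u : Bits (Fin (k + 1)),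
        0 = u ↔ u (Fin.last k) = 0 ∧ 0 = fun i : Fin k => u i.castSucc := by
      intro u
      constructor
      · rintro rfl; exact ⟨rfl, rfl⟩
      · rintro ⟨h1, h2⟩
        ext i
        refine Fin.lastCases h1.symm (fun i => congrFun h2 i) i
    ext u v
    simp only [addZero, basisProj_apply, Matrix.of_apply]
    rw [← ite_and]
    exact if_congr (by rw [h u, h v]; tauto) rfl rfl

/-! ### Maps implemented by circuits of bounded size -/

section Impl

variable {ι κ μ ν : Type} [Fintype ι] [DecidableEq ι] [Fintype κ] [DecidableEq κ]
  [Fintype μ] [DecidableEq μ] [Fintype ν] [DecidableEq ν]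

/-- The map `Φ` is implemented by a circuit of size at most `N`. -/
def Impl (N : ℕ) (Φ : Op ι → Op κ) : Prop :=
  ∃ (n m : ℕ) (C : Circuit n m) (e : ι ≃ Fin n) (f : κ ≃ Fin m),
    C.size ≤ N ∧ ∀ ρ, relabel f (Φ ρ) = C.run (relabel e ρ)

/-- The state `ω` is generated by a circuit of size at most `N`. -/
def GenState (N : ℕ) (ω : Op κ) : Prop :=
  ∃ (m : ℕ) (C : Circuit 0 m) (f : κ ≃ Fin m), C.size ≤ N ∧ relabel f ω = C.run 1

namespace Impl

theorem mono {N M : ℕ} {Φ : Op ι → Op κ} (h : Impl N Φ) (hNM : N ≤ M) : Impl M Φ := by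
  obtain ⟨n, m, C, e, f, hC, hr⟩ := h
  exact ⟨n, m, C, e, f, hC.trans hNM, hr⟩

theorem conj {c : ℕ} {U : Op ι} (hU : GateProd c U) : Impl c fun ρ => U * ρ * Uᴴ := by
  let e := Fintype.equivFin ι
  obtain ⟨C, hC, hr⟩ := (hU.relabel e).exists_circuit
  refine ⟨_, _, C, e, e, hC, fun ρ => ?_⟩
  rw [hr, relabel_mul, relabel_mul, relabel_conjTranspose]

/-- The two circuits may number the qubits of `κ` differently; the wire permutation inserted between
them accounts for the summand `Fintype.card κ`. -/
theorem comp {N M : ℕ} {Ψ : Op κ → Op μ} {Φ : Op ι → Op κ} (hΨ : Impl N Ψ) (hΦ : Impl M Φ) :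
    Impl (N + M + Fintype.card κ) fun ρ => Ψ (Φ ρ) := by
  obtain ⟨n, m, C, e, f, hC, hr⟩ := hΦ
  obtain ⟨m', l, D, e', f', hD, hr'⟩ := hΨ
  obtain rfl : m = m' := by
    have h1 := Fintype.card_congr f
    have h2 := Fintype.card_congr e'
    simp only [Fintype.card_fin] at h1 h2
    omega
  obtain ⟨P, hP, hrP⟩ := (gateProd_wirePerm (f.symm.trans e')).exists_circuit
  refine ⟨n, l, C.append (P.append D), e, f', ?_, fun ρ => ?_⟩
  · rw [Circuit.size_append, Circuit.size_append]
    have h1 := Fintype.card_congr f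
    simp only [Fintype.card_fin] at h1 hP
    omega
  · rw [Circuit.run_append, Circuit.run_append, hrP, ← hr, ← relabel_eq_conj, hr',
      relabel_relabel]
    congr 2
    ext i
    simp

theorem relabel_comp {N : ℕ} {Φ : Op ι → Op κ} (h : Impl N Φ) (g : κ ≃ μ) :
    Impl N fun ρ => BHRD.relabel g (Φ ρ) := by
  obtain ⟨n, m, C, e, f, hC, hr⟩ := h
  refine ⟨n, m, C, e, g.symm.trans f, hC, fun ρ => ?_⟩
  rw [← hr, relabel_relabel, ← Equiv.trans_assoc, Equiv.self_trans_symm, Equiv.refl_trans]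

theorem comp_relabel {N : ℕ} {Φ : Op ι → Op κ} (h : Impl N Φ) (g : μ ≃ ι) :
    Impl N fun ρ => Φ (BHRD.relabel g ρ) := by
  obtain ⟨n, m, C, e, f, hC, hr⟩ := h
  exact ⟨n, m, C, g.trans e, f, hC, fun ρ => by rw [hr, relabel_relabel]⟩

theorem traceRight : Impl (Fintype.card κ) (BHRD.traceRight : Op (ι ⊕ κ) → Op ι) := by
  let e := Fintype.equivFin ι
  let f := Fintype.equivFin κ
  refine ⟨_, _, discards (Fintype.card ι) (Fintype.card κ),
    (Equiv.sumCongr e f).trans finSumFinEquiv, e, (size_discards _ _).le, fun ρ => ?_⟩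
  ext u v
  rw [run_discards]
  simp only [relabel_apply, BHRD.traceRight, Matrix.of_apply]
  rw [← sum_bits_equiv f]
  refine Finset.sum_congr rfl fun w _ => ?_
  congr 1 <;>
  · ext (i | i) <;> simp

theorem ampl {N : ℕ} {Φ : Op ι → Op κ} (h : Impl N Φ) :
    Impl N (ampl Φ : Op (ι ⊕ μ) → Op (κ ⊕ μ)) := by
  obtain ⟨n, m, C, e, f, hC, hr⟩ := h
  let g := Fintype.equivFin μ
  refine ⟨_, _, C.lift (Fintype.card μ),
    (Equiv.sumComm _ _).trans ((Equiv.sumCongr g e).trans finSumFinEquiv),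
    (Equiv.sumComm _ _).trans ((Equiv.sumCongr g f).trans finSumFinEquiv),
    (C.size_lift _).trans_le hC, fun ρ => ?_⟩
  have key : ∀ (a b : Bits (Fin (Fintype.card μ))) (u v : Bits (Fin m)),
      BHRD.relabel ((Equiv.sumComm _ _).trans ((Equiv.sumCongr g f).trans finSumFinEquiv))
        (BHRD.ampl Φ ρ) (Fin.append a u) (Fin.append b v) =
      Circuit.block ((C.lift (Fintype.card μ)).run (BHRD.relabel
        ((Equiv.sumComm _ _).trans ((Equiv.sumCongr g e).trans finSumFinEquiv)) ρ)) a b u v := by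
    intro a b u v
    rw [Circuit.block_run_lift]
    have h1 : Circuit.block (BHRD.relabel
        ((Equiv.sumComm _ _).trans ((Equiv.sumCongr g e).trans finSumFinEquiv)) ρ) a b =
        BHRD.relabel e (Matrix.of fun i j => ρ (Sum.elim i (a ∘ g)) (Sum.elim j (b ∘ g))) := by
      ext u v
      simp only [Circuit.block, relabel_apply, Matrix.of_apply]
      congr 1 <;>
      · ext (i | i) <;> simp
    rw [h1, ← hr]
    simp only [relabel_apply, BHRD.ampl, Matrix.of_apply]
    refine congr (congr (congrArg Φ ?_) ?_) ?_
    · ext i j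
      refine congrArg₂ ρ ?_ ?_ <;> congr 1 <;> ext k <;> simp
    · ext k; simp
    · ext k; simp
  ext u v
  have hu : ∀ w : Bits (Fin (Fintype.card μ + m)),
      Fin.append (fun i => w (Fin.castAdd m i)) (fun i => w (Fin.natAdd _ i)) = w :=
    fun w => Fin.append_castAdd_natAdd
  rw [← hu u, ← hu v]
  exact key _ _ _ _

theorem isKraus {N : ℕ} {Φ : Op ι → Op κ} (h : Impl N Φ) : IsKraus Φ := by
  obtain ⟨n, m, C, e, f, -, hr⟩ := h
  have : Φ = BHRD.relabel f.symm ∘ C.run ∘ BHRD.relabel e := by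
    ext1 ρ
    simp only [Function.comp_apply, ← hr, relabel_symm_relabel]
  rw [this]
  exact (isKraus_relabel _).comp (C.isKraus_run.comp (isKraus_relabel _))

theorem complexity_le {N : ℕ} {Φ : Channel ι κ} (h : Impl N Φ.map) :
    complexity Φ ≤ N := by
  obtain ⟨n, m, C, e, f, hC, hr⟩ := h
  refine (iInf_le_of_le n <| iInf_le_of_le m <| iInf_le_of_le C <|
    iInf_le_of_le ⟨e, f, hr⟩ le_rfl).trans ?_
  exact_mod_cast hC

end Impl

/-- The infimum is over natural numbers, so it is attained: if every implementing circuit had size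
above `N`, the infimum would be at least `N + 1`. -/
theorem impl_of_complexity_le {Φ : Channel ι κ} {N : ℕ} (h : complexity Φ ≤ N) :
    Impl N Φ.map := by
  by_contra hcon
  have : ((N + 1 : ℕ) : ℕ∞) ≤ complexity Φ := by
    refine le_iInf fun n => le_iInf fun m => le_iInf fun C => le_iInf fun hI => ?_
    obtain ⟨e, f, hr⟩ := hI
    by_contra hlt
    refine hcon ⟨n, m, C, e, f, ?_, hr⟩
    have := not_le.1 hlt
    have h2 : C.size < N + 1 := by exact_mod_cast this
    omega
  have h3 := this.trans h
  have h4 : N + 1 ≤ N := by exact_mod_cast h3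
  omega

/-- Surplus input qubits have to be discarded one by one. Applied to a distinguisher, this bounds
the number of copies by its complexity, so no polynomial bound on `n` is needed in part 1. -/
theorem Impl.card_le {N : ℕ} {Φ : Op ι → Op κ} (h : Impl N Φ) :
    Fintype.card ι ≤ Fintype.card κ + N := by
  obtain ⟨n, m, C, e, f, hC, -⟩ := h
  have h1 := Fintype.card_congr e
  have h2 := Fintype.card_congr f
  have h3 := C.width_le.1
  simp only [Fintype.card_fin] at h1 h2
  omega

namespace GenState

theorem mono {N M : ℕ} {ω : Op κ} (h : GenState N ω) (hNM : N ≤ M) : GenState M ω := by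
  obtain ⟨m, C, f, hC, hr⟩ := h
  exact ⟨m, C, f, hC.trans hNM, hr⟩

theorem card_le {N : ℕ} {ω : Op κ} (h : GenState N ω) : Fintype.card κ ≤ N := by
  obtain ⟨m, C, f, hC, -⟩ := h
  have h1 := Fintype.card_congr f
  have h3 := C.width_le.2
  simp only [Fintype.card_fin] at h1
  omega

theorem zero : GenState (Fintype.card κ) (basisProj (0 : Bits κ)) := by
  refine ⟨_, inits _, Fintype.equivFin κ, (size_inits _).le, ?_⟩
  rw [run_inits]
  ext u v
  simp only [relabel_apply, basisProj_apply]
  have h : ∀ u : Bits (Fin (Fintype.card κ)), 0 = u ∘ Fintype.equivFin κ ↔ 0 = u := by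
    intro u
    constructor
    · intro h
      ext i
      simpa using congrFun h ((Fintype.equivFin κ).symm i)
    · rintro rfl; rfl
  exact if_congr (and_congr (h u) (h v)) rfl rfl

theorem apply {N M : ℕ} {Φ : Op ι → Op κ} {ω : Op ι} (hΦ : Impl N Φ) (hω : GenState M ω) :
    GenState (N + M + Fintype.card ι) (Φ ω) := by
  obtain ⟨m, C, f, hC, hr⟩ := hω
  obtain ⟨m', l, D, e', f', hD, hr'⟩ := hΦ
  obtain rfl : m = m' := by
    have h1 := Fintype.card_congr f
    have h2 := Fintype.card_congr e'
    simp only [Fintype.card_fin] at h1 h2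
    omega
  obtain ⟨P, hP, hrP⟩ := (gateProd_wirePerm (f.symm.trans e')).exists_circuit
  refine ⟨l, C.append (P.append D), f', ?_, ?_⟩
  · rw [Circuit.size_append, Circuit.size_append]
    have h1 := Fintype.card_congr f
    simp only [Fintype.card_fin] at h1 hP
    omega
  · rw [Circuit.run_append, Circuit.run_append, hrP, ← hr, ← relabel_eq_conj, hr',
      relabel_relabel]
    congr 2
    ext i
    simp

theorem relabel {N : ℕ} {ω : Op ι} (h : GenState N ω) (e : ι ≃ κ) :
    GenState N (BHRD.relabel e ω) := by
  obtain ⟨m, C, f, hC, hr⟩ := h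
  refine ⟨m, C, e.symm.trans f, hC, ?_⟩
  rw [← hr, relabel_relabel, ← Equiv.trans_assoc, Equiv.self_trans_symm, Equiv.refl_trans]

theorem impl_tensor {N : ℕ} {ω : Op κ} (h : GenState N ω) :
    Impl N fun ρ : Op ι => tensor ρ ω := by
  obtain ⟨m, C, f, hC, hr⟩ := h
  let g := Fintype.equivFin ι
  refine ⟨Fintype.card ι + 0, Fintype.card ι + m, C.lift (Fintype.card ι), g,
    (Equiv.sumCongr g f).trans finSumFinEquiv,
    (C.size_lift _).trans_le hC, fun ρ => ?_⟩
  have key : ∀ (a b : Bits (Fin (Fintype.card ι))) (u v : Bits (Fin m)),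
      BHRD.relabel ((Equiv.sumCongr g f).trans finSumFinEquiv)
        (tensor ρ ω) (Fin.append a u) (Fin.append b v) =
      Circuit.block ((C.lift (Fintype.card ι)).run (BHRD.relabel g ρ)) a b u v := by
    intro a b u v
    rw [Circuit.block_run_lift]
    -- The circuit that generates `ω` has no input wires, so each block of `ρ` is a scalar, and
    -- linearity of the run pulls it out.
    have h1 : Circuit.block (n := 0) (BHRD.relabel g ρ) a b = ρ (a ∘ g) (b ∘ g) • 1 := by
      ext u v
      have h : ∀ (a : Bits (Fin (Fintype.card ι))) (u : Bits (Fin 0)),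
          (Fin.append a u : Bits (Fin (Fintype.card ι + 0))) = a :=
        fun a u => Fin.append_right_nil a u rfl
      simp only [Matrix.smul_apply, Subsingleton.elim u v,
        Matrix.one_apply_eq, smul_eq_mul, mul_one]
      exact congrArg₂ (fun x y => ρ (x ∘ g) (y ∘ g)) (h a v) (h b v)
    refine Eq.trans ?_ (congrFun (congrFun (congrArg C.run h1.symm) u) v)
    rw [C.isKraus_run.map_smul, ← hr, Matrix.smul_apply, smul_eq_mul]
    simp only [relabel_apply, tensor_apply]
    refine congrArg₂ (· * ·) (congrArg₂ ρ ?_ ?_) (congrArg₂ ω ?_ ?_) <;> ext k <;> simp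
  ext u v
  have hu : ∀ w : Bits (Fin (Fintype.card ι + m)),
      Fin.append (fun i => w (Fin.castAdd m i)) (fun i => w (Fin.natAdd _ i)) = w :=
    fun w => Fin.append_castAdd_natAdd
  rw [← hu u, ← hu v]
  exact key _ _ _ _

theorem tensor {N M : ℕ} {ω : Op ι} {σ : Op κ} (hω : GenState N ω) (hσ : GenState M σ) :
    GenState (M + N + Fintype.card ι) (tensor ω σ) :=
  apply hσ.impl_tensor hω

theorem genComplexity_le {N : ℕ} {ω : Op κ} (h : GenState N ω) : genComplexity ω ≤ N := by
  obtain ⟨m, C, f, hC, hr⟩ := h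
  have hI : Impl N fun ρ : Op (Fin 0) => BHRD.relabel f.symm (C.run ρ) :=
    ⟨0, m, C, Equiv.refl _, f, hC, fun ρ => relabel_relabel_symm _ _⟩
  have h1 : (hI.isKraus.channel).map 1 = ω := by
    change BHRD.relabel f.symm (C.run 1) = ω
    rw [← hr, relabel_symm_relabel]
  exact (iInf_le_of_le hI.isKraus.channel <| iInf_le_of_le h1 le_rfl).trans
    (Impl.complexity_le (Φ := hI.isKraus.channel) hI)

end GenState

theorem genState_of_genComplexity_le {ω : Op κ} {N : ℕ} (h : genComplexity ω ≤ N) :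
    GenState N ω := by
  by_contra hcon
  have : ((N + 1 : ℕ) : ℕ∞) ≤ genComplexity ω := by
    refine le_iInf fun Φ => le_iInf fun hΦ => ?_
    by_contra hlt
    have h2 : complexity Φ ≤ N := by
      have := not_le.1 hlt
      rw [Nat.cast_add, Nat.cast_one] at this
      exact Order.le_of_lt_add_one this
    obtain ⟨n, m, C, e, f, hC, hr⟩ := impl_of_complexity_le h2
    obtain rfl : 0 = n := by simpa using Fintype.card_congr e
    refine hcon ⟨m, C, f, hC, ?_⟩
    rw [← hΦ, hr, relabel_one]
  have h3 := this.trans h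
  have h4 : N + 1 ≤ N := by exact_mod_cast h3
  omega

/-- The copies of `ι`, with the `i`-th one split off. -/
noncomputable def insertCopy (ι : Type) {n : ℕ} (i : Fin (n + 1)) : ι ⊕ (Fin n × ι) ≃ Fin (n + 1) × ι :=
  Equiv.ofBijective (Sum.elim (fun q => (i, q)) fun p => (i.succAbove p.1, p.2)) <| by
    constructor
    · rintro (a | ⟨j, a⟩) (b | ⟨k, b⟩) h
      · simpa using h
      · exact absurd (congrArg Prod.fst h).symm (Fin.succAbove_ne i k)
      · exact absurd (congrArg Prod.fst h) (Fin.succAbove_ne i j)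
      · simpa using h
    · rintro ⟨j, a⟩
      rcases eq_or_ne j i with rfl | hj
      · exact ⟨Sum.inl a, rfl⟩
      · obtain ⟨k, rfl⟩ := Fin.exists_succAbove_eq hj
        exact ⟨Sum.inr (k, a), rfl⟩

/-- The copy split off is arbitrary because the decoder later inserts its own copy at a position `i`
that cannot be prescribed. -/
theorem tensorFamily_eq_relabel {n : ℕ} (i : Fin (n + 1)) (ρ : Fin (n + 1) → Op ι) :
    tensorFamily ρ =
      relabel (insertCopy ι i) (tensor (ρ i) (tensorFamily fun j => ρ (i.succAbove j))) := by
  ext u v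
  simp only [tensorFamily, Matrix.of_apply, relabel_apply, tensor_apply]
  rw [Fin.prod_univ_succAbove _ i]
  rfl

theorem GenState.tensorFamily {n : ℕ} {N : ℕ} {ρ : Fin n → Op ι} (h : ∀ i, GenState N (ρ i)) :
    GenState (n * (N + Fintype.card ι)) (tensorFamily ρ) := by
  induction n with
  | zero =>
    have : BHRD.tensorFamily ρ = basisProj 0 := by
      ext u v
      simp only [BHRD.tensorFamily, basisProj_apply, Subsingleton.elim u 0, Subsingleton.elim v 0]
      simp
    rw [this, Nat.zero_mul]
    exact GenState.zero.mono (by simp)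
  | succ n ih =>
    rw [tensorFamily_eq_relabel 0]
    refine (((h 0).tensor (ih fun j => h _)).relabel _).mono (le_of_eq ?_)
    ring

end Impl

/-! ### Binary observables in the Heisenberg picture -/

section Heisenberg

variable {ι κ α : Type} [Fintype ι] [DecidableEq ι] [Fintype κ] [DecidableEq κ]
  [Fintype α] [DecidableEq α]

/-- The compression of an operator to the subspace in which the ancillas `α` are zero. -/
def corner (T : Op (ι ⊕ α)) : Op ι :=
  Matrix.of fun u v => T (Sum.elim u 0) (Sum.elim v 0)

theorem corner_apply (T : Op (ι ⊕ α)) (u v : Bits ι) :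
    corner T u v = T (Sum.elim u 0) (Sum.elim v 0) := rfl

theorem tensor_one_mul_apply (A : Op ι) (T : Op (ι ⊕ α)) (u : Bits ι) (w : Bits α)
    (x : Bits (ι ⊕ α)) :
    (tensor A (1 : Op α) * T) (Sum.elim u w) x = ∑ v, A u v * T (Sum.elim v w) x := by
  rw [Matrix.mul_apply, sum_bits_sum]
  refine Finset.sum_congr rfl fun v _ => ?_
  simp only [tensor_elim, Matrix.one_apply, mul_ite, mul_one, mul_zero, ite_mul, zero_mul,
    Finset.sum_ite_eq, Finset.mem_univ, if_true]

theorem mul_tensor_one_apply (A : Op ι) (T : Op (ι ⊕ α)) (u : Bits ι) (w : Bits α)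
    (x : Bits (ι ⊕ α)) :
    (T * tensor A (1 : Op α)) x (Sum.elim u w) = ∑ v, T x (Sum.elim v w) * A v u := by
  rw [Matrix.mul_apply, sum_bits_sum]
  refine Finset.sum_congr rfl fun v _ => ?_
  simp only [tensor_elim, Matrix.one_apply, mul_ite, mul_one, mul_zero,
    Finset.sum_ite_eq', Finset.mem_univ, if_true]

theorem corner_conj (A B : Op ι) (T : Op (ι ⊕ α)) :
    corner (tensor A (1 : Op α) * T * tensor B (1 : Op α)) = A * corner T * B := by
  ext u v
  simp only [corner_apply, mul_tensor_one_apply, tensor_one_mul_apply]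
  simp only [Matrix.mul_apply, corner_apply]

/-- The dual of introducing `|0⟩` is compression to the value zero of that wire, so the wire joins
the ancillas. -/
theorem corner_init {n : ℕ} (T : Op (Fin (n + 1) ⊕ α)) (ρ : Op (Fin n)) :
    (corner (relabel ((Equiv.sumCongr (finSumFinEquiv (m := n) (n := 1)).symm
      (Equiv.refl α)).trans (Equiv.sumAssoc (Fin n) (Fin 1) α)) T) * ρ).trace =
      (corner T * addZero ρ).trace := by
  have h1 : ∀ u : Bits (Fin n), (Sum.elim u (0 : Bits (Fin 1 ⊕ α))) ∘
      ((Equiv.sumCongr (finSumFinEquiv (m := n) (n := 1)).symm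
        (Equiv.refl α)).trans (Equiv.sumAssoc (Fin n) (Fin 1) α)) =
      Sum.elim (Fin.snoc (α := fun _ => ZMod 2) u 0) (0 : Bits α) := by
    intro u
    ext (i | i)
    · refine Fin.lastCases ?_ (fun i => ?_) i
      · have : (finSumFinEquiv (m := n) (n := 1)).symm (Fin.last n) = Sum.inr 0 :=
          finSumFinEquiv_symm_last
        simp [this]
      · have : (finSumFinEquiv (m := n) (n := 1)).symm i.castSucc = Sum.inl i :=
          finSumFinEquiv_symm_apply_castSucc i
        simp [this]
    · simp
  have h2 : ∀ u v : Bits (Fin n), addZero ρ (Fin.snoc (α := fun _ => ZMod 2) u 0)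
      (Fin.snoc (α := fun _ => ZMod 2) v 0) = ρ u v := by
    intro u v
    simp [addZero]
  have h3 : ∀ (u : Bits (Fin n)) (w : Bits (Fin (n + 1))),
      addZero ρ w (Fin.snoc (α := fun _ => ZMod 2) u 1) = 0 := by
    intro u w
    simp [addZero]
  have h4 : ∀ (u : Bits (Fin n)) (w : Bits (Fin (n + 1))),
      addZero ρ (Fin.snoc (α := fun _ => ZMod 2) u 1) w = 0 := by
    intro u w
    simp [addZero]
  have hs : ∀ f : Bits (Fin (n + 1)) → ℂ, ∑ u, f u =
      ∑ u : Bits (Fin n), (f (Fin.snoc (α := fun _ => ZMod 2) u 0) +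
        f (Fin.snoc (α := fun _ => ZMod 2) u 1)) := by
    intro f
    rw [← (Fin.snocEquiv fun _ : Fin (n + 1) => ZMod 2).sum_comp, Fintype.sum_prod_type_right]
    exact Finset.sum_congr rfl fun u _ => sum_zmod_two _
  simp only [Matrix.trace, Matrix.diag, Matrix.mul_apply, hs, h3, h4, mul_zero,
    Finset.sum_const_zero, add_zero, h2, corner_apply, relabel_apply, h1]

/-- The dual of a partial trace is tensoring with the identity, so the observable is merely placed
on a larger register. -/
theorem corner_discard {n : ℕ} (T : Op (Fin n ⊕ α)) (ρ : Op (Fin (n + 1))) :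
    (corner (place (Function.Embedding.sumMap Fin.castSuccEmb
      (Function.Embedding.refl α)) T) * ρ).trace = (corner T * dropLast ρ).trace := by
  have hs : ∀ f : Bits (Fin (n + 1)) → ℂ, ∑ u, f u =
      ∑ u : Bits (Fin n), ∑ b : ZMod 2, f (Fin.snoc (α := fun _ => ZMod 2) u b) := by
    intro f
    rw [← (Fin.snocEquiv fun _ : Fin (n + 1) => ZMod 2).sum_comp, Fintype.sum_prod_type_right]
    rfl
  have h1 : ∀ (u v : Bits (Fin n)) (b c : ZMod 2),
      place (Function.Embedding.sumMap Fin.castSuccEmb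
        (Function.Embedding.refl α)) T
        (Sum.elim (Fin.snoc (α := fun _ => ZMod 2) u b) 0)
        (Sum.elim (Fin.snoc (α := fun _ => ZMod 2) v c) 0) =
      if b = c then T (Sum.elim u 0) (Sum.elim v 0) else 0 := by
    classical
    intro u v b c
    rw [place_apply]
    refine if_congr ⟨fun h => ?_, ?_⟩ ?_ rfl
    · simpa using h (Sum.inl (Fin.last n)) (by
        rintro ⟨i | i, hi⟩
        · exact absurd (Sum.inl.inj hi) (Fin.castSucc_lt_last i).ne
        · exact absurd hi (by simp))
    · rintro rfl (j | j) hj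
      · induction j using Fin.lastCases with
        | last => simp
        | cast i => exact absurd ⟨Sum.inl i, rfl⟩ hj
      · rfl
    · congr 1 <;>
      · ext (i | i)
        · exact Fin.snoc_castSucc (α := fun _ => ZMod 2) _ _ i
        · rfl
  simp only [Matrix.trace, Matrix.diag, Matrix.mul_apply, hs, corner_apply, h1, ite_mul, zero_mul,
    Finset.sum_ite_eq, Finset.mem_univ, if_true, dropLast, Matrix.of_apply, Finset.mul_sum]
  refine Finset.sum_congr rfl fun u _ => ?_
  rw [Finset.sum_comm]

/-- Induction on the circuit from its end: a gate conjugates the observable, an introduced qubit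
becomes an ancilla, a discarded qubit is ignored. The pulled-back observable is thus the corner of a
unitary of known gate count, which can itself be run as an operation. -/
theorem exists_heisenberg {n m : ℕ} (C : Circuit n m) {c : ℕ} {T : Op (Fin m ⊕ α)}
    (hT : GateProd c T) :
    ∃ (α' : Type) (_ : Fintype α') (_ : DecidableEq α') (T' : Op (Fin n ⊕ α')),
      Fintype.card α' ≤ Fintype.card α + C.size ∧ GateProd (c + 2 * C.size) T' ∧
        ∀ ρ, (corner T' * ρ).trace = (corner T * C.run ρ).trace := by
  induction C with
  | nil n => exact ⟨α, _, _, T, le_rfl, hT.mono (by omega), fun ρ => rfl⟩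
  | gate hk S U C ih =>
    obtain ⟨α', _, _, T', hα, hT', h⟩ := ih hT
    have hg : GateProd 1 (place S U.1) := by
      have := GateProd.cons hk S U (GateProd.one 0)
      rwa [mul_one] at this
    -- Conjugation adds the gate and its adjoint, hence the factor two in `2 * C.size`.
    refine ⟨α', inferInstance, inferInstance, tensor (place S U.1)ᴴ 1 * T' * tensor (place S U.1) 1, ?_, ?_, fun ρ => ?_⟩
    · simp only [Circuit.size]; omega
    · refine ((hg.conjTranspose.tensor_one.mul hT').mul hg.tensor_one).mono ?_
      simp only [Circuit.size]; omega
    · rw [corner_conj]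
      simp only [Circuit.run, onWires_eq_place]
      rw [← h, Matrix.mul_assoc, Matrix.mul_assoc, Matrix.trace_mul_comm]
      simp only [Matrix.mul_assoc]
  | init C ih =>
    obtain ⟨α', _, _, T', hα, hT', h⟩ := ih hT
    refine ⟨Fin 1 ⊕ α', inferInstance, inferInstance,
      relabel ((Equiv.sumCongr (finSumFinEquiv (m := _) (n := 1)).symm
        (Equiv.refl α')).trans (Equiv.sumAssoc (Fin _) (Fin 1) α')) T', ?_,
      (hT'.relabel _).mono ?_, fun ρ => ?_⟩
    · simp only [Circuit.size, Fintype.card_sum, Fintype.card_fin]; omega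
    · simp only [Circuit.size]; omega
    · exact (corner_init T' ρ).trans (h _)
  | discard C ih =>
    obtain ⟨α', _, _, T', hα, hT', h⟩ := ih hT
    refine ⟨α', inferInstance, inferInstance,
      place (Function.Embedding.sumMap Fin.castSuccEmb (Function.Embedding.refl α')) T', ?_,
      (hT'.place _).mono ?_, fun ρ => ?_⟩
    · simp only [Circuit.size]; omega
    · simp only [Circuit.size]; omega
    · exact (corner_discard T' ρ).trans (h _)

theorem pauliZ_mem_unitaryGroup : pauliZ ∈ Matrix.unitaryGroup (Bits Unit) ℂ := by
  rw [Matrix.mem_unitaryGroup_iff, Matrix.star_eq_conjTranspose, pauliZ,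
    Matrix.diagonal_conjTranspose, Matrix.diagonal_mul_diagonal, ← Matrix.diagonal_one]
  congr 1
  funext u
  simp only [Pi.star_apply]
  split_ifs <;> simp

theorem sum_bits_unit {M : Type*} [AddCommMonoid M] (f : Bits Unit → M) :
    ∑ u, f u = f (fun _ => 0) + f (fun _ => 1) := by
  rw [← (Equiv.funUnique Unit (ZMod 2)).symm.sum_comp, sum_zmod_two]
  rfl

theorem Impl.exists_observable {N : ℕ} {Φ : Op ι → Op Unit} (h : Impl N Φ) :
    ∃ (α : Type) (_ : Fintype α) (_ : DecidableEq α) (T : Op (ι ⊕ α)),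
      Fintype.card α ≤ N ∧ GateProd (2 * N + 1) T ∧
        ∀ ρ, (corner T * ρ).trace =
          Φ ρ (fun _ => 0) (fun _ => 0) - Φ ρ (fun _ => 1) (fun _ => 1) := by
  obtain ⟨n, m, C, e, f, hC, hr⟩ := h
  have hZ : GateProd 1 (tensor (BHRD.relabel f pauliZ) (1 : Op (Fin 0))) :=
    ((GateProd.single (by simp) pauliZ_mem_unitaryGroup).relabel f).tensor_one
  obtain ⟨α, _, _, T, hα, hT, hTr⟩ := exists_heisenberg C hZ
  refine ⟨α, _, _, BHRD.relabel (Equiv.sumCongr e.symm (Equiv.refl α)) T, ?_,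
    (hT.relabel _).mono (by omega), fun ρ => ?_⟩
  · simp only [Fintype.card_fin] at hα; omega
  · have h1 : corner (BHRD.relabel (Equiv.sumCongr e.symm (Equiv.refl α)) T) =
        BHRD.relabel e.symm (corner T) := by
      ext u v
      simp only [corner_apply, relabel_apply]
      congr 1 <;>
      · ext (i | i) <;> simp
    have h2 : corner (tensor (BHRD.relabel f pauliZ) (1 : Op (Fin 0))) =
        BHRD.relabel f pauliZ := by
      ext u v
      rw [corner_apply, tensor_apply]
      exact mul_one _
    rw [h1, ← trace_relabel e, relabel_mul, relabel_relabel_symm, hTr, h2, ← hr, ← relabel_mul,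
      trace_relabel, pauliZ, Matrix.trace]
    simp only [Matrix.diag, Matrix.diagonal_mul, sum_bits_unit]
    simp [sub_eq_add_neg]

end Heisenberg

/-! ### The Hadamard transform -/

section Hadamard

variable {ι α : Type} [Fintype ι] [DecidableEq ι] [Fintype α] [DecidableEq α]
  {σ : Type} [Fintype σ] [DecidableEq σ]

/-- The sign `(-1) ^ x`. -/
def sgn (x : ZMod 2) : ℂ := if x = 0 then 1 else -1

@[simp] theorem sgn_zero : sgn 0 = 1 := by simp [sgn]
@[simp] theorem sgn_one : sgn 1 = -1 := by simp [sgn]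

theorem zmod_two_cases (x : ZMod 2) : x = 0 ∨ x = 1 := by
  revert x; decide

theorem zmod_two_add_self (x : ZMod 2) : x + x = 0 := by
  revert x; decide

theorem sgn_add (x y : ZMod 2) : sgn (x + y) = sgn x * sgn y := by
  rcases zmod_two_cases x with rfl | rfl <;> rcases zmod_two_cases y with rfl | rfl <;>
    simp [zmod_two_add_self]

theorem sgn_sum {β : Type*} (s : Finset β) (f : β → ZMod 2) :
    sgn (∑ i ∈ s, f i) = ∏ i ∈ s, sgn (f i) := by
  classical
  induction s using Finset.induction_on with
  | empty => simp
  | insert a s ha ih => rw [Finset.sum_insert ha, Finset.prod_insert ha, sgn_add, ih]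

theorem star_sgn (x : ZMod 2) : star (sgn x) = sgn x := by
  rcases zmod_two_cases x with rfl | rfl <;> simp

/-- The Hadamard matrix, followed by a shift of the basis by `s`. -/
noncomputable def had (s : ZMod 2) : Matrix (ZMod 2) (ZMod 2) ℂ :=
  Matrix.of fun a b => ((Real.sqrt 2)⁻¹ : ℝ) * sgn ((a + s) * b)

theorem had_apply (s a b : ZMod 2) :
    had s a b = ((Real.sqrt 2)⁻¹ : ℝ) * sgn ((a + s) * b) := rfl

theorem inv_sqrt_two_mul_self : (((Real.sqrt 2)⁻¹ : ℝ) : ℂ) * ((Real.sqrt 2)⁻¹ : ℝ) = 1 / 2 := by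
  rw [← Complex.ofReal_mul, ← mul_inv, Real.mul_self_sqrt (by norm_num)]
  norm_num

theorem had_mem_unitaryGroup (s : ZMod 2) : had s ∈ Matrix.unitaryGroup (ZMod 2) ℂ := by
  rw [Matrix.mem_unitaryGroup_iff, Matrix.star_eq_conjTranspose]
  have h : ∀ a b : ℂ, (((Real.sqrt 2)⁻¹ : ℝ) : ℂ) * a * ((((Real.sqrt 2)⁻¹ : ℝ) : ℂ) * b) =
      1 / 2 * (a * b) := by
    intro a b
    rw [← inv_sqrt_two_mul_self]; ring
  ext a b
  rw [Matrix.mul_apply, sum_zmod_two]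
  simp only [Matrix.conjTranspose_apply, had_apply, star_mul', star_sgn, Complex.star_def,
    Complex.conj_ofReal, h]
  rcases zmod_two_cases s with rfl | rfl <;> rcases zmod_two_cases a with rfl | rfl <;>
    rcases zmod_two_cases b with rfl | rfl <;> norm_num [one_add_one_eq_two, show sgn 2 = 1 from sgn_zero]

/-- Summing over the shift `s` is a character sum in `v + v'`: it forces `v' = v` and leaves the
sign of the Goldreich-Levin character. -/
theorem sum_had_mul_star_had (w v v' : ZMod 2) :
    ∑ s, had s w v' * star (had s 0 v) = if v' = v then sgn (w * v) else 0 := by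
  have h : ∀ a b : ℂ, (((Real.sqrt 2)⁻¹ : ℝ) : ℂ) * a * ((((Real.sqrt 2)⁻¹ : ℝ) : ℂ) * b) =
      1 / 2 * (a * b) := by
    intro a b
    rw [← inv_sqrt_two_mul_self]; ring
  rw [sum_zmod_two]
  simp only [had_apply, star_mul', star_sgn, Complex.star_def, Complex.conj_ofReal, h]
  rcases zmod_two_cases w with rfl | rfl <;> rcases zmod_two_cases v with rfl | rfl <;>
    rcases zmod_two_cases v' with rfl | rfl <;> norm_num [one_add_one_eq_two, show sgn 2 = 1 from sgn_zero]

/-- The Hadamard transform of the register `ι`, followed by a shift of the basis by `s`. -/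
noncomputable def hadShift (s : Bits ι) : Op ι := piOp fun j => had (s j)

theorem sum_hadShift (w v v' : Bits ι) :
    ∑ s : Bits ι, hadShift s w v' * star (hadShift s 0 v) =
      if v' = v then sgn (∑ j, w j * v j) else 0 := by
  simp only [hadShift, piOp_apply, star_prod, ← Finset.prod_mul_distrib]
  have := (Fintype.piFinset_univ (α := ι) (β := fun _ => ZMod 2)).symm
  rw [this, ← Finset.prod_univ_sum (fun _ => Finset.univ)
    fun j s => had s (w j) (v' j) * star (had s ((0 : Bits ι) j) (v j))]
  simp only [Pi.zero_apply, sum_had_mul_star_had, Finset.prod_ite_zero, Finset.mem_univ,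
    forall_const, funext_iff, sgn_sum]

/-- The block of `T` that maps the value `0` of the register `ι` to the value `w`, while the
ancillas `α` stay zero. -/
def outcomeOp (T : Op ((σ ⊕ ι) ⊕ α)) (w : Bits ι) : Op σ :=
  Matrix.of fun p q => T (Sum.elim (Sum.elim p w) 0) (Sum.elim (Sum.elim q 0) 0)

/-- The diagonal block of `T` at the value `v` of the register `ι`, while the ancillas `α` stay
zero. -/
def diagBlock (T : Op ((σ ⊕ ι) ⊕ α)) (v : Bits ι) : Op σ :=
  Matrix.of fun p q => T (Sum.elim (Sum.elim p v) 0) (Sum.elim (Sum.elim q v) 0)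

/-- The operator `T`, conjugated by the shifted Hadamard transform of the register `ι`. -/
noncomputable def hadConj (s : Bits ι) (T : Op ((σ ⊕ ι) ⊕ α)) : Op ((σ ⊕ ι) ⊕ α) :=
  tensor (tensor (1 : Op σ) (hadShift s)) (1 : Op α) * T *
    tensor (tensor (1 : Op σ) (hadShift s)ᴴ) (1 : Op α)

theorem gateProd_hadConj {c : ℕ} (s : Bits ι) {T : Op ((σ ⊕ ι) ⊕ α)} (hT : GateProd c T) :
    GateProd (c + 2 * Fintype.card ι) (hadConj s T) := by
  have h : GateProd (Fintype.card ι) (hadShift s) := GateProd.piOp fun j => had_mem_unitaryGroup _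
  exact ((h.one_tensor.tensor_one.mul hT).mul h.conjTranspose.one_tensor.tensor_one).mono
    (by omega)

theorem one_tensor_apply (A : Op ι) (p q : Bits σ) (u v : Bits ι) :
    tensor (1 : Op σ) A (Sum.elim p u) (Sum.elim q v) = if p = q then A u v else 0 := by
  rw [tensor_apply, Matrix.one_apply, ite_mul, one_mul, zero_mul]
  exact if_congr Iff.rfl rfl rfl

theorem hadConj_apply (s : Bits ι) (T : Op ((σ ⊕ ι) ⊕ α)) (p q : Bits σ) (w : Bits ι) :
    outcomeOp (hadConj s T) w p q = ∑ v, ∑ v', hadShift s w v' * star (hadShift s 0 v) *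
      T (Sum.elim (Sum.elim p v') 0) (Sum.elim (Sum.elim q v) 0) := by
  simp only [outcomeOp, hadConj, Matrix.of_apply, mul_tensor_one_apply, tensor_one_mul_apply,
    sum_bits_sum, one_tensor_apply, ite_mul, mul_ite, zero_mul, mul_zero,
    Matrix.conjTranspose_apply]
  rw [Finset.sum_comm]
  simp only [Finset.sum_ite_eq', Finset.mem_univ, if_true]
  refine Finset.sum_congr rfl fun v _ => ?_
  rw [Finset.sum_comm]
  simp only [Finset.sum_ite_eq, Finset.mem_univ, if_true, Finset.sum_mul]
  refine Finset.sum_congr rfl fun v' _ => ?_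
  ring

/-- In the usual Goldreich-Levin circuit the oracle preserves the query register. Here `T` may move
it, and the sum over all shifts removes exactly the terms in which it does. -/
theorem sum_outcomeOp_hadConj (T : Op ((σ ⊕ ι) ⊕ α)) (w : Bits ι) :
    ∑ s, outcomeOp (hadConj s T) w = ∑ v, sgn (∑ j, w j * v j) • diagBlock T v := by
  ext p q
  simp only [Matrix.sum_apply, hadConj_apply, Matrix.smul_apply, diagBlock, Matrix.of_apply,
    smul_eq_mul]
  rw [Finset.sum_comm]
  refine Finset.sum_congr rfl fun v _ => ?_
  rw [Finset.sum_comm]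
  simp only [← Finset.sum_mul, sum_hadShift, ite_mul, zero_mul, Finset.sum_ite_eq',
    Finset.mem_univ, if_true]

end Hadamard

/-! ### Density operators -/

section Density

variable {ι κ α : Type} [Fintype ι] [DecidableEq ι] [Fintype κ] [DecidableEq κ]
  [Fintype α] [DecidableEq α]

theorem IsKraus.posSemidef {Φ : Op ι → Op κ} (h : IsKraus Φ) {ρ : Op ι} (hρ : ρ.PosSemidef) :
    (Φ ρ).PosSemidef := by
  obtain ⟨α, _, K, hK, -⟩ := h
  rw [hK]
  exact Matrix.posSemidef_sum _ fun a _ => hρ.mul_mul_conjTranspose_same _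

theorem IsKraus.isDensity {Φ : Op ι → Op κ} (h : IsKraus Φ) {ρ : Op ι} (hρ : IsDensity ρ) :
    IsDensity (Φ ρ) :=
  ⟨h.posSemidef hρ.1, (h.trace_map ρ).trans hρ.2⟩

theorem isDensity_basisProj (w : Bits ι) : IsDensity (basisProj w : Op ι) :=
  ⟨posSemidef_basisProj w, trace_basisProj w⟩

theorem IsDensity.tensor {ρ : Op ι} {σ : Op κ} (hρ : IsDensity ρ) (hσ : IsDensity σ) :
    IsDensity (tensor ρ σ) :=
  ⟨posSemidef_tensor hρ.1 hσ.1, by rw [trace_tensor, hρ.2, hσ.2, one_mul]⟩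

theorem posSemidef_tensorFamily {n : ℕ} {ρ : Fin n → Op ι} (h : ∀ i, (ρ i).PosSemidef) :
    (tensorFamily ρ).PosSemidef := by
  induction n with
  | zero =>
    have : tensorFamily ρ = basisProj 0 := by
      ext u v
      simp only [tensorFamily, basisProj_apply, Subsingleton.elim u 0, Subsingleton.elim v 0]
      simp
    rw [this]
    exact posSemidef_basisProj _
  | succ n ih =>
    rw [tensorFamily_eq_relabel 0]
    exact posSemidef_relabel _ (posSemidef_tensor (h 0) (ih fun j => h _))

theorem trace_tensorFamily {n : ℕ} (ρ : Fin n → Op ι) :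
    (tensorFamily ρ).trace = ∏ i, (ρ i).trace := by
  induction n with
  | zero =>
    have : tensorFamily ρ = basisProj 0 := by
      ext u v
      simp only [tensorFamily, basisProj_apply, Subsingleton.elim u 0, Subsingleton.elim v 0]
      simp
    rw [this, trace_basisProj]
    simp
  | succ n ih =>
    rw [tensorFamily_eq_relabel 0, trace_relabel, trace_tensor, ih, Fin.prod_univ_succAbove _ 0]

theorem IsDensity.tensorFamily {n : ℕ} {ρ : Fin n → Op ι} (h : ∀ i, IsDensity (ρ i)) :
    IsDensity (tensorFamily ρ) :=
  ⟨posSemidef_tensorFamily fun i => (h i).1, by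
    rw [trace_tensorFamily, Finset.prod_congr rfl fun i _ => (h i).2, Finset.prod_const_one]⟩

theorem isKraus_traceRight : IsKraus (traceRight : Op (ι ⊕ κ) → Op ι) :=
  Impl.traceRight.isKraus

theorem IsDensity.conj {ρ U : Op ι} (hρ : IsDensity ρ)
    (hU : U ∈ Matrix.unitaryGroup (Bits ι) ℂ) : IsDensity (U * ρ * Uᴴ) :=
  (isKraus_conj hU).isDensity hρ

theorem traceRight_conj (A B : Op ι) (ρ : Op (ι ⊕ κ)) :
    traceRight (tensor A (1 : Op κ) * ρ * tensor B (1 : Op κ)) = A * traceRight ρ * B := by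
  ext u v
  simp only [traceRight, Matrix.of_apply, mul_tensor_one_apply, tensor_one_mul_apply]
  simp only [Matrix.mul_apply, Matrix.of_apply, Finset.mul_sum, Finset.sum_mul]
  rw [Finset.sum_comm]
  refine Finset.sum_congr rfl fun j _ => ?_
  rw [Finset.sum_comm]

/-- The cyclic form of the Cauchy–Schwarz inequality for a density operator. -/
theorem normSq_trace_le {φ : Op ι} (hφ : IsDensity φ) (K : Op ι) :
    ‖(K * φ).trace‖ ^ 2 ≤ (K * φ * Kᴴ).trace.re := by
  set l := (K * φ).trace with hl
  -- Nonnegativity of the variance of `K` about its mean `l`.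
  have h := (hφ.1.mul_mul_conjTranspose_same (K - l • (1 : Op ι))).trace_nonneg
  have h1 : (φ * Kᴴ).trace = star l := by
    rw [hl, ← Matrix.trace_conjTranspose, Matrix.conjTranspose_mul, hφ.1.isHermitian.eq]
  have h2 : ((K - l • (1 : Op ι)) * φ * (K - l • (1 : Op ι))ᴴ).trace =
      (K * φ * Kᴴ).trace - l * star l := by
    simp only [Matrix.conjTranspose_sub, Matrix.conjTranspose_smul, Matrix.conjTranspose_one,
      Matrix.sub_mul, Matrix.mul_sub, Matrix.smul_mul, Matrix.mul_smul, Matrix.one_mul,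
      Matrix.mul_one, Matrix.trace_sub, Matrix.trace_smul, h1, hφ.2, smul_eq_mul]
    rw [← hl]
    ring
  rw [h2] at h
  have h3 := (Complex.le_def.1 h).1
  rw [Complex.star_def, Complex.mul_conj, Complex.sub_re, Complex.ofReal_re,
    Complex.normSq_eq_norm_sq] at h3
  simpa using h3

end Density

/-! ### Measuring a register after a unitary -/

section Measure

variable {ι α σ : Type} [Fintype ι] [DecidableEq ι] [Fintype α] [DecidableEq α]
  [Fintype σ] [DecidableEq σ]

/-- The order of the registers `σ`, `ι`, `α` in which the register `σ` is the last one. -/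
def dataLast (σ ι α : Type) : (σ ⊕ ι) ⊕ α ≃ (ι ⊕ α) ⊕ σ :=
  (Equiv.sumAssoc σ ι α).trans (Equiv.sumComm σ (ι ⊕ α))

/-- The state of the registers `ι` and `α`, both initially zero, after `T`. -/
def meas (T : Op ((σ ⊕ ι) ⊕ α)) (X : Op σ) : Op (ι ⊕ α) :=
  traceRight (relabel (dataLast σ ι α)
    (T * tensor (tensor X (basisProj (0 : Bits ι))) (basisProj (0 : Bits α)) * Tᴴ))

theorem impl_meas {c : ℕ} {T : Op ((σ ⊕ ι) ⊕ α)} (hT : GateProd c T) :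
    Impl (c + 4 * Fintype.card σ + 4 * Fintype.card ι + 3 * Fintype.card α) (meas T) := by
  have h1 : Impl (Fintype.card ι) fun X : Op σ => tensor X (basisProj (0 : Bits ι)) :=
    GenState.zero.impl_tensor
  have h2 : Impl (Fintype.card α) fun X : Op (σ ⊕ ι) => tensor X (basisProj (0 : Bits α)) :=
    GenState.zero.impl_tensor
  have h3 := (((Impl.traceRight (ι := ι ⊕ α) (κ := σ)).comp_relabel (dataLast σ ι α)).comp
    (Impl.conj hT)).comp (h2.comp h1)
  refine Impl.mono h3 ?_
  simp only [Fintype.card_sum]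
  omega

theorem conj_tensor_basisProj_apply (T : Op ((σ ⊕ ι) ⊕ α)) (X : Op σ)
    (u v : Bits ((σ ⊕ ι) ⊕ α)) :
    (T * tensor (tensor X (basisProj (0 : Bits ι))) (basisProj (0 : Bits α)) * Tᴴ) u v =
      ∑ q', (∑ q, T u (Sum.elim (Sum.elim q 0) 0) * X q q') *
        star (T v (Sum.elim (Sum.elim q' 0) 0)) := by
  simp only [Matrix.mul_apply, sum_bits_sum, tensor_elim, basisProj_apply,
    Matrix.conjTranspose_apply]
  refine Finset.sum_congr rfl fun q' _ => ?_
  rw [Finset.sum_eq_single 0, Finset.sum_eq_single 0]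
  · congr 1
    refine Finset.sum_congr rfl fun q _ => ?_
    rw [Finset.sum_eq_single 0, Finset.sum_eq_single 0]
    · simp
    · intro b _ hb
      simp [hb.symm]
    · simp
    · intro b _ hb
      simp [hb.symm]
    · simp
  · intro b _ hb
    simp [hb.symm]
  · simp
  · intro b _ hb
    simp [hb.symm]
  · simp

theorem meas_elim_zero (T : Op ((σ ⊕ ι) ⊕ α)) (X : Op σ) (w : Bits ι) :
    meas T X (Sum.elim w 0) (Sum.elim w 0) =
      (outcomeOp T w * X * (outcomeOp T w)ᴴ).trace := by
  have h : ∀ p : Bits σ, (Sum.elim (Sum.elim w (0 : Bits α)) p : Bits ((ι ⊕ α) ⊕ σ)) ∘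
      dataLast σ ι α = Sum.elim (Sum.elim p w) 0 := by
    intro p
    ext ((i | i) | i) <;> simp [dataLast]
  simp only [meas, traceRight, Matrix.of_apply, relabel_apply, h, conj_tensor_basisProj_apply]
  simp only [Matrix.trace, Matrix.diag, Matrix.mul_apply, outcomeOp, Matrix.of_apply,
    Matrix.conjTranspose_apply]

/-- The outcomes with zero ancillas are some of the outcomes of one complete measurement of a
density operator. -/
theorem sum_outcome_le {c : ℕ} {T : Op ((σ ⊕ ι) ⊕ α)} (hT : GateProd c T) {X : Op σ}
    (hX : IsDensity X) :
    ∑ w : Bits ι, (outcomeOp T w * X * (outcomeOp T w)ᴴ).trace.re ≤ 1 := by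
  have h := (impl_meas hT).isKraus.isDensity hX
  have h1 : ∀ g, 0 ≤ (meas T X g g).re := fun g => (Complex.le_def.1 (h.1.diag_nonneg (i := g))).1
  have h2 : ∑ g, (meas T X g g).re = 1 := by
    have := congrArg Complex.re h.2
    simpa [Matrix.trace, Matrix.diag] using this
  rw [sum_bits_sum] at h2
  rw [← h2]
  refine Finset.sum_le_sum fun w _ => ?_
  rw [← meas_elim_zero]
  exact Finset.single_le_sum (f := fun b => (meas T X (Sum.elim w b) (Sum.elim w b)).re)
    (fun b _ => h1 _) (Finset.mem_univ 0)

theorem outcome_nonneg (T : Op ((σ ⊕ ι) ⊕ α)) {X : Op σ} (hX : X.PosSemidef) (w : Bits ι) :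
    0 ≤ (outcomeOp T w * X * (outcomeOp T w)ᴴ).trace.re :=
  (Complex.le_def.1 (hX.mul_mul_conjTranspose_same _).trace_nonneg).1

/-- The hypothesis bounds an amplitude averaged over all shifts and all `y`. One shift reaches the
average; two applications of Cauchy-Schwarz, over `y` and inside the trace, turn amplitude `δ` into
probability `δ ^ 2`. -/
theorem exists_guess {Y : Type} [Fintype Y] [Nonempty Y] {φ : Y → Op σ}
    (hφ : ∀ y, IsDensity (φ y)) (w : Y → Bits ι) (T : Op ((σ ⊕ ι) ⊕ α)) {δ : ℝ}
    (hδ : 2 ^ Fintype.card ι * Fintype.card Y * δ ≤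
      ‖∑ y, ((∑ v, sgn (∑ j, w y j * v j) • diagBlock T v) * φ y).trace‖) (hδ0 : 0 ≤ δ) :
    ∃ s, Fintype.card Y * δ ^ 2 ≤ ∑ y, (outcomeOp (hadConj s T) (w y) * φ y *
      (outcomeOp (hadConj s T) (w y))ᴴ).trace.re := by
  have h1 : ∑ y, ((∑ v, sgn (∑ j, w y j * v j) • diagBlock T v) * φ y).trace =
      ∑ s, ∑ y, (outcomeOp (hadConj s T) (w y) * φ y).trace := by
    rw [Finset.sum_comm]
    refine Finset.sum_congr rfl fun y _ => ?_
    rw [← sum_outcomeOp_hadConj, Matrix.sum_mul, Matrix.trace_sum]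
  rw [h1] at hδ
  have hcard : (Fintype.card (Bits ι) : ℝ) = 2 ^ Fintype.card ι := by
    simp [ZMod.card]
  obtain ⟨s, hs⟩ : ∃ s, Fintype.card Y * δ ≤
      ‖∑ y, (outcomeOp (hadConj s T) (w y) * φ y).trace‖ := by
    by_contra! hcon
    have h2 := Finset.sum_lt_sum_of_nonempty (Finset.univ_nonempty (α := Bits ι))
      fun s _ => hcon s
    rw [Finset.sum_const, Finset.card_univ, nsmul_eq_mul, hcard, ← mul_assoc] at h2
    exact absurd (hδ.trans (norm_sum_le _ _)) (not_le.2 h2)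
  refine ⟨s, ?_⟩
  have hY : (0 : ℝ) < Fintype.card Y := by exact_mod_cast Fintype.card_pos
  have h3 : Fintype.card Y * δ ≤ ∑ y, ‖(outcomeOp (hadConj s T) (w y) * φ y).trace‖ :=
    hs.trans (norm_sum_le _ _)
  -- Cauchy-Schwarz over `y`.
  have h4 : (Fintype.card Y * δ) ^ 2 ≤ Fintype.card Y *
      ∑ y, ‖(outcomeOp (hadConj s T) (w y) * φ y).trace‖ ^ 2 :=
    (pow_le_pow_left₀ (by positivity) h3 2).trans (sq_sum_le_card_mul_sum_sq (s := Finset.univ))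
  have h5 : Fintype.card Y * δ ^ 2 ≤
      ∑ y, ‖(outcomeOp (hadConj s T) (w y) * φ y).trace‖ ^ 2 := by
    refine le_of_mul_le_mul_left ?_ hY
    calc (Fintype.card Y : ℝ) * (Fintype.card Y * δ ^ 2) = (Fintype.card Y * δ) ^ 2 := by ring
      _ ≤ _ := h4
  exact h5.trans (Finset.sum_le_sum fun y _ => normSq_trace_le (hφ y) _)

theorem trace_corner_mul_tensor (T : Op ((σ ⊕ ι) ⊕ α)) (φ : Op σ) (v : Bits ι) :
    (corner T * tensor φ (basisProj v)).trace = (diagBlock T v * φ).trace := by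
  simp only [Matrix.trace, Matrix.diag, Matrix.mul_apply, sum_bits_sum, corner_apply, tensor_elim,
    basisProj_apply, diagBlock, Matrix.of_apply]
  refine Finset.sum_congr rfl fun p _ => ?_
  rw [Finset.sum_comm]
  refine Finset.sum_congr rfl fun q _ => ?_
  rw [Finset.sum_eq_single v, Finset.sum_eq_single v]
  · simp
  · intro b _ hb
    simp [hb.symm]
  · simp
  · intro b _ hb
    simp [hb.symm]
  · simp

end Measure

/-! ### The masked states and the amplified state -/

section Masked

variable {r h : ℕ}

theorem pauliMask_apply (x z : ZMod 2) (u v : Bits Unit) :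
    pauliMask x z u v = if u () = v () + x then sgn (z * v ()) else 0 := by
  have hu : u = fun _ => u () := rfl
  have hv : v = fun _ => v () := rfl
  rw [hu, hv]
  generalize u () = a
  generalize v () = b
  have h0 : (0 : ZMod 2).val = 0 := rfl
  have h1 : (1 : ZMod 2).val = 1 := rfl
  have hc : ∀ a b : ZMod 2, ((fun _ : Unit => a) = fun _ => b) ↔ a = b := fun a b =>
    ⟨fun h => congrFun h (), fun h => by rw [h]⟩
  rcases zmod_two_cases x with rfl | rfl <;> rcases zmod_two_cases z with rfl | rfl <;>
    simp only [pauliMask, h0, h1, pow_zero, pow_one, Matrix.mul_one, Matrix.one_mul, pauliX,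
      pauliZ, Matrix.mul_diagonal, Matrix.of_apply, Matrix.diagonal_apply, Matrix.one_apply, hc] <;>
    rcases zmod_two_cases a with rfl | rfl <;> rcases zmod_two_cases b with rfl | rfl <;>
    simp [zmod_two_add_self]

theorem pauliMask_mem_unitaryGroup (x z : ZMod 2) :
    pauliMask x z ∈ Matrix.unitaryGroup (Bits Unit) ℂ := by
  have hX : pauliX ∈ Matrix.unitaryGroup (Bits Unit) ℂ := by
    have h : pauliX = basisPerm (Equiv.addRight (1 : Bits Unit)) := by
      ext u v
      simp only [pauliX, basisPerm_apply, Matrix.of_apply, Equiv.addRight_symm,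
        Equiv.coe_addRight]
      refine if_congr ⟨fun h => ?_, ?_⟩ rfl rfl
      · ext
        simp [h, add_assoc, zmod_two_add_self]
      · rintro rfl
        simp [add_assoc, zmod_two_add_self]
    rw [h]
    exact basisPerm_mem_unitaryGroup _
  exact mul_mem (pow_mem hX _) (pow_mem pauliZ_mem_unitaryGroup _)

/-- The Pauli mask on the register `B`. -/
def maskOp (r : ℕ) (y : ZMod 2 × ZMod 2) : Op (RegRB r) := tensor 1 (pauliMask y.1 y.2)

theorem gateProd_maskOp (r : ℕ) (y : ZMod 2 × ZMod 2) : GateProd 1 (maskOp r y) :=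
  (GateProd.single (by simp) (pauliMask_mem_unitaryGroup _ _)).one_tensor

/-- The reduced state on the registers `R` and `B`. -/
def reduced (ψ : PureState r h) : Op (RegRB r) := traceRight ψ.density

theorem maskedState_eq (ψ : PureState r h) (y : ZMod 2 × ZMod 2) :
    maskedState ψ y.1 y.2 = maskOp r y * reduced ψ * (maskOp r y)ᴴ := by
  simp only [maskedState, tensor_conjTranspose, Matrix.conjTranspose_one, traceRight_conj]
  rw [maskOp, tensor_conjTranspose, Matrix.conjTranspose_one]
  rfl

theorem isDensity_density (ψ : PureState r h) : IsDensity ψ.density := by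
  refine ⟨Matrix.posSemidef_vecMulVec_self_star _, ?_⟩
  rw [PureState.density, Matrix.trace_vecMulVec, dotProduct_comm]
  exact ψ.normalized

theorem isDensity_reduced (ψ : PureState r h) : IsDensity (reduced ψ) :=
  isKraus_traceRight.isDensity (isDensity_density ψ)

theorem isDensity_maskedState (ψ : PureState r h) (x z : ZMod 2) :
    IsDensity (maskedState ψ x z) := by
  rw [maskedState_eq ψ (x, z)]
  exact (isDensity_reduced ψ).conj (gateProd_maskOp r _).mem_unitaryGroup

/-- The state of the `n` masked copies, for the masks `y`. -/
def maskedFamily (ψ : PureState r h) {n : ℕ} (y : Fin n → ZMod 2 × ZMod 2) :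
    Op (Fin n × RegRB r) :=
  tensorFamily fun i => maskedState ψ (y i).1 (y i).2

theorem isDensity_maskedFamily (ψ : PureState r h) {n : ℕ} (y : Fin n → ZMod 2 × ZMod 2) :
    IsDensity (maskedFamily ψ y) :=
  IsDensity.tensorFamily fun _ => isDensity_maskedState ψ _ _

theorem sum_masks {M : Type*} [AddCommMonoid M] {n : ℕ}
    (f : (Fin n → ZMod 2) → (Fin n → ZMod 2) → M) :
    ∑ x, ∑ z, f x z =
      ∑ y : Fin n → ZMod 2 × ZMod 2, f (fun i => (y i).1) fun i => (y i).2 := by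
  rw [← Fintype.sum_prod_type']
  exact Fintype.sum_equiv (Equiv.arrowProdEquivProdArrow (Fin n) (fun _ => ZMod 2)
    (fun _ => ZMod 2)).symm _ _ fun _ => rfl

theorem amplified_eq (ψ : PureState r h) (n : ℕ) (b : ZMod 2) :
    amplified ψ n b = ((2 : ℂ) ^ (4 * n))⁻¹ • ∑ y : Fin n → ZMod 2 × ZMod 2,
      ∑ a : Fin n → ZMod 2, ∑ a' : Fin n → ZMod 2,
        tensor (maskedFamily ψ y) (basisProj (Sum.elim (Sum.elim a a')
          fun _ => a ⬝ᵥ (fun i => (y i).1) + a' ⬝ᵥ (fun i => (y i).2) + b)) := by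
  rw [amplified, sum_masks]
  rfl

theorem isDensity_amplified (ψ : PureState r h) (n : ℕ) (b : ZMod 2) :
    IsDensity (amplified ψ n b) := by
  rw [amplified_eq]
  constructor
  · refine Matrix.PosSemidef.smul ?_ ?_
    · exact Matrix.posSemidef_sum _ fun y _ => Matrix.posSemidef_sum _ fun a _ =>
        Matrix.posSemidef_sum _ fun a' _ =>
          ((isDensity_maskedFamily ψ y).tensor (isDensity_basisProj _)).1
    · have : ((2 : ℂ) ^ (4 * n))⁻¹ = (((2 : ℝ) ^ (4 * n))⁻¹ : ℝ) := by push_cast; rfl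
      rw [this]
      exact Complex.zero_le_real.2 (by positivity)
  · simp only [Matrix.trace_smul, Matrix.trace_sum,
      ((isDensity_maskedFamily ψ _).tensor (isDensity_basisProj _)).2]
    simp only [Finset.sum_const, Finset.card_univ, Fintype.card_pi, Fintype.card_prod, ZMod.card,
      Finset.prod_const, Fintype.card_fin, nsmul_eq_mul, smul_eq_mul, mul_one, Nat.cast_pow,
      Nat.cast_ofNat, Nat.cast_mul]
    rw [pow_mul]
    field_simp
    rw [← pow_mul, ← pow_mul, ← pow_mul, ← pow_add]
    congr 1
    ring

/-- The frequency that belongs to the masks `y`, on the registers of `a`, `a'` and the bit. -/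
def frequency {n : ℕ} (y : Fin n → ZMod 2 × ZMod 2) : Bits ((Fin n ⊕ Fin n) ⊕ Unit) :=
  Sum.elim (Sum.elim (fun i => (y i).1) fun i => (y i).2) fun _ => 1

/-- The last coordinate of the frequency is `1`, so the sign at public word `(a, a', t)` is that of
`t` plus the inner product, which is the bit `b` for which this word occurs. The character sum is
therefore the difference of the cases `b = 0` and `b = 1`. -/
theorem sum_sgn_frequency {n : ℕ} (y : Fin n → ZMod 2 × ZMod 2)
    (f : Bits ((Fin n ⊕ Fin n) ⊕ Unit) → ℂ) :
    ∑ v, sgn (∑ j, frequency y j * v j) * f v =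
      ∑ a : Fin n → ZMod 2, ∑ a' : Fin n → ZMod 2,
        (f (Sum.elim (Sum.elim a a')
          fun _ => a ⬝ᵥ (fun i => (y i).1) + a' ⬝ᵥ (fun i => (y i).2) + 0) -
        f (Sum.elim (Sum.elim a a')
          fun _ => a ⬝ᵥ (fun i => (y i).1) + a' ⬝ᵥ (fun i => (y i).2) + 1)) := by
  rw [sum_bits_sum, sum_bits_sum]
  refine Finset.sum_congr rfl fun a _ => Finset.sum_congr rfl fun a' _ => ?_
  have h : ∀ t : ZMod 2, ∑ j, frequency y j * (Sum.elim (Sum.elim a a') fun _ : Unit => t) j =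
      a ⬝ᵥ (fun i => (y i).1) + a' ⬝ᵥ (fun i => (y i).2) + t := by
    intro t
    simp only [Fintype.sum_sum_type, frequency, Sum.elim_inl, Sum.elim_inr, dotProduct, mul_comm]
    simp
  rw [sum_bits_unit, h, h]
  generalize a ⬝ᵥ (fun i => (y i).1) + a' ⬝ᵥ (fun i => (y i).2) = c
  rcases zmod_two_cases c with rfl | rfl
  · simp [sub_eq_add_neg]
  · rw [show (1 : ZMod 2) + 1 = 0 from rfl]
    simp [sub_eq_add_neg, add_comm]

/-- The Goldreich-Levin step. The difference of the two output states is the character sum at the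
frequency `(x, z, 1)`, so `exists_guess` applies with `δ` the absolute advantage. The factor `4 ^ n`
counts the masks. -/
theorem exists_predictor {n N : ℕ} (ψ : PureState r h) {D : Channel (RegOut r n) Unit}
    (hD : Impl N D.map) :
    ∃ (α : Type) (_ : Fintype α) (_ : DecidableEq α)
      (T : Op ((Fin n × RegRB r ⊕ ((Fin n ⊕ Fin n) ⊕ Unit)) ⊕ α)),
      Fintype.card α ≤ N ∧ GateProd (2 * N + 1 + 2 * (2 * n + 1)) T ∧
      4 ^ n * advantage D (amplified ψ n 0) (amplified ψ n 1) ^ 2 ≤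
        ∑ y : Fin n → ZMod 2 × ZMod 2, (outcomeOp T (frequency y) * maskedFamily ψ y *
          (outcomeOp T (frequency y))ᴴ).trace.re := by
  obtain ⟨α, _, _, T, hα, hT, hTr⟩ := hD.exists_observable
  have hcard : (Fintype.card (Fin n → ZMod 2 × ZMod 2) : ℝ) = 4 ^ n := by
    simp [ZMod.card]
  have hcardV : Fintype.card ((Fin n ⊕ Fin n) ⊕ Unit) = 2 * n + 1 := by
    simp; ring
  set A := advantage D (amplified ψ n 0) (amplified ψ n 1) with hA
  -- The output probabilities add up to one, so the mean of `Z` is `1 - 2 * P(1)`, and the two means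
  -- differ by twice the advantage.
  have hdiff : ∀ b, (corner T * amplified ψ n b).trace.re =
      1 - 2 * (D.map (amplified ψ n b) (fun _ => 1) (fun _ => 1)).re := by
    intro b
    have h1 : (D.map (amplified ψ n b)).trace = 1 :=
      (D.trace_map _).trans (isDensity_amplified ψ n b).2
    rw [Matrix.trace, sum_bits_unit] at h1
    have h2 := congrArg Complex.re h1
    simp only [Matrix.diag, Complex.add_re, Complex.one_re] at h2
    rw [hTr, Complex.sub_re]
    linarith
  have hsum : ∑ y : Fin n → ZMod 2 × ZMod 2,
      ((∑ v, sgn (∑ j, frequency y j * v j) • diagBlock T v) * maskedFamily ψ y).trace =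
      2 ^ (4 * n) * ((corner T * amplified ψ n 0).trace - (corner T * amplified ψ n 1).trace) := by
    have h1 : ∀ b, 2 ^ (4 * n) * (corner T * amplified ψ n b).trace =
        ∑ y : Fin n → ZMod 2 × ZMod 2, ∑ a : Fin n → ZMod 2, ∑ a' : Fin n → ZMod 2,
          (diagBlock T (Sum.elim (Sum.elim a a') fun _ =>
            a ⬝ᵥ (fun i => (y i).1) + a' ⬝ᵥ (fun i => (y i).2) + b) * maskedFamily ψ y).trace := by
      intro b
      rw [amplified_eq, Matrix.mul_smul, Matrix.trace_smul, smul_eq_mul, ← mul_assoc,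
        mul_inv_cancel₀ (by positivity), one_mul]
      simp only [Matrix.mul_sum, Matrix.trace_sum, trace_corner_mul_tensor]
    rw [mul_sub, h1, h1, ← Finset.sum_sub_distrib]
    refine Finset.sum_congr rfl fun y _ => ?_
    simp only [← Finset.sum_sub_distrib]
    rw [← sum_sgn_frequency y fun v => (diagBlock T v * maskedFamily ψ y).trace]
    simp only [Matrix.sum_mul, Matrix.trace_sum, Matrix.smul_mul, Matrix.trace_smul, smul_eq_mul]
  obtain ⟨s, hs⟩ := exists_guess (δ := |A|) (isDensity_maskedFamily ψ) frequency T (by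
    rw [hsum, hcard, hcardV]
    have h1 : 2 * |A| ≤ ‖(corner T * amplified ψ n 0).trace - (corner T * amplified ψ n 1).trace‖ := by
      refine le_trans (le_of_eq ?_) (Complex.abs_re_le_norm _)
      rw [Complex.sub_re, hdiff, hdiff, hA, advantage, ← abs_two, ← abs_mul, abs_two]
      congr 1
      ring
    rw [norm_mul, norm_pow, Complex.norm_ofNat]
    -- The normalizations match exactly: the public register has `2 * n + 1` qubits, and the extra
    -- factor two is that of `1 - 2 * P(1)`.
    calc (2 : ℝ) ^ (2 * n + 1) * 4 ^ n * |A| = 2 ^ (4 * n) * (2 * |A|) := by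
          rw [show (4 : ℝ) = 2 ^ 2 by norm_num, ← pow_mul]
          ring
      _ ≤ _ := by gcongr) (abs_nonneg _)
  refine ⟨α, inferInstance, inferInstance, hadConj s T, hα, ?_, ?_⟩
  · have := gateProd_hadConj s hT
    rwa [hcardV] at this
  · rwa [hcard, sq_abs] at hs

end Masked

/-! ### Classical functions of registers -/

section Classical

variable {ι κ μ ν : Type} [Fintype ι] [DecidableEq ι] [Fintype κ] [DecidableEq κ]
  [Fintype μ] [DecidableEq μ] [Fintype ν] [DecidableEq ν]

/-- Measurement of the register `κ` in the computational basis, and output of the function `h` of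
the outcome. -/
def classical (h : Bits κ → Bits μ) (ρ : Op κ) : Op μ :=
  Matrix.of fun u v => if u = v then ∑ g, if h g = u then ρ g g else 0 else 0

theorem classical_apply (h : Bits κ → Bits μ) (ρ : Op κ) (u v : Bits μ) :
    classical h ρ u v = if u = v then ∑ g, if h g = u then ρ g g else 0 else 0 := rfl

theorem ampl_apply (Φ : Op ι → Op κ) (ρ : Op (ι ⊕ μ)) (a b : Bits κ) (u v : Bits μ) :
    ampl Φ ρ (Sum.elim a u) (Sum.elim b v) =
      Φ (Matrix.of fun i j => ρ (Sum.elim i u) (Sum.elim j v)) a b := rfl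

/-- Computing in stages equals computing the composite function; this allows a many-qubit predicate
to be evaluated by small gates. -/
theorem classical_ampl (h₁ : Bits ι → Bits κ) (h₂ : Bits (κ ⊕ μ) → Bits ν) (ρ : Op (ι ⊕ μ)) :
    classical h₂ (ampl (classical h₁) ρ) =
      classical (fun g => h₂ (Sum.elim (h₁ (g ∘ Sum.inl)) (g ∘ Sum.inr))) ρ := by
  ext u v
  rw [classical_apply, classical_apply]
  refine if_congr Iff.rfl ?_ rfl
  simp only [sum_bits_sum, ampl_apply, classical_apply, if_true, Matrix.of_apply]
  rw [Finset.sum_comm, Finset.sum_comm (s := Finset.univ (α := Bits ι))]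
  refine Finset.sum_congr rfl fun b _ => ?_
  have : ∀ a : Bits κ, (if h₂ (Sum.elim a b) = u then
      ∑ g, (if h₁ g = a then ρ (Sum.elim g b) (Sum.elim g b) else 0) else 0) =
      ∑ g, if h₁ g = a then if h₂ (Sum.elim a b) = u then
        ρ (Sum.elim g b) (Sum.elim g b) else 0 else 0 := by
    intro a
    split_ifs with h
    · rfl
    · simp
  simp only [this]
  rw [Finset.sum_comm]
  refine Finset.sum_congr rfl fun g _ => ?_
  rw [Finset.sum_ite_eq, if_pos (Finset.mem_univ _)]
  exact if_congr Iff.rfl rfl rfl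

/-- The permutation `|g, o⟩ ↦ |g, o + h g⟩`. -/
def xorPerm (h : Bits κ → Bits μ) : Equiv.Perm (Bits (κ ⊕ μ)) where
  toFun u := Sum.elim (u ∘ Sum.inl) (u ∘ Sum.inr + h (u ∘ Sum.inl))
  invFun u := Sum.elim (u ∘ Sum.inl) (u ∘ Sum.inr - h (u ∘ Sum.inl))
  left_inv u := by
    simp only [Sum.elim_comp_inl, Sum.elim_comp_inr, add_sub_cancel_right]
    exact Sum.elim_comp_inl_inr u
  right_inv u := by
    simp only [Sum.elim_comp_inl, Sum.elim_comp_inr, sub_add_cancel]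
    exact Sum.elim_comp_inl_inr u

theorem xorPerm_symm_elim (h : Bits κ → Bits μ) (g : Bits κ) (o : Bits μ) :
    (xorPerm h).symm (Sum.elim g o) = Sum.elim g (o - h g) := rfl

theorem xorPerm_add (h h' : Bits κ → Bits μ) : xorPerm (h + h') = xorPerm h * xorPerm h' := by
  ext u : 1
  change Sum.elim _ _ = Sum.elim _ _
  congr 1
  simp only [Pi.add_apply, xorPerm, Equiv.coe_fn_mk, Sum.elim_comp_inl, Sum.elim_comp_inr]
  abel

theorem xorPerm_zero : xorPerm (0 : Bits κ → Bits μ) = 1 := by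
  ext u : 1
  change Sum.elim _ _ = u
  rw [Pi.zero_apply, add_zero]
  exact Sum.elim_comp_inl_inr u

theorem gateProd_xorPerm_sum {β : Type*} (s : Finset β) (h : β → Bits κ → Bits μ)
    (hh : ∀ b ∈ s, GateProd 1 (basisPerm (xorPerm (h b)))) :
    GateProd s.card (basisPerm (xorPerm (∑ b ∈ s, h b))) := by
  classical
  induction s using Finset.induction_on with
  | empty =>
    rw [Finset.sum_empty, xorPerm_zero, basisPerm_one]
    exact GateProd.one _
  | insert a s ha ih =>
    rw [Finset.sum_insert ha, xorPerm_add, ← basisPerm_mul, Finset.card_insert_of_notMem ha,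
      add_comm]
    exact (hh a (Finset.mem_insert_self a s)).mul
      (ih fun b hb => hh b (Finset.mem_insert_of_mem hb))

/-- Two control qubits and one target make a three-qubit unitary, the largest gate allowed. -/
theorem gateProd_xorPerm_single (S : ι ↪ κ) (hS : Fintype.card ι ≤ 2) (φ : Bits ι → ZMod 2)
    (k : μ) : GateProd 1 (basisPerm (xorPerm fun g : Bits κ => Pi.single k (φ (g ∘ S)))) := by
  classical
  let S' : ι ⊕ Unit ↪ κ ⊕ μ := S.sumMap ⟨fun _ => k, fun _ _ _ => rfl⟩
  have hSr : ∀ x, S' (Sum.inr x) = Sum.inr k := fun _ => rfl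
  have hSl : ∀ i, S' (Sum.inl i) = Sum.inl (S i) := fun _ => rfl
  have h : basisPerm (xorPerm fun g : Bits κ => Pi.single k (φ (g ∘ S))) =
      place S' (basisPerm (xorPerm fun g (_ : Unit) => φ g)) := by
    ext u v
    rw [place_apply, basisPerm_apply, basisPerm_apply, ← ite_and]
    refine if_congr ?_ rfl rfl
    have h1 : (xorPerm fun g : Bits κ => Pi.single k (φ (g ∘ S))).symm u =
        Sum.elim (u ∘ Sum.inl) (u ∘ Sum.inr - Pi.single k (φ ((u ∘ Sum.inl) ∘ S))) := rfl
    have h2 : (xorPerm fun (g : Bits ι) (_ : Unit) => φ g).symm (u ∘ S') =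
        Sum.elim ((u ∘ Sum.inl) ∘ S) ((fun _ => u (Sum.inr k)) -
          fun _ => φ ((u ∘ Sum.inl) ∘ S)) := rfl
    rw [h1, h2]
    constructor
    · rintro rfl
      refine ⟨fun j hj => ?_, ?_⟩
      · rcases j with j | j
        · rfl
        · have hjk : j ≠ k := by
            rintro rfl
            exact hj ⟨Sum.inr (), rfl⟩
          simp [hjk]
      · ext (j | j)
        · rfl
        · simp [hSr]
    · rintro ⟨h3, h4⟩
      ext (j | j)
      · by_cases hj : j ∈ Set.range S
        · obtain ⟨i, rfl⟩ := hj
          exact congrFun h4 (Sum.inl i)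
        · exact h3 (Sum.inl j) (by
            rintro ⟨i | i, hi⟩
            · exact hj ⟨i, Sum.inl.inj hi⟩
            · exact Sum.inr_ne_inl hi)
      · by_cases hj : j = k
        · subst hj
          have := congrFun h4 (Sum.inr ())
          simpa [hSr] using this
        · have := h3 (Sum.inr j) (by
            rintro ⟨i | i, hi⟩
            · exact Sum.inl_ne_inr hi
            · exact hj (Sum.inr.inj hi).symm)
          simpa [hj] using this
  rw [h]
  refine (GateProd.single ?_ (basisPerm_mem_unitaryGroup _)).place S'
  rw [Fintype.card_sum, Fintype.card_unit]
  omega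

/-- The function is computed reversibly into fresh zeros, and discarding the input supplies the
dephasing of a measurement. -/
theorem classical_eq (h : Bits κ → Bits μ) (ρ : Op κ) :
    classical h ρ = traceRight (relabel (Equiv.sumComm κ μ)
      (basisPerm (xorPerm h) * tensor ρ (basisProj 0) * (basisPerm (xorPerm h))ᴴ)) := by
  ext u v
  have h1 : ∀ (u : Bits μ) (g : Bits κ),
      (Sum.elim u g : Bits (μ ⊕ κ)) ∘ Equiv.sumComm κ μ = Sum.elim g u := by
    intro u g
    ext (i | i) <;> rfl
  simp only [traceRight, Matrix.of_apply, relabel_apply, h1, basisPerm_conj_apply,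
    xorPerm_symm_elim, tensor_elim, basisProj_apply, classical_apply]
  have h2 : ∀ g, (0 = u - h g ∧ 0 = v - h g) ↔ (u = v ∧ h g = u) := by
    intro g
    rw [eq_comm, sub_eq_zero, eq_comm (a := (0 : Bits μ)), sub_eq_zero]
    constructor
    · rintro ⟨rfl, rfl⟩; exact ⟨rfl, rfl⟩
    · rintro ⟨rfl, h⟩; exact ⟨h.symm, h.symm⟩
  simp only [h2]
  split_ifs with huv <;> simp [huv]

theorem impl_classical {c : ℕ} {h : Bits κ → Bits μ} (hh : GateProd c (basisPerm (xorPerm h))) :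
    Impl (c + 3 * Fintype.card κ + 3 * Fintype.card μ) (classical h) := by
  have h1 := (((Impl.traceRight (ι := μ) (κ := κ)).comp_relabel (Equiv.sumComm κ μ)).comp
    (Impl.conj hh)).comp ((GenState.zero (κ := μ)).impl_tensor (ι := κ))
  have h2 : (fun ρ : Op κ => traceRight (relabel (Equiv.sumComm κ μ)
      (basisPerm (xorPerm h) * tensor ρ (basisProj 0) * (basisPerm (xorPerm h))ᴴ))) =
      classical h := by
    ext1 ρ; exact (classical_eq h ρ).symm
  rw [h2] at h1
  refine h1.mono ?_
  simp only [Fintype.card_sum]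
  omega

open Classical in
/-- The failure flag: `0` if all qubits satisfy the predicate, and `1` otherwise. -/
noncomputable def flag (good : κ → ZMod 2 → Prop) (g : Bits κ) : Bits Unit :=
  fun _ => if ∀ j, good j (g j) then 0 else 1

theorem flag_of_forall {good : κ → ZMod 2 → Prop} {g : Bits κ} (h : ∀ j, good j (g j)) :
    flag good g = 0 := by
  ext
  exact if_pos h

theorem flag_of_not {good : κ → ZMod 2 → Prop} {g : Bits κ} (h : ¬ ∀ j, good j (g j)) :
    flag good g = 1 := by
  ext
  exact if_neg h

/-- The flag is accumulated qubit by qubit: each further qubit is combined with the running flag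
into a new flag by one three-qubit gate. -/
theorem impl_flag_fin {m : ℕ} (good : Fin m → ZMod 2 → Prop) :
    Impl (13 * m + 1) (classical (flag good)) := by
  induction m with
  | zero =>
    have h := ((GenState.zero (κ := Unit)).impl_tensor (ι := Fin 0)).relabel_comp
      (Equiv.emptySum (Fin 0) Unit)
    refine Impl.mono (Φ := classical (flag good)) ?_ (by simp : Fintype.card Unit ≤ 13 * 0 + 1)
    convert h using 1
    ext ρ u v
    have h1 : ∀ g, flag good g = 0 := by
      intro g
      exact flag_of_forall fun j => j.elim0
    rw [classical_apply, relabel_apply, tensor_apply, basisProj_apply]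
    simp only [h1]
    rw [Fintype.sum_unique]
    have h2 : ∀ u : Bits Unit, (u ∘ Equiv.emptySum (Fin 0) Unit) ∘ Sum.inr = u := fun u => rfl
    rw [h2, h2, Subsingleton.elim ((u ∘ Equiv.emptySum (Fin 0) Unit) ∘ Sum.inl) default,
      Subsingleton.elim ((v ∘ Equiv.emptySum (Fin 0) Unit) ∘ Sum.inl) default]
    by_cases huv : u = v
    · subst huv
      simp only [if_true, and_self, mul_ite, mul_one, mul_zero]
      exact if_congr Iff.rfl (congrArg₂ ρ (Subsingleton.elim _ _) (Subsingleton.elim _ _)) rfl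
    · have : ¬ (0 = u ∧ 0 = v) := fun h => huv (h.1.symm.trans h.2)
      simp [huv, this]
  | succ m ih =>
    have hor : Impl 10 (classical fun u : Bits (Unit ⊕ Fin 1) =>
        fun _ : Unit => open Classical in
          if u (Sum.inl ()) = 0 ∧ good (Fin.last m) (u (Sum.inr 0)) then (0 : ZMod 2) else 1) :=
      (impl_classical (GateProd.single (by simp) (basisPerm_mem_unitaryGroup _))).mono (by simp)
    have h := (hor.comp ((ih fun j => good j.castSucc).ampl (μ := Fin 1))).comp_relabel
      (finSumFinEquiv (m := m) (n := 1)).symm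
    simp only [classical_ampl] at h
    refine Impl.mono (Φ := classical (flag good)) ?_
      (by simp; omega : 10 + (13 * m + 1) + Fintype.card (Unit ⊕ Fin 1) ≤ 13 * (m + 1) + 1)
    convert h using 1
    ext ρ u v
    rw [classical_apply, classical_apply]
    refine if_congr Iff.rfl ?_ rfl
    rw [← sum_bits_equiv (finSumFinEquiv (m := m) (n := 1)).symm]
    refine Finset.sum_congr rfl fun g _ => ?_
    rw [relabel_apply]
    refine if_congr (iff_of_eq (congrArg (· = u) ?_)) rfl rfl
    ext
    have h1 : ∀ i : Fin m, (finSumFinEquiv (m := m) (n := 1)).symm i.castSucc = Sum.inl i :=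
      finSumFinEquiv_symm_apply_castSucc
    have h2 : (finSumFinEquiv (m := m) (n := 1)).symm (Fin.last m) = Sum.inr 0 :=
      finSumFinEquiv_symm_last
    have h4 : (∀ j, good j ((g ∘ (finSumFinEquiv (m := m) (n := 1)).symm) j)) ↔
        (∀ i : Fin m, good i.castSucc (g (Sum.inl i))) ∧ good (Fin.last m) (g (Sum.inr 0)) := by
      rw [Fin.forall_fin_succ']
      simp only [Function.comp_apply, h1, h2]
    by_cases h3 : ∀ i : Fin m, good i.castSucc (g (Sum.inl i))
    · have h5 : flag (fun j : Fin m => good j.castSucc) (g ∘ Sum.inl) () = 0 := if_pos h3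
      by_cases h6 : good (Fin.last m) (g (Sum.inr 0))
      · rw [flag_of_forall (h4.2 ⟨h3, h6⟩)]
        simp [h5, h6]
      · rw [flag_of_not fun h => h6 (h4.1 h).2]
        simp [h6]
    · have h5 : flag (fun j : Fin m => good j.castSucc) (g ∘ Sum.inl) () = 1 := if_neg h3
      rw [flag_of_not fun h => h3 (h4.1 h).1]
      simp [h5]

theorem impl_flag (good : κ → ZMod 2 → Prop) :
    Impl (13 * Fintype.card κ + 1) (classical (flag good)) := by
  let e := Fintype.equivFin κ
  have h := (impl_flag_fin fun j => good (e.symm j)).comp_relabel e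
  convert h using 1
  ext ρ u v
  rw [classical_apply, classical_apply]
  refine if_congr Iff.rfl ?_ rfl
  rw [← sum_bits_equiv e]
  refine Finset.sum_congr rfl fun g _ => ?_
  rw [relabel_apply]
  refine if_congr (iff_of_eq (congrArg (· = u) ?_)) rfl rfl
  by_cases h1 : ∀ j, good j ((g ∘ e) j)
  · rw [flag_of_forall (good := good) h1]
    exact (flag_of_forall fun j => by simpa using h1 (e.symm j)).symm
  · rw [flag_of_not (good := good) h1]
    exact (flag_of_not fun h => h1 fun j => by simpa using h (e j)).symm

end Classical

/-! ### Controlled Pauli operators -/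

section Control

variable {ι κ : Type} [Fintype ι] [DecidableEq ι] [Fintype κ] [DecidableEq κ]

/-- The Pauli mask `t g` on a qubit, controlled by the value `g` of the register `κ`. -/
def ctrlPauli (t : Bits κ → ZMod 2 × ZMod 2) : Op (κ ⊕ Unit) :=
  Matrix.of fun u v => if u ∘ Sum.inl = v ∘ Sum.inl then
    pauliMask (t (u ∘ Sum.inl)).1 (t (u ∘ Sum.inl)).2 (u ∘ Sum.inr) (v ∘ Sum.inr) else 0

theorem ctrlPauli_elim (t : Bits κ → ZMod 2 × ZMod 2) (g g' : Bits κ) (d d' : Bits Unit) :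
    ctrlPauli t (Sum.elim g d) (Sum.elim g' d') =
      if g = g' then pauliMask (t g).1 (t g).2 d d' else 0 := rfl

theorem ctrlPauli_conj_apply (t : Bits κ → ZMod 2 × ZMod 2) (ρ : Op (κ ⊕ Unit)) (g g' : Bits κ)
    (d d' : Bits Unit) :
    (ctrlPauli t * ρ * (ctrlPauli t)ᴴ) (Sum.elim g d) (Sum.elim g' d') =
      (pauliMask (t g).1 (t g).2 * (Matrix.of fun i j => ρ (Sum.elim g i) (Sum.elim g' j)) *
        (pauliMask (t g').1 (t g').2)ᴴ) d d' := by
  simp only [Matrix.mul_apply, sum_bits_sum (ι := κ), ctrlPauli_elim, Matrix.conjTranspose_apply,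
    Matrix.of_apply, apply_ite star, star_zero, mul_ite, ite_mul, mul_zero, zero_mul]
  rw [Finset.sum_comm]
  refine Finset.sum_congr rfl fun i _ => ?_
  rw [Finset.sum_ite_eq, if_pos (Finset.mem_univ _)]
  congr 1
  rw [Finset.sum_comm]
  refine Finset.sum_congr rfl fun j _ => ?_
  rw [Finset.sum_ite_eq, if_pos (Finset.mem_univ _)]

theorem ctrlPauli_mem_unitaryGroup (t : Bits κ → ZMod 2 × ZMod 2) :
    ctrlPauli t ∈ Matrix.unitaryGroup (Bits (κ ⊕ Unit)) ℂ := by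
  rw [Matrix.mem_unitaryGroup_iff, Matrix.star_eq_conjTranspose]
  ext u v
  rw [← Sum.elim_comp_inl_inr u, ← Sum.elim_comp_inl_inr v]
  generalize u ∘ Sum.inl = g
  generalize v ∘ Sum.inl = g'
  generalize u ∘ Sum.inr = d
  generalize v ∘ Sum.inr = d'
  rw [← tensor_one_one, tensor_elim]
  simp only [Matrix.mul_apply, sum_bits_sum (ι := κ), ctrlPauli_elim, Matrix.conjTranspose_apply,
    apply_ite star, star_zero, mul_ite, ite_mul, mul_zero, zero_mul]
  rw [Finset.sum_comm]
  have h : ∀ i : Bits Unit, ∑ x : Bits κ, (if g' = x then if g = x then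
      pauliMask (t g).1 (t g).2 d i * star (pauliMask (t g').1 (t g').2 d' i) else 0 else 0) =
      (1 : Op κ) g g' * (pauliMask (t g).1 (t g).2 d i *
        (pauliMask (t g).1 (t g).2)ᴴ i d') := by
    intro i
    rw [Finset.sum_ite_eq, if_pos (Finset.mem_univ _), Matrix.one_apply]
    split_ifs with hg
    · subst hg; rw [one_mul, Matrix.conjTranspose_apply]
    · rw [zero_mul]
  simp only [h, ← Finset.mul_sum, ← Matrix.mul_apply]
  rw [← Matrix.star_eq_conjTranspose,
    Matrix.mem_unitaryGroup_iff.1 (pauliMask_mem_unitaryGroup _ _)]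

theorem gateProd_ctrlPauli (S : ι ↪ κ) (hS : Fintype.card ι ≤ 2)
    (t : Bits ι → ZMod 2 × ZMod 2) :
    GateProd 1 (ctrlPauli fun g : Bits κ => t (g ∘ S)) := by
  classical
  let S' : ι ⊕ Unit ↪ κ ⊕ Unit := S.sumMap (Function.Embedding.refl Unit)
  have h : (ctrlPauli fun g : Bits κ => t (g ∘ S)) = place S' (ctrlPauli t) := by
    ext u v
    rw [place_apply, ctrlPauli, ctrlPauli, Matrix.of_apply, Matrix.of_apply, ← ite_and]
    refine if_congr ⟨fun h => ⟨?_, ?_⟩, ?_⟩ rfl rfl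
    · rintro (j | j) hj
      · exact congrFun h j
      · exact absurd ⟨Sum.inr j, rfl⟩ hj
    · ext i
      exact congrFun h (S i)
    · rintro ⟨h1, h2⟩
      ext j
      by_cases hj : j ∈ Set.range S
      · obtain ⟨i, rfl⟩ := hj
        exact congrFun h2 i
      · exact h1 (Sum.inl j) (by
          rintro ⟨i | i, hi⟩
          · exact hj ⟨i, Sum.inl.inj hi⟩
          · exact absurd hi (by simp [S']))
  rw [h]
  refine (GateProd.single ?_ (ctrlPauli_mem_unitaryGroup t)).place S'
  rw [Fintype.card_sum, Fintype.card_unit]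
  omega

/-- The density operator `|epr⟩⟨epr|`. -/
noncomputable def eprOp : Op (Unit ⊕ Unit) := Matrix.vecMulVec epr (star epr)

theorem epr_apply (a b : Bits Unit) :
    epr (Sum.elim a b) = if a = b then (((Real.sqrt 2)⁻¹ : ℝ) : ℂ) else 0 := by
  simp only [epr, Sum.elim_inl, Sum.elim_inr, one_div]
  refine if_congr ⟨fun h => ?_, fun h => by rw [h]⟩ rfl rfl
  ext; exact h

theorem eprOp_apply (a b c d : Bits Unit) :
    eprOp (Sum.elim a b) (Sum.elim c d) = if a = b ∧ c = d then 1 / 2 else 0 := by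
  rw [eprOp, Matrix.vecMulVec_apply, Pi.star_apply, epr_apply, epr_apply, ite_and]
  split_ifs
  · rw [Complex.star_def, Complex.conj_ofReal, inv_sqrt_two_mul_self]
  · rw [star_zero, mul_zero]
  · rw [zero_mul]
  · rw [zero_mul]

/-- A Hadamard gate followed by a controlled NOT on `|00⟩`. -/
theorem genState_eprOp : GenState 6 eprOp := by
  have hS : GateProd 1 (hadShift (0 : Bits Unit)) :=
    GateProd.piOp (ι := Unit) fun j => had_mem_unitaryGroup _
  have hU : GateProd 2 (basisPerm (xorPerm fun g : Bits Unit => g) *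
      tensor (hadShift (0 : Bits Unit)) (1 : Op Unit)) :=
    (GateProd.single (by simp) (basisPerm_mem_unitaryGroup _)).mul (hS.tensor_one (κ := Unit))
  have h := GenState.apply (Impl.conj hU) (GenState.zero (κ := Unit ⊕ Unit))
  have h1 : eprOp = basisPerm (xorPerm fun g : Bits Unit => g) *
      tensor (hadShift (0 : Bits Unit)) (1 : Op Unit) * basisProj 0 *
      (basisPerm (xorPerm fun g : Bits Unit => g) *
      tensor (hadShift (0 : Bits Unit)) (1 : Op Unit))ᴴ := by
    set U := basisPerm (xorPerm fun g : Bits Unit => g) *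
      tensor (hadShift (0 : Bits Unit)) (1 : Op Unit) with hUdef
    have h2 : ∀ u, U u 0 = epr u := by
      intro u
      rw [← Sum.elim_comp_inl_inr u]
      generalize u ∘ Sum.inl = a
      generalize u ∘ Sum.inr = b
      rw [hUdef, basisPerm_mul_apply, xorPerm_symm_elim, epr_apply,
        show (0 : Bits (Unit ⊕ Unit)) = Sum.elim (0 : Bits Unit) (0 : Bits Unit) from
          (Sum.elim_comp_inl_inr (0 : Bits (Unit ⊕ Unit))).symm,
        tensor_elim, hadShift, piOp_apply, Matrix.one_apply]
      simp [had_apply, sub_eq_zero, eq_comm]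
    ext u v
    rw [Matrix.mul_apply, Finset.sum_eq_single 0, Matrix.mul_apply, Finset.sum_eq_single 0,
      eprOp, Matrix.vecMulVec_apply, Pi.star_apply, Matrix.conjTranspose_apply, ← h2, ← h2,
      basisProj_apply, if_pos ⟨rfl, rfl⟩, mul_one]
    · intro b _ hb
      rw [basisProj_apply, if_neg fun h => hb h.1.symm, mul_zero]
    · simp
    · intro b _ hb
      rw [Matrix.mul_apply, Finset.sum_eq_zero, zero_mul]
      intro c _
      rw [basisProj_apply, if_neg fun h => hb h.2.symm, mul_zero]
    · simp
  rw [h1]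
  exact h.mono (by simp)

end Control

/-! ### Recognizing decoders -/

section Recognize

variable {r h : ℕ}

/-- The substitute `ρ'` covers the case of zero probability, where the conditional state is not
determined by `X` and may be chosen freely. -/
theorem exists_isDensity_smul {ι : Type} [Fintype ι] [DecidableEq ι] {X : Op ι}
    (hX : X.PosSemidef) {ρ' : Op ι} (hρ' : IsDensity ρ') :
    ∃ ρ, IsDensity ρ ∧ X = (X.trace.re : ℂ) • ρ ∧ (X.trace.re = 0 → ρ = ρ') := by
  have h0 := Complex.le_def.1 hX.trace_nonneg
  have h1 : (X.trace.re : ℂ) = X.trace := by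
    refine Complex.ext (Complex.ofReal_re _) ?_
    rw [Complex.ofReal_im]
    exact h0.2
  by_cases h : X.trace.re = 0
  · refine ⟨ρ', hρ', ?_, fun _ => rfl⟩
    rw [h, Complex.ofReal_zero, zero_smul, ← hX.trace_eq_zero_iff, ← h1, h, Complex.ofReal_zero]
  · have h2 : (X.trace.re : ℂ) ≠ 0 := Complex.ofReal_ne_zero.2 h
    refine ⟨((X.trace.re : ℂ))⁻¹ • X, ⟨hX.smul ?_, ?_⟩, ?_, fun h' => absurd h' h⟩
    · rw [← Complex.ofReal_inv]
      exact Complex.zero_le_real.2 (inv_nonneg.2 h0.1)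
    · rw [Matrix.trace_smul, smul_eq_mul, ← h1]
      exact inv_mul_cancel₀ h2
    · rw [smul_smul, mul_inv_cancel₀ h2, one_smul]

theorem eprFidelity_eq (X : Op (Unit ⊕ Unit)) :
    eprFidelity X =
      (1 / 2 * ∑ b : Bits Unit, ∑ b' : Bits Unit, X (Sum.elim b b) (Sum.elim b' b')).re := by
  rw [eprFidelity]
  congr 1
  have h1 : ∀ u, (X *ᵥ epr) u = ∑ b', X u (Sum.elim b' b') * (((Real.sqrt 2)⁻¹ : ℝ) : ℂ) := by
    intro u
    simp only [Matrix.mulVec, dotProduct, sum_bits_sum, epr_apply, mul_ite, mul_zero,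
      Finset.sum_ite_eq, Finset.mem_univ, if_true]
  simp only [dotProduct, h1, sum_bits_sum, Pi.star_apply, epr_apply, apply_ite star, star_zero,
    ite_mul, zero_mul, Finset.sum_ite_eq, Finset.mem_univ, if_true]
  simp only [Finset.mul_sum]
  refine Finset.sum_congr rfl fun b _ => Finset.sum_congr rfl fun b' _ => ?_
  rw [Complex.star_def, Complex.conj_ofReal, mul_comm (X _ _), ← mul_assoc, inv_sqrt_two_mul_self]

theorem eprFidelity_smul (c : ℝ) (X : Op (Unit ⊕ Unit)) :
    eprFidelity ((c : ℂ) • X) = c * eprFidelity X := by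
  simp only [eprFidelity, Matrix.smul_mulVec, dotProduct_smul, smul_eq_mul, Complex.re_ofReal_mul]

theorem isDensity_eprOp : IsDensity eprOp := by
  refine ⟨Matrix.posSemidef_vecMulVec_self_star _, ?_⟩
  simp only [Matrix.trace, Matrix.diag, sum_bits_sum, eprOp_apply, and_self, Finset.sum_ite_eq,
    Finset.mem_univ, if_true, Finset.sum_const, Finset.card_univ]
  simp [ZMod.card]

theorem eprFidelity_eprOp : eprFidelity eprOp = 1 := by
  simp only [eprFidelity_eq, eprOp_apply, and_self, if_true, Finset.sum_const, Finset.card_univ]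
  simp [ZMod.card]

/-- The unnormalized block at `F = 0` carries both data: its trace is `γ'` and its unnormalized
fidelity is compared with that trace. If the trace vanishes, `|epr⟩⟨epr|` serves as `ρ₀`, so any
admissible `ε` is allowed. -/
theorem isDecoder_of_blocks {A : Channel (Fin r) RegFD} {ψ : PureState r h}
    (hd : IsDensity (decodedState A ψ)) {B : Bits Unit → Op (Unit ⊕ Unit)}
    (hB : ∀ f f' u v, decodedState A ψ (Sum.elim f u) (Sum.elim f' v) =
      if f = f' then B f u v else 0)
    {γ ε : ℝ} (hγ : γ ∈ Set.Icc (0 : ℝ) 1) (hε : ε ∈ Set.Icc (0 : ℝ) 1)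
    (hγB : γ ≤ (B 0).trace.re)
    (hεB : (1 / 4 + 3 / 4 * ε) * (B 0).trace.re ≤ eprFidelity (B 0)) :
    IsDecoder γ ε A ψ := by
  have hpos : ∀ f, (B f).PosSemidef := by
    intro f
    have : B f = (decodedState A ψ).submatrix (Sum.elim f) (Sum.elim f) := by
      ext u v
      rw [Matrix.submatrix_apply, hB, if_pos rfl]
    rw [this]
    exact hd.1.submatrix _
  have htr : (B 0).trace.re + (B 1).trace.re = 1 := by
    have h1 := congrArg Complex.re hd.2
    rw [Matrix.trace, sum_bits_sum, sum_bits_unit] at h1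
    simp only [Matrix.diag, hB, if_true, Complex.add_re, Complex.one_re] at h1
    exact h1
  obtain ⟨ρ₀, hρ₀, h0, h0'⟩ := exists_isDensity_smul (hpos 0) isDensity_eprOp
  obtain ⟨ρ₁, hρ₁, h1, -⟩ := exists_isDensity_smul (hpos 1) isDensity_eprOp
  refine ⟨hγ, hε, (B 0).trace.re, ρ₀, ρ₁, hγB, hρ₀, hρ₁, ?_, ?_⟩
  · have h2 : 1 - (B 0).trace.re = (B 1).trace.re := by linarith
    rw [h2]
    ext u v
    rw [← Sum.elim_comp_inl_inr u, ← Sum.elim_comp_inl_inr v, hB]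
    generalize u ∘ Sum.inl = f
    generalize v ∘ Sum.inl = f'
    generalize u ∘ Sum.inr = a
    generalize v ∘ Sum.inr = b
    rw [Matrix.add_apply, Matrix.smul_apply, Matrix.smul_apply, tensor_elim, tensor_elim,
      basisProj_apply, basisProj_apply]
    have h3 : ∀ f : Bits Unit, f = (fun _ => 0) ∨ f = fun _ => 1 := by
      intro f
      rcases zmod_two_cases (f ()) with hf | hf
      · exact Or.inl (funext fun _ => hf)
      · exact Or.inr (funext fun _ => hf)
    have h4 : ((fun _ => 0 : Bits Unit)) ≠ fun _ => 1 := fun h => zero_ne_one (congrFun h ())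
    have h5 : B (fun _ => 0) a b = ((B 0).trace.re : ℂ) • ρ₀ a b := congrFun₂ h0 a b
    have h6 : B (fun _ => 1) a b = ((B 1).trace.re : ℂ) • ρ₁ a b := congrFun₂ h1 a b
    rcases h3 f with rfl | rfl <;> rcases h3 f' with rfl | rfl <;>
      simp [h4, h4.symm, h5, h6]
  · by_cases h2 : (B 0).trace.re = 0
    · rw [h0' h2, eprFidelity_eprOp]
      linarith [hε.2]
    · have h3 : 0 < (B 0).trace.re :=
        lt_of_le_of_ne (Complex.le_def.1 (hpos 0).trace_nonneg).1 (Ne.symm h2)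
      rw [h0, eprFidelity_smul, ← h0, mul_comm] at hεB
      exact le_of_mul_le_mul_left hεB h3

end Recognize

/-! ### Teleportation -/

section Teleport

variable {r h : ℕ} {G : Type} [Fintype G] [DecidableEq G]

/-- The operation that teleports the register `B` of a fictitious copy through `M`. -/
noncomputable def teleport (M : Op (RegRB r) → Op G) (t : Bits G → ZMod 2 × ZMod 2)
    (good : G → ZMod 2 → Prop) (σ : Op (Fin r)) : Op RegFD :=
  ampl (classical (flag good)) (ctrlPauli t *
    ampl M (relabel (Equiv.sumAssoc (Fin r) Unit Unit).symm (tensor σ eprOp)) * (ctrlPauli t)ᴴ)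

theorem impl_teleport {N : ℕ} {M : Op (RegRB r) → Op G} (hM : Impl N M)
    {t : Bits G → ZMod 2 × ZMod 2} (ht : GateProd 1 (ctrlPauli t)) (good : G → ZMod 2 → Prop) :
    Impl (N + 16 * r + 16 * Fintype.card G + 100) (teleport M t good) := by
  have h1 := (((impl_flag good).ampl (μ := Unit)).comp (Impl.conj ht)).comp
    ((hM.ampl (μ := Unit)).comp ((genState_eprOp.impl_tensor (ι := Fin r)).relabel_comp
      (Equiv.sumAssoc (Fin r) Unit Unit).symm))
  refine Impl.mono h1 ?_
  simp only [Fintype.card_sum, Fintype.card_fin, Fintype.card_unit]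
  omega

/-- The operator `|a⟩⟨b|`. -/
def unitOp (a b : Bits Unit) : Op Unit := Matrix.single a b 1

/-- Expanding `|epr⟩⟨epr|` as half the sum of `|i⟩⟨j| ⊗ |i⟩⟨j|` turns the entangled input into
inputs `σ ⊗ |i⟩⟨j|` of `M`, with the Pauli correction acting on the second factor. -/
theorem teleport_apply {M : Op (RegRB r) → Op G} (hM : IsKraus M) (t : Bits G → ZMod 2 × ZMod 2)
    (good : G → ZMod 2 → Prop) (σ : Op (Fin r)) (f f' d d' : Bits Unit) :
    teleport M t good σ (Sum.elim f d) (Sum.elim f' d') = if f = f' then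
      ∑ g, if flag good g = f then 1 / 2 * ∑ i, ∑ j, pauliMask (t g).1 (t g).2 d i *
        star (pauliMask (t g).1 (t g).2 d' j) * M (tensor σ (unitOp i j)) g g else 0 else 0 := by
  rw [teleport, ampl_apply, classical_apply]
  refine if_congr Iff.rfl (Finset.sum_congr rfl fun g _ => if_congr Iff.rfl ?_ rfl) rfl
  rw [Matrix.of_apply, ctrlPauli_conj_apply]
  have h1 : ∀ i j, ampl M (relabel (Equiv.sumAssoc (Fin r) Unit Unit).symm (tensor σ eprOp))
      (Sum.elim g i) (Sum.elim g j) = 1 / 2 * M (tensor σ (unitOp i j)) g g := by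
    intro i j
    have h2 : (Matrix.of fun u v : Bits (RegRB r) =>
        relabel (Equiv.sumAssoc (Fin r) Unit Unit).symm (tensor σ eprOp) (Sum.elim u i)
          (Sum.elim v j)) = (1 / 2 : ℂ) • tensor σ (unitOp i j) := by
      ext u v
      rw [Matrix.smul_apply, tensor_apply, unitOp, Matrix.single_apply]
      change σ (u ∘ Sum.inl) (v ∘ Sum.inl) * eprOp (Sum.elim (u ∘ Sum.inr) i)
        (Sum.elim (v ∘ Sum.inr) j) = _
      rw [eprOp_apply, smul_eq_mul]
      simp only [eq_comm (a := i), eq_comm (a := j)]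
      split_ifs <;> ring
    rw [ampl_apply, h2, hM.map_smul, Matrix.smul_apply, smul_eq_mul]
  simp only [Matrix.mul_apply, Matrix.of_apply, h1, Matrix.conjTranspose_apply, Finset.sum_mul,
    Finset.mul_sum]
  rw [Finset.sum_comm]
  refine Finset.sum_congr rfl fun i _ => Finset.sum_congr rfl fun j _ => ?_
  ring

end Teleport

/-! ### The decoder given by teleportation -/

section Decoder

variable {r h : ℕ}

/-- The block `b`, `b'` of the register `B` of the reduced state. -/
noncomputable def reducedBlock (ψ : PureState r h) (b b' : Bits Unit) : Op (Fin r) :=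
  Matrix.of fun i j => reduced ψ (Sum.elim i b) (Sum.elim j b')

theorem maskedState_elim (ψ : PureState r h) (y : ZMod 2 × ZMod 2) (q q' : Bits (Fin r))
    (c c' : Bits Unit) :
    maskedState ψ y.1 y.2 (Sum.elim q c) (Sum.elim q' c') =
      ∑ b, ∑ b', pauliMask y.1 y.2 c b * star (pauliMask y.1 y.2 c' b') *
        reducedBlock ψ b b' q q' := by
  rw [maskedState_eq, Finset.sum_comm]
  simp only [Matrix.mul_apply, Matrix.conjTranspose_apply, maskOp, sum_bits_sum, one_tensor_apply,
    ite_mul, zero_mul, apply_ite star, star_zero, mul_ite, mul_zero, reducedBlock, Matrix.of_apply]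
  rw [Finset.sum_eq_single q']
  · refine Finset.sum_congr rfl fun b' _ => ?_
    rw [if_pos rfl, Finset.sum_eq_single q]
    · rw [Finset.sum_mul]
      refine Finset.sum_congr rfl fun b _ => ?_
      rw [if_pos rfl]
      ring
    · intro b _ hb
      simp [hb.symm]
    · simp
  · intro b _ hb
    simp [hb.symm]
  · simp

theorem star_pauliMask (x z : ZMod 2) (u v : Bits Unit) :
    star (pauliMask x z u v) = pauliMask x z u v := by
  rw [pauliMask_apply, apply_ite star, star_sgn, star_zero]

/-- Transposition changes a Pauli mask at most by a sign, which occurs twice here and cancels. It is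
needed since moving an operator across `|epr⟩` transposes it. -/
theorem pauliMask_transpose_mul (x z : ZMod 2) (b c b' c' : Bits Unit) :
    pauliMask x z b c * star (pauliMask x z b' c') =
      pauliMask x z c b * star (pauliMask x z c' b') := by
  simp only [star_pauliMask, pauliMask_apply]
  generalize b () = b
  generalize c () = c
  generalize b' () = b'
  generalize c' () = c'
  rcases zmod_two_cases x with rfl | rfl <;> rcases zmod_two_cases z with rfl | rfl <;>
  rcases zmod_two_cases b with rfl | rfl <;> rcases zmod_two_cases c with rfl | rfl <;>
  rcases zmod_two_cases b' with rfl | rfl <;> rcases zmod_two_cases c' with rfl | rfl <;>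
    simp [zmod_two_add_self]

/-- Orthogonality of the four Pauli operators. It yields both the Pauli twirl and the completeness
of the Bell basis. -/
theorem sum_pauliMask_mul_star (b c b' c' : Bits Unit) :
    ∑ y : ZMod 2 × ZMod 2, pauliMask y.1 y.2 c b * star (pauliMask y.1 y.2 c' b') =
      if c = c' ∧ b = b' then 2 else 0 := by
  have hc : ∀ a b : Bits Unit, a = b ↔ a () = b () := fun a b =>
    ⟨fun h => by rw [h], fun h => funext fun _ => h⟩
  rw [Fintype.sum_prod_type]
  simp only [star_pauliMask, pauliMask_apply, sum_zmod_two, hc]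
  generalize b () = b
  generalize c () = c
  generalize b' () = b'
  generalize c' () = c'
  rcases zmod_two_cases b with rfl | rfl <;> rcases zmod_two_cases c with rfl | rfl <;>
  rcases zmod_two_cases b' with rfl | rfl <;> rcases zmod_two_cases c' with rfl | rfl <;>
    simp [zmod_two_add_self] <;> norm_num

theorem tensor_unitOp_elim (ρ : Op (Fin r)) (i j c c' : Bits Unit) (q q' : Bits (Fin r)) :
    tensor ρ (unitOp i j) (Sum.elim q c) (Sum.elim q' c') =
      if i = c then if j = c' then ρ q q' else 0 else 0 := by
  rw [tensor_elim, unitOp, Matrix.single_apply, ← ite_and, mul_ite, mul_one, mul_zero]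

/-- The teleportation identity: contracting `B` and the corrected EPR half with `|epr⟩` makes `M`
act on the original copy with the mask `y` on `B`. -/
theorem sum_transpose_mask (ψ : PureState r h) (y : ZMod 2 × ZMod 2) :
    ∑ b, ∑ b', ∑ i, ∑ j, (pauliMask y.1 y.2 b i * star (pauliMask y.1 y.2 b' j)) •
      tensor (reducedBlock ψ b b') (unitOp i j) = maskedState ψ y.1 y.2 := by
  ext u v
  rw [← Sum.elim_comp_inl_inr u, ← Sum.elim_comp_inl_inr v, maskedState_elim]
  simp only [Matrix.sum_apply, Matrix.smul_apply, smul_eq_mul, tensor_unitOp_elim, mul_ite,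
    mul_zero, Finset.sum_ite_eq', Finset.mem_univ, if_true]
  refine Finset.sum_congr rfl fun b _ => Finset.sum_congr rfl fun b' _ => ?_
  have h1 : ∀ i, (∑ j, if i = u ∘ Sum.inr then if j = v ∘ Sum.inr then
      pauliMask y.1 y.2 b i * star (pauliMask y.1 y.2 b' j) *
        reducedBlock ψ b b' (u ∘ Sum.inl) (v ∘ Sum.inl) else 0 else 0) =
      if i = u ∘ Sum.inr then pauliMask y.1 y.2 b i * star (pauliMask y.1 y.2 b' (v ∘ Sum.inr)) *
        reducedBlock ψ b b' (u ∘ Sum.inl) (v ∘ Sum.inl) else 0 := by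
    intro i
    split_ifs
    · rw [Finset.sum_ite_eq', if_pos (Finset.mem_univ _)]
    · rw [Finset.sum_const_zero]
  simp only [h1, Finset.sum_ite_eq', Finset.mem_univ, if_true]
  rw [pauliMask_transpose_mul]

/-- Without the projection on `|epr⟩`, `M` sees `R` and a maximally mixed qubit, whatever correction
is applied. A uniformly random Pauli mask on `B` gives the same state. -/
theorem sum_twirl (ψ : PureState r h) (x z : ZMod 2) :
    (1 / 2 : ℂ) • ∑ d, ∑ b, ∑ i, ∑ j, (pauliMask x z d i * star (pauliMask x z d j)) •
      tensor (reducedBlock ψ b b) (unitOp i j) =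
    (1 / 4 : ℂ) • ∑ y : ZMod 2 × ZMod 2, maskedState ψ y.1 y.2 := by
  ext u v
  rw [← Sum.elim_comp_inl_inr u, ← Sum.elim_comp_inl_inr v]
  generalize u ∘ Sum.inl = q
  generalize v ∘ Sum.inl = q'
  generalize u ∘ Sum.inr = c
  generalize v ∘ Sum.inr = c'
  have h1 : ∀ d b i, (∑ j, if i = c then if j = c' then
      pauliMask x z d i * star (pauliMask x z d j) * reducedBlock ψ b b q q' else 0 else 0) =
      if i = c then pauliMask x z d i * star (pauliMask x z d c') *
        reducedBlock ψ b b q q' else 0 := by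
    intro d b i
    split_ifs
    · rw [Finset.sum_ite_eq', if_pos (Finset.mem_univ _)]
    · rw [Finset.sum_const_zero]
  simp only [Matrix.smul_apply, Matrix.sum_apply, smul_eq_mul, tensor_unitOp_elim, mul_ite,
    mul_zero, maskedState_elim, h1, Finset.sum_ite_eq', Finset.mem_univ, if_true]
  have h2 : ∑ d, pauliMask x z d c * star (pauliMask x z d c') = if c = c' then 1 else 0 := by
    simp only [pauliMask_transpose_mul x z _ c]
    have := congrFun₂ (Matrix.mem_unitaryGroup_iff.1 (pauliMask_mem_unitaryGroup x z)) c c'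
    rw [Matrix.mul_apply, Matrix.one_apply] at this
    exact this
  have h3 : ∑ d, ∑ b, pauliMask x z d c * star (pauliMask x z d c') * reducedBlock ψ b b q q' =
      if c = c' then ∑ b, reducedBlock ψ b b q q' else 0 := by
    rw [Finset.sum_comm]
    simp only [← Finset.sum_mul, h2]
    split_ifs <;> simp
  have h4 : ∑ y : ZMod 2 × ZMod 2, ∑ b, ∑ b',
      pauliMask y.1 y.2 c b * star (pauliMask y.1 y.2 c' b') * reducedBlock ψ b b' q q' =
      if c = c' then 2 * ∑ b, reducedBlock ψ b b q q' else 0 := by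
    rw [Finset.sum_comm]
    have h5 : ∀ b, ∑ y : ZMod 2 × ZMod 2, ∑ b',
        pauliMask y.1 y.2 c b * star (pauliMask y.1 y.2 c' b') * reducedBlock ψ b b' q q' =
        if c = c' then 2 * reducedBlock ψ b b q q' else 0 := by
      intro b
      rw [Finset.sum_comm]
      simp only [← Finset.sum_mul, sum_pauliMask_mul_star]
      by_cases hc : c = c' <;> simp [hc]
    simp only [h5]
    split_ifs
    · rw [Finset.mul_sum]
    · rw [Finset.sum_const_zero]
  rw [h3, h4]
  split_ifs
  · ring
  · simp

variable {G : Type} [Fintype G] [DecidableEq G]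

/-- The probability that `M` gives a good outcome on the state masked by `y g`. -/
noncomputable def goodProb (ψ : PureState r h) (M : Op (RegRB r) → Op G)
    (good : G → ZMod 2 → Prop) (y : Bits G → ZMod 2 × ZMod 2) : ℝ :=
  ∑ g, if flag good g = 0 then (M (maskedState ψ (y g).1 (y g).2) g g).re else 0

/-- Teleportation turns a measurement of one masked copy into a decoder. Success has the probability
of a good outcome under a uniform mask, and the unnormalized fidelity is a quarter of `goodProb ψ M
good t`, where each outcome `g` is tested on the mask `t g` that it announces. -/
theorem exists_decoder_of_goodProb (ψ : PureState r h) {N : ℕ} {M : Op (RegRB r) → Op G}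
    (hM : Impl N M) {t : Bits G → ZMod 2 × ZMod 2} (ht : GateProd 1 (ctrlPauli t))
    (good : G → ZMod 2 → Prop) {γ ε : ℝ} (hγ : γ ∈ Set.Icc (0 : ℝ) 1)
    (hε : ε ∈ Set.Icc (0 : ℝ) 1)
    (hγB : 4 * γ ≤ ∑ y, goodProb ψ M good fun _ => y)
    (hεB : (1 / 4 + 3 / 4 * ε) * ∑ y, (goodProb ψ M good fun _ => y) ≤ goodProb ψ M good t) :
    ∃ A : Channel (Fin r) RegFD,
      complexity A ≤ (N + 16 * r + 16 * Fintype.card G + 100 : ℕ) ∧ IsDecoder γ ε A ψ := by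
  have hI := impl_teleport hM ht good
  set L := hM.isKraus.channel.map with hL
  have hML : ∀ ρ, M ρ = L ρ := fun _ => rfl
  refine ⟨hI.isKraus.channel, Impl.complexity_le (Φ := hI.isKraus.channel) hI, ?_⟩
  -- The block of the decoded state at `F = f`, with `D` as the first and `B` as the second qubit.
  let B : Bits Unit → Op (Unit ⊕ Unit) := fun f => Matrix.of fun u v =>
    ∑ g, if flag good g = f then 1 / 2 * ∑ i, ∑ j,
      pauliMask (t g).1 (t g).2 (u ∘ Sum.inl) i * star (pauliMask (t g).1 (t g).2 (v ∘ Sum.inl) j) *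
        M (tensor (reducedBlock ψ (u ∘ Sum.inr) (v ∘ Sum.inr)) (unitOp i j)) g g else 0
  have hd : IsDensity (decodedState hI.isKraus.channel ψ) := by
    have h1 := (hI.ampl (μ := Unit)).isKraus.isDensity (isDensity_reduced ψ)
    exact ⟨posSemidef_relabel _ h1.1, (trace_relabel _ _).trans h1.2⟩
  have hB0 : (B 0).trace.re = 1 / 4 * ∑ y, goodProb ψ M good fun _ => y := by
    have h1 : (B 0).trace = ∑ g, if flag good g = 0 then
        L ((1 / 4 : ℂ) • ∑ y : ZMod 2 × ZMod 2, maskedState ψ y.1 y.2) g g else 0 := by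
      simp only [Matrix.trace, Matrix.diag, sum_bits_sum, B, Matrix.of_apply, Sum.elim_comp_inl,
        Sum.elim_comp_inr]
      rw [Finset.sum_congr rfl fun d _ => Finset.sum_comm, Finset.sum_comm]
      refine Finset.sum_congr rfl fun g _ => ?_
      split_ifs
      · rw [← sum_twirl ψ (t g).1 (t g).2]
        simp only [map_smul, map_sum, Matrix.smul_apply, Matrix.sum_apply, smul_eq_mul, hML,
          Finset.mul_sum]
      · simp only [Finset.sum_const_zero]
    simp only [goodProb]
    rw [h1, Finset.sum_comm, Complex.re_sum, Finset.mul_sum]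
    refine Finset.sum_congr rfl fun g _ => ?_
    split_ifs
    · rw [map_smul, map_sum, Matrix.smul_apply, Matrix.sum_apply, smul_eq_mul,
        show (1 / 4 : ℂ) = ((1 / 4 : ℝ) : ℂ) by push_cast; rfl, Complex.re_ofReal_mul,
        Complex.re_sum]
      simp only [hML]
    · simp
  have hBF : eprFidelity (B 0) = 1 / 4 * goodProb ψ M good t := by
    have h1 : 1 / 2 * ∑ b : Bits Unit, ∑ b' : Bits Unit, B 0 (Sum.elim b b) (Sum.elim b' b') =
        ∑ g, if flag good g = 0 then
          (1 / 4 : ℂ) * L (maskedState ψ (t g).1 (t g).2) g g else 0 := by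
      simp only [B, Matrix.of_apply, Sum.elim_comp_inl, Sum.elim_comp_inr]
      rw [Finset.sum_congr rfl fun d _ => Finset.sum_comm, Finset.sum_comm, Finset.mul_sum]
      refine Finset.sum_congr rfl fun g _ => ?_
      split_ifs
      · rw [← sum_transpose_mask ψ (t g)]
        simp only [map_smul, map_sum, Matrix.smul_apply, Matrix.sum_apply, smul_eq_mul, hML,
          Finset.mul_sum]
        refine Finset.sum_congr rfl fun b _ => Finset.sum_congr rfl fun b' _ =>
          Finset.sum_congr rfl fun i _ => Finset.sum_congr rfl fun j _ => ?_
        ring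
      · simp only [Finset.sum_const_zero, mul_zero]
    rw [eprFidelity_eq, h1, goodProb, Complex.re_sum, Finset.mul_sum]
    refine Finset.sum_congr rfl fun g _ => ?_
    split_ifs
    · rw [show (1 / 4 : ℂ) = ((1 / 4 : ℝ) : ℂ) by push_cast; rfl, Complex.re_ofReal_mul, hML]
    · simp
  refine isDecoder_of_blocks hd (B := B) ?_ hγ hε ?_ ?_
  · intro f f' u v
    rw [← Sum.elim_comp_inl_inr u, ← Sum.elim_comp_inl_inr v]
    exact teleport_apply hM.isKraus t good _ f f' _ _
  · rw [hB0]; linarith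
  · rw [hB0, hBF]; linarith

end Decoder

/-! ### Guessing a string symbol by symbol -/

section Chain

variable {Y : Type} [Fintype Y] [DecidableEq Y] [Nonempty Y] {n : ℕ}

/-- The probability that the first `k` symbols of the guess `w` of `y` are right. -/
def prefixProb (p : (Fin n → Y) → (Fin n → Y) → ℝ) (k : ℕ) (y : Fin n → Y) : ℝ :=
  ∑ w, if ∀ j : Fin n, (j : ℕ) < k → w j = y j then p w y else 0

/-- Exchanging `y i` with `t` is an involution on pairs, so resampling one symbol preserves the
uniform distribution. -/
theorem sum_sum_update (i : Fin n) (f : (Fin n → Y) → ℝ) :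
    ∑ y, ∑ t, f (Function.update y i t) = Fintype.card Y * ∑ y, f y := by
  let e : (Fin n → Y) × Y ≃ (Fin n → Y) × Y :=
    { toFun := fun a => (Function.update a.1 i a.2, a.1 i)
      invFun := fun a => (Function.update a.1 i a.2, a.1 i)
      left_inv := fun a => by simp
      right_inv := fun a => by simp }
  rw [← Fintype.sum_prod_type' fun y t => f (Function.update y i t),
    ← Equiv.sum_comp e.symm, Fintype.sum_prod_type]
  have : ∀ y t, f (Function.update (e.symm (y, t)).1 i (e.symm (y, t)).2) = f y := by
    intro y t
    exact congrArg f (congrArg Prod.fst (e.apply_symm_apply (y, t)))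
  simp only [this, Finset.sum_const, Finset.card_univ, nsmul_eq_mul, Finset.mul_sum]

/-- Otherwise, averaging over `y` gives `e (k + 1) < r * e k + β * |Y| ^ n` for the summed prefix
probabilities at every step, and hence `e n < |Y| ^ n * (r ^ n + n * β)`, against the hypothesis.
The additive `β` prevents the good ratio from occurring on an event that is too rare. -/
theorem exists_update_prefixProb {p : (Fin n → Y) → (Fin n → Y) → ℝ} (hp1 : ∀ y, ∑ w, p w y ≤ 1)
    {δ r β : ℝ} (hδ : δ * Fintype.card Y ^ n ≤ ∑ y, p y y) (hr0 : 0 ≤ r) (hr1 : r ≤ 1)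
    (hβ : 0 ≤ β) (hle : r ^ n + n * β ≤ δ) (hn : 0 < n) :
    ∃ (i : Fin n) (y : Fin n → Y),
      r * ∑ t, prefixProb p i (Function.update y i t) + Fintype.card Y * β ≤
        ∑ t, prefixProb p (i + 1) (Function.update y i t) := by
  by_contra! hcon
  set e : ℕ → ℝ := fun k => ∑ y, prefixProb p k y with he
  have hcard : (Fintype.card (Fin n → Y) : ℝ) = Fintype.card Y ^ n := by simp
  have h0 : e 0 ≤ Fintype.card Y ^ n := by
    rw [← hcard, ← nsmul_one, ← Finset.card_univ, ← Finset.sum_const]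
    refine Finset.sum_le_sum fun y _ => ?_
    simpa [prefixProb] using hp1 y
  have hlast : e n = ∑ y, p y y := by
    refine Finset.sum_congr rfl fun y _ => ?_
    rw [prefixProb, Finset.sum_eq_single y]
    · simp
    · intro w _ hw
      rw [if_neg]
      intro h
      exact hw (funext fun j => h j j.2)
    · simp
  have hY0 : (0 : ℝ) < Fintype.card Y := by exact_mod_cast Fintype.card_pos
  have hstep : ∀ k, k < n → e (k + 1) < r * e k + Fintype.card Y ^ n * β := by
    intro k hk
    have h1 := Finset.sum_lt_sum_of_nonempty (Finset.univ_nonempty (α := Fin n → Y))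
      fun y _ => hcon ⟨k, hk⟩ y
    rw [sum_sum_update, Finset.sum_add_distrib, ← Finset.mul_sum, sum_sum_update, Finset.sum_const,
      Finset.card_univ, nsmul_eq_mul, hcard] at h1
    refine lt_of_mul_lt_mul_left ?_ hY0.le
    calc (Fintype.card Y : ℝ) * e (k + 1) < _ := h1
      _ = _ := by simp only [he]; ring
  have hind : ∀ k, k ≤ n → e k ≤ Fintype.card Y ^ n * (r ^ k + k * β) := by
    intro k
    induction k with
    | zero => simpa using h0
    | succ k ih =>
      intro hk
      have h1 := ih (by omega)
      have h2 := hstep k (by omega)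
      have h3 : r * e k ≤ r * (Fintype.card Y ^ n * (r ^ k + k * β)) :=
        mul_le_mul_of_nonneg_left h1 hr0
      have h4 : r * (k * β) ≤ k * β := mul_le_of_le_one_left (by positivity) hr1
      have h5 : (Fintype.card Y : ℝ) ^ n * (r * (k * β)) ≤ Fintype.card Y ^ n * (k * β) :=
        mul_le_mul_of_nonneg_left h4 (by positivity)
      rw [pow_succ r, Nat.cast_succ]
      nlinarith
  -- The induction gives only a weak inequality, with equality possible at `0`; the strictness that
  -- contradicts `hle` comes from one last step, which needs `0 < n`.
  obtain ⟨m, rfl⟩ : ∃ m, n = m + 1 := ⟨n - 1, by omega⟩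
  have h1 := hind m (by omega)
  have h2 := hstep m (by omega)
  have h3 : r * e m ≤ r * (Fintype.card Y ^ (m + 1) * (r ^ m + m * β)) :=
    mul_le_mul_of_nonneg_left h1 hr0
  have h4 : r * (m * β) ≤ m * β := mul_le_of_le_one_left (by positivity) hr1
  have h5 : (Fintype.card Y : ℝ) ^ (m + 1) * (r * (m * β)) ≤ Fintype.card Y ^ (m + 1) * (m * β) :=
    mul_le_mul_of_nonneg_left h4 (by positivity)
  have h6 : (Fintype.card Y : ℝ) ^ (m + 1) * (r ^ (m + 1) + (m + 1 : ℕ) * β) ≤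
      Fintype.card Y ^ (m + 1) * δ := mul_le_mul_of_nonneg_left hle (by positivity)
  rw [hlast] at h2
  rw [pow_succ r, Nat.cast_succ] at h6
  nlinarith

end Chain

/-! ### From a distinguisher to a decoder -/

section Reduction

variable {r h : ℕ}

theorem flag_eq_zero_iff {κ : Type} [Fintype κ] [DecidableEq κ] {good : κ → ZMod 2 → Prop} {g : Bits κ} :
    flag good g = 0 ↔ ∀ j, good j (g j) := by
  constructor
  · intro h0
    by_contra h1
    rw [flag_of_not h1] at h0
    exact one_ne_zero (congrFun h0 ())
  · exact flag_of_forall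

/-- The outcomes for which the ancillas are zero, the bit is one, and the masks before `i` are
those of `y`. -/
def goodOutcome (α : Type) {n : ℕ} (i : Fin n) (y : Fin n → ZMod 2 × ZMod 2) :
    ((Fin n ⊕ Fin n) ⊕ Unit) ⊕ α → ZMod 2 → Prop :=
  Sum.elim (Sum.elim (Sum.elim (fun j b => (j : ℕ) < i → b = (y j).1)
    fun j b => (j : ℕ) < i → b = (y j).2) fun _ b => b = 1) fun _ b => b = 0

/-- Outcomes with nonzero ancillas or last bit `0` are rejected; the remaining ones are exactly the
frequencies of guesses `w`. -/
theorem sum_goodOutcome {α : Type} [Fintype α] [DecidableEq α] {n : ℕ} (i : Fin n)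
    (y : Fin n → ZMod 2 × ZMod 2) (F : Bits (((Fin n ⊕ Fin n) ⊕ Unit) ⊕ α) → ℝ) :
    (∑ g, if flag (goodOutcome α i y) g = 0 then F g else 0) =
      ∑ w : Fin n → ZMod 2 × ZMod 2, if ∀ j : Fin n, (j : ℕ) < i → w j = y j then
        F (Sum.elim (frequency w) 0) else 0 := by
  have h1 : ∀ (x z : Bits (Fin n)) (c : Bits Unit) (a : Bits α),
      flag (goodOutcome α i y) (Sum.elim (Sum.elim (Sum.elim x z) c) a) = 0 ↔
      a = 0 ∧ c = (fun _ => 1) ∧ ∀ j : Fin n, (j : ℕ) < i → (x j, z j) = y j := by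
    intro x z c a
    rw [flag_eq_zero_iff]
    constructor
    · intro h
      refine ⟨funext fun j => h (Sum.inr j), funext fun j => h (Sum.inl (Sum.inr j)),
        fun j hj => Prod.ext (h (Sum.inl (Sum.inl (Sum.inl j))) hj)
          (h (Sum.inl (Sum.inl (Sum.inr j))) hj)⟩
    · rintro ⟨rfl, rfl, h⟩ (((j | j) | j) | j)
      · exact fun hj => congrArg Prod.fst (h j hj)
      · exact fun hj => congrArg Prod.snd (h j hj)
      · rfl
      · rfl
  simp only [sum_bits_sum, h1]
  refine Eq.trans ?_ (sum_masks fun x z => if ∀ j : Fin n, (j : ℕ) < i → (x j, z j) = y j then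
    F (Sum.elim (Sum.elim (Sum.elim x z) fun _ => 1) 0) else 0)
  refine Finset.sum_congr rfl fun x _ => Finset.sum_congr rfl fun z _ => ?_
  rw [Finset.sum_eq_single fun _ => (1 : ZMod 2), Finset.sum_eq_single 0]
  · refine if_congr ?_ rfl rfl
    simp
  · intro a _ ha
    rw [if_neg fun h => ha h.1]
  · simp
  · intro c _ hc
    refine Finset.sum_eq_zero fun a _ => ?_
    rw [if_neg fun h => hc h.2.1]
  · simp

theorem genState_reduced {N : ℕ} {ψ : PureState r h} (hψ : GenState N ψ.density) :
    GenState (3 * N) (reduced ψ) := by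
  have h1 := hψ.card_le
  have h2 := GenState.apply (Impl.traceRight (ι := RegRB r) (κ := Fin h)) hψ
  refine GenState.mono h2 ?_
  simp only [Fintype.card_sum, Fintype.card_fin, Fintype.card_unit] at h1 ⊢
  omega

theorem genState_maskedState {N : ℕ} {ψ : PureState r h} (hψ : GenState N ψ.density)
    (y : ZMod 2 × ZMod 2) : GenState (5 * N) (maskedState ψ y.1 y.2) := by
  have h1 := hψ.card_le
  have h2 := GenState.apply (Impl.conj (gateProd_maskOp r y)) (genState_reduced hψ)
  rw [maskedState_eq]
  refine GenState.mono h2 ?_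
  simp only [Fintype.card_sum, Fintype.card_fin, Fintype.card_unit] at h1 ⊢
  omega

/-- The `i`-th copy of the register `RB`, inserted among copies that are masked by `y`. -/
noncomputable def insertMasked (ψ : PureState r h) {m : ℕ} (i : Fin (m + 1))
    (y : Fin (m + 1) → ZMod 2 × ZMod 2) (ρ : Op (RegRB r)) : Op (Fin (m + 1) × RegRB r) :=
  relabel (insertCopy (RegRB r) i)
    (tensor ρ (tensorFamily fun j => maskedState ψ (y (i.succAbove j)).1 (y (i.succAbove j)).2))

theorem insertMasked_maskedState (ψ : PureState r h) {m : ℕ} (i : Fin (m + 1))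
    (y : Fin (m + 1) → ZMod 2 × ZMod 2) (t : ZMod 2 × ZMod 2) :
    insertMasked ψ i y (maskedState ψ t.1 t.2) = maskedFamily ψ (Function.update y i t) := by
  rw [maskedFamily, tensorFamily_eq_relabel i, insertMasked]
  simp only [Function.update_self, Function.update_of_ne (Fin.succAbove_ne i _)]

theorem impl_insertMasked {N : ℕ} {ψ : PureState r h} (hψ : GenState N ψ.density) {m : ℕ}
    (i : Fin (m + 1)) (y : Fin (m + 1) → ZMod 2 × ZMod 2) :
    Impl (m * (6 * N)) (insertMasked ψ i y) := by
  have h1 := hψ.card_le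
  have h2 := ((GenState.tensorFamily fun j => genState_maskedState hψ
    (y (i.succAbove j))).impl_tensor (ι := RegRB r)).relabel_comp (insertCopy (RegRB r) i)
  refine Impl.mono h2 (Nat.mul_le_mul_left _ ?_)
  simp only [Fintype.card_sum, Fintype.card_fin, Fintype.card_unit] at h1 ⊢
  omega

/-- The three ideas meet here: the predictor, the position `i` and fixed masks `y` from the chain
rule, and teleportation at that position. For a fixed mask `t` of copy `i`, acceptance has
probability `prefixProb p i`; requiring the `i`-th guess to equal `t` as well gives `prefixProb p (i
+ 1)`. -/
theorem exists_decoder {n N K : ℕ} (hn : 0 < n) {ψ : PureState r h}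
    {D : Channel (RegOut r n) Unit} (hD : Impl N D.map) (hψ : GenState K ψ.density) {q β ε : ℝ}
    (hq0 : 0 ≤ q) (hq1 : q ≤ 1) (hβ : β ∈ Set.Icc (0 : ℝ) 1) (hε : ε ∈ Set.Icc (0 : ℝ) 1)
    (hle : q ^ n + n * β ≤ advantage D (amplified ψ n 0) (amplified ψ n 1) ^ 2)
    (hεq : 1 / 4 + 3 / 4 * ε ≤ q) :
    ∃ A : Channel (Fin r) RegFD,
      complexity A ≤ (300 * (1 + N + K) ^ 2 : ℕ) ∧ IsDecoder β ε A ψ := by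
  obtain ⟨m, rfl⟩ : ∃ m, n = m + 1 := ⟨n - 1, by omega⟩
  obtain ⟨α, _, _, T, hα, hT, hTp⟩ := exists_predictor ψ hD
  let p : (Fin (m + 1) → ZMod 2 × ZMod 2) → (Fin (m + 1) → ZMod 2 × ZMod 2) → ℝ := fun w y =>
    (outcomeOp T (frequency w) * maskedFamily ψ y * (outcomeOp T (frequency w))ᴴ).trace.re
  have hp0 : ∀ w y, 0 ≤ p w y := fun w y => outcome_nonneg T (isDensity_maskedFamily ψ y).1 _
  have hp1 : ∀ y, ∑ w, p w y ≤ 1 := by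
    intro y
    refine le_trans ?_ (sum_outcome_le hT (isDensity_maskedFamily ψ y))
    have hinj : Function.Injective (frequency (n := m + 1)) := by
      intro w w' hw
      funext j
      exact Prod.ext (congrFun hw (Sum.inl (Sum.inl j))) (congrFun hw (Sum.inl (Sum.inr j)))
    rw [← Finset.sum_image (s := Finset.univ) (g := frequency (n := m + 1))
      (f := fun v => (outcomeOp T v * maskedFamily ψ y * (outcomeOp T v)ᴴ).trace.re)
      hinj.injOn]
    exact Finset.sum_le_sum_of_subset_of_nonneg (Finset.subset_univ _) fun v _ _ =>
      outcome_nonneg T (isDensity_maskedFamily ψ y).1 v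
  have hcard : (Fintype.card (ZMod 2 × ZMod 2) : ℝ) = 4 := by simp [ZMod.card]
  obtain ⟨i, y, hiy⟩ := exists_update_prefixProb hp1
    (δ := advantage D (amplified ψ (m + 1) 0) (amplified ψ (m + 1) 1) ^ 2) (by
      rw [hcard, mul_comm]; exact hTp) hq0 hq1 hβ.1 hle hn
  rw [hcard] at hiy
  let M : Op (RegRB r) → Op (((Fin (m + 1) ⊕ Fin (m + 1)) ⊕ Unit) ⊕ α) := fun ρ =>
    meas T (insertMasked ψ i y ρ)
  have hM : Impl _ M := (impl_meas hT).comp (impl_insertMasked hψ i y)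
  -- The two outcome qubits that hold the guess of the `i`-th mask; they control the Pauli
  -- correction.
  let S : Bool ↪ ((Fin (m + 1) ⊕ Fin (m + 1)) ⊕ Unit) ⊕ α :=
    ⟨fun b => Sum.inl (Sum.inl (if b then Sum.inr i else Sum.inl i)), by
      intro b b' hb
      cases b <;> cases b' <;> simp_all⟩
  have hS := gateProd_ctrlPauli S (by simp) fun u => (u false, u true)
  have hprob : ∀ t, goodProb ψ M (goodOutcome α i y) t =
      ∑ w : Fin (m + 1) → ZMod 2 × ZMod 2, if ∀ j : Fin (m + 1), (j : ℕ) < i → w j = y j then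
        p w (Function.update y i (t (Sum.elim (frequency w) 0))) else 0 := by
    intro t
    rw [goodProb, sum_goodOutcome]
    refine Finset.sum_congr rfl fun w _ => if_congr Iff.rfl ?_ rfl
    simp only [M, p]
    rw [insertMasked_maskedState, meas_elim_zero]
  have hbefore : ∀ t, (goodProb ψ M (goodOutcome α i y) fun _ => t) =
      prefixProb p i (Function.update y i t) := by
    intro t
    rw [hprob, prefixProb]
    refine Finset.sum_congr rfl fun w _ => if_congr (forall₂_congr fun j hj => ?_) rfl rfl
    rw [Function.update_of_ne fun h => (by subst h; exact lt_irrefl _ hj)]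
  -- The mask is read off from the guess, so each `w` contributes only at `t = w i`, which is the
  -- event that the first `i + 1` guesses are right.
  have hafter : goodProb ψ M (goodOutcome α i y)
      (fun g => (fun u : Bits Bool => (u false, u true)) (g ∘ S)) =
      ∑ t, prefixProb p (i + 1) (Function.update y i t) := by
    rw [hprob]
    simp only [prefixProb]
    rw [Finset.sum_comm]
    refine Finset.sum_congr rfl fun w _ => ?_
    have h1 : ∀ t, (∀ j : Fin (m + 1), (j : ℕ) < i + 1 → w j = Function.update y i t j) ↔
        w i = t ∧ ∀ j : Fin (m + 1), (j : ℕ) < i → w j = y j := by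
      intro t
      constructor
      · intro h2
        refine ⟨by simpa using h2 i (by omega), fun j hj => ?_⟩
        have h3 := h2 j (by omega)
        rwa [Function.update_of_ne fun h => (by subst h; exact lt_irrefl _ hj)] at h3
      · rintro ⟨rfl, h2⟩ j hj
        by_cases hji : j = i
        · subst hji; simp
        · rw [Function.update_of_ne hji]
          exact h2 j (by have : (j : ℕ) ≠ i := fun h => hji (Fin.ext h)
                         omega)
    simp only [h1, ite_and]
    rw [Finset.sum_ite_eq, if_pos (Finset.mem_univ _)]
    rfl
  -- Together with the gain `4 * β` this bounds the acceptance probability itself from below, as the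
  -- parameter `γ = β` requires.
  have hmono : ∀ y', prefixProb p (i + 1) y' ≤ prefixProb p i y' := by
    intro y'
    refine Finset.sum_le_sum fun w _ => ?_
    by_cases h1 : ∀ j : Fin (m + 1), (j : ℕ) < i + 1 → w j = y' j
    · rw [if_pos h1, if_pos fun j hj => h1 j (by omega)]
    · rw [if_neg h1]
      split_ifs
      · exact hp0 _ _
      · exact le_rfl
  have hE0 : 0 ≤ ∑ t, prefixProb p i (Function.update y i t) :=
    Finset.sum_nonneg fun t _ => Finset.sum_nonneg fun w _ => by
      split_ifs
      · exact hp0 _ _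
      · exact le_rfl
  have hE1 : ∑ t, prefixProb p (i + 1) (Function.update y i t) ≤
      ∑ t, prefixProb p i (Function.update y i t) := Finset.sum_le_sum fun t _ => hmono _
  obtain ⟨A, hA, hdec⟩ := exists_decoder_of_goodProb ψ hM hS (goodOutcome α i y) hβ hε
    (by
      simp only [hbefore]
      have := mul_nonneg hq0 hE0
      linarith)
    (by
      rw [hafter]
      simp only [hbefore]
      have := mul_le_mul_of_nonneg_right hεq hE0
      linarith [hβ.1])
  refine ⟨A, hA.trans ?_, hdec⟩
  have c1 := hψ.card_le
  have c2 := hD.card_le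
  -- Preparing the other copies costs a multiple of `m * K`. The input size of the distinguisher
  -- bounds `m` by `N`, which makes the total quadratic.
  have c3 : m * (6 * K) ≤ N * (6 * K) := Nat.mul_le_mul_right _ (by
    simp only [Fintype.card_sum, Fintype.card_fin, Fintype.card_unit] at c2
    omega)
  simp only [Fintype.card_sum, Fintype.card_fin, Fintype.card_unit, Fintype.card_prod] at c1 c2 ⊢
  generalize (m + 1) * (r + 1) = X at c2 ⊢
  have c4 : 300 * (1 + N + K) ^ 2 = 300 + 300 * (N * N) + 300 * (K * K) + 600 * N + 600 * K +
      600 * (N * K) := by ring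
  have c5 : N * (6 * K) = 6 * (N * K) := by ring
  rw [c5] at c3
  rw [c4]
  norm_cast
  omega

end Reduction

/-! ### Decoders of every ensemble -/

section Constant

variable {r h : ℕ}

theorem classical_zero_diag {κ : Type} [Fintype κ] [DecidableEq κ] (ρ : Op κ) (g : Bits Unit) :
    classical (0 : Bits κ → Bits Unit) ρ g g = if 0 = g then ρ.trace else 0 := by
  rw [classical_apply, if_pos rfl]
  simp only [Pi.zero_apply]
  split_ifs
  · rfl
  · exact Finset.sum_const_zero

/-- Two fallbacks for every state. Always accepting and outputting half of a fresh EPR pair gives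
fidelity `1 / 4`, hence `(1, 0)`; always rejecting gives `(0, 1)`, since the accepted state may then
be chosen freely. -/
theorem exists_constant_decoder {K : ℕ} {ψ : PureState r h} (hψ : GenState K ψ.density)
    (b : Bool) : ∃ A : Channel (Fin r) RegFD,
      complexity A ≤ (300 * (1 + K) ^ 2 : ℕ) ∧
        IsDecoder (if b then 1 else 0) (if b then 0 else 1) A ψ := by
  have hM : Impl _ (classical (0 : Bits (RegRB r) → Bits Unit)) :=
    impl_classical (c := 0) (by rw [xorPerm_zero, basisPerm_one]; exact GateProd.one _)
  have ht := gateProd_ctrlPauli (Function.Embedding.refl Unit) (by simp) fun _ => (0, 0)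
  have hprob : ∀ y, goodProb ψ (classical (0 : Bits (RegRB r) → Bits Unit))
      (fun _ v => v = 0 ∧ b = true) y = if b then 1 else 0 := by
    intro y
    simp only [goodProb, classical_zero_diag, (isDensity_maskedState ψ _ _).2]
    cases b with
    | true =>
      rw [Finset.sum_eq_single 0]
      · rw [if_pos (flag_of_forall fun j => ⟨rfl, rfl⟩)]
        simp
      · intro g _ hg
        simp [hg.symm]
      · simp
    | false =>
      refine Finset.sum_eq_zero fun g _ => if_neg fun hg => ?_
      have := flag_eq_zero_iff.1 hg ()
      simp at this
  have hcard : (Fintype.card (ZMod 2 × ZMod 2) : ℝ) = 4 := by simp [ZMod.card]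
  obtain ⟨A, hA, hdec⟩ := exists_decoder_of_goodProb ψ hM ht (fun _ v => v = 0 ∧ b = true)
    (γ := if b then 1 else 0) (ε := if b then 0 else 1) (by cases b <;> simp)
    (by cases b <;> simp)
    (by
      simp only [hprob, Finset.sum_const, Finset.card_univ, nsmul_eq_mul, hcard]
      exact le_rfl)
    (by
      simp only [hprob, Finset.sum_const, Finset.card_univ, nsmul_eq_mul, hcard]
      cases b <;> norm_num)
  refine ⟨A, hA.trans ?_, hdec⟩
  have c1 := hψ.card_le
  have c2 : 300 * (1 + K) ^ 2 = 300 + 600 * K + 300 * (K * K) := by ring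
  rw [c2]
  simp only [Fintype.card_sum, Fintype.card_fin, Fintype.card_unit] at c1 ⊢
  norm_cast
  omega

/-- The budget `θ` is split evenly: `q ^ n = θ / 2` and `n * β = θ / 2`. Then `1 - q ≤ log (2 / θ) /
n` because `1 - exp (-u) ≤ u`. -/
theorem exists_decoder_of_le_sq {n N K : ℕ} (hn : 0 < n) {ψ : PureState r h}
    {D : Channel (RegOut r n) Unit} (hD : Impl N D.map) (hψ : GenState K ψ.density) {θ : ℝ}
    (hθ0 : 0 < θ) (hθ1 : θ ≤ 1)
    (hθ : θ ≤ advantage D (amplified ψ n 0) (amplified ψ n 1) ^ 2) :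
    ∃ (A : Channel (Fin r) RegFD) (γ ε : ℝ), complexity A ≤ (300 * (1 + N + K) ^ 2 : ℕ) ∧
      IsDecoder γ ε A ψ ∧ θ / (2 * n) ≤ γ ∧ 1 - ε ≤ 4 / 3 * (Real.log (2 / θ) / n) := by
  have hn' : (0 : ℝ) < n := Nat.cast_pos.2 hn
  have hn1 : (1 : ℝ) ≤ n := Nat.one_le_cast.2 hn
  set q := Real.exp (-(Real.log (2 / θ) / n)) with hq
  have hlog : 0 ≤ Real.log (2 / θ) := Real.log_nonneg (by rw [le_div_iff₀ hθ0]; linarith)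
  have hq0 : 0 ≤ q := (Real.exp_pos _).le
  have hq1 : q ≤ 1 := Real.exp_le_one_iff.2 (neg_nonpos.2 (by positivity))
  have hqn : q ^ n = θ / 2 := by
    rw [hq, ← Real.exp_nat_mul, mul_neg, mul_div_cancel₀ _ hn'.ne', Real.exp_neg,
      Real.exp_log (by positivity), inv_div]
  have hq2 : 1 - q ≤ Real.log (2 / θ) / n := by
    have := Real.add_one_le_exp (-(Real.log (2 / θ) / n))
    linarith
  have hβ : θ / (2 * n) ≤ 1 := by
    rw [div_le_one (by positivity)]
    linarith
  by_cases h4 : 1 / 4 ≤ q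
  · obtain ⟨A, hA, hdec⟩ := exists_decoder hn hD hψ (q := q) (β := θ / (2 * n))
      -- The solution of `1 / 4 + 3 / 4 * ε = q`; it is nonnegative only for `q ≥ 1 / 4`.
      (ε := (4 * q - 1) / 3) hq0 hq1 ⟨by positivity, hβ⟩ ⟨by linarith, by linarith⟩
      (by
        rw [hqn]
        refine le_trans (le_of_eq ?_) hθ
        field_simp
        ring) (by linarith)
    exact ⟨A, _, _, hA, hdec, le_rfl, by linarith⟩
  -- If `q < 1 / 4`, then `log (2 / θ) / n > 3 / 4`, so the claimed bound on `1 - ε` exceeds one and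
  -- `ε = 0` suffices.
  · obtain ⟨A, hA, hdec⟩ := exists_constant_decoder hψ true
    refine ⟨A, 1, 0, hA.trans ?_, hdec, hβ, by linarith⟩
    exact_mod_cast Nat.mul_le_mul_left _ (Nat.pow_le_pow_left (by omega) 2)

end Constant

/-! ### Negligible functions and polynomial bounds -/

section Asymptotic

/-- Failure of negligibility gives an inverse polynomial bound only for infinitely many parameters.
The constant is capped at `1` so that its logarithm has a known sign. -/
theorem frequently_of_not_negligible {f : ℕ → ℝ} (hf : ¬ Negligible f) :
    ∃ (k : ℕ) (c : ℝ), 0 < c ∧ c ≤ 1 ∧ ∃ᶠ s : ℕ in atTop, c ≤ (s : ℝ) ^ k * |f s| := by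
  rw [Negligible, SuperpolynomialDecay] at hf
  push Not at hf
  obtain ⟨k, hk⟩ := hf
  rw [Metric.tendsto_nhds] at hk
  push Not at hk
  obtain ⟨c, hc, hfr⟩ := hk
  refine ⟨k, min c 1, lt_min hc one_pos, min_le_right _ _, hfr.mono fun s hs => ?_⟩
  rw [Real.dist_eq, sub_zero, abs_mul, abs_of_nonneg (by positivity)] at hs
  exact (min_le_left _ _).trans hs

theorem not_negligible_of_frequently {f : ℕ → ℝ} (k : ℕ) {c : ℝ} (hc : 0 < c)
    (h : ∃ᶠ s : ℕ in atTop, c ≤ (s : ℝ) ^ k * |f s|) : ¬ Negligible f := by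
  intro hf
  have h1 := Metric.tendsto_nhds.1 (hf k) c hc
  refine h ?_
  filter_upwards [h1] with s hs
  rw [Real.dist_eq, sub_zero, abs_mul, abs_of_nonneg (by positivity)] at hs
  exact not_le.2 hs

theorem exists_eval_le (p : Polynomial ℕ) :
    ∃ m C : ℕ, 0 < C ∧ ∀ s : ℕ, 0 < s → p.eval s ≤ C * s ^ m := by
  refine ⟨p.natDegree, p.eval 1 + 1, Nat.succ_pos _, fun s hs => ?_⟩
  refine le_trans ?_ (Nat.mul_le_mul_right _ (Nat.le_succ _))
  rw [Polynomial.eval_eq_sum_range, Polynomial.eval_eq_sum_range, Finset.sum_mul]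
  refine Finset.sum_le_sum fun i hi => ?_
  rw [one_pow, mul_one]
  exact Nat.mul_le_mul_left _ (Nat.pow_le_pow_right hs (by
    rw [Finset.mem_range] at hi; omega))

theorem PolyBounded.exists_nat {f : ℕ → ℕ∞} (hf : PolyBounded f) :
    ∃ (N : ℕ → ℕ) (p : Polynomial ℕ), (∀ s, f s = N s) ∧ ∀ s, N s ≤ p.eval s := by
  obtain ⟨p, hp⟩ := hf
  have h1 : ∀ s, f s ≠ ⊤ := fun s h => by
    have := hp s
    rw [h, top_le_iff] at this
    exact ENat.natCast_ne_top _ this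
  refine ⟨fun s => (f s).toNat, p, fun s => (ENat.natCast_toNat (h1 s)).symm, fun s => ?_⟩
  have := hp s
  rw [← ENat.natCast_toNat (h1 s)] at this
  exact_mod_cast this

/-- The advantage is large only infinitely often, while `1 - ε` must be small at all large
parameters. Where the advantage is large the reduction is used; elsewhere the rejecting decoder has
`ε = 1` at no cost to the frequent lower bound on `γ`. -/
theorem exists_decoder_ensemble (Ψ : StateEnsemble) (n : ℕ → ℕ) (hn : ∀ᶠ s in atTop, 0 < n s)
    (hΨ : EfficientlyGeneratable fun s => (Ψ.state s).density)
    (D : ∀ s, Channel (RegOut (Ψ.r s) (n s)) Unit) (hD : Efficient D)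
    (hadv : ¬ Negligible fun s => advantage (D s)
      (amplified (Ψ.state s) (n s) 0) (amplified (Ψ.state s) (n s) 1)) :
    ∃ (A : ∀ s, Channel (Fin (Ψ.r s)) RegFD) (γ ε : ℕ → ℝ),
      (∀ s, IsDecoder (γ s) (ε s) (A s) (Ψ.state s)) ∧ Efficient A ∧
      (∀ s, complexity (A s) ≤
        (300 : ℕ) * (1 + complexity (D s) + genComplexity (Ψ.state s).density) ^ 2) ∧
      ¬ Negligible γ ∧ (fun s => 1 - ε s) =O[atTop] fun s => Real.log s / n s := by
  obtain ⟨N, pN, hN, hpN⟩ := PolyBounded.exists_nat hD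
  obtain ⟨K, pK, hK, hpK⟩ := PolyBounded.exists_nat hΨ
  have hDI : ∀ s, Impl (N s) (D s).map := fun s => impl_of_complexity_le (hN s).le
  have hΨI : ∀ s, GenState (K s) (Ψ.state s).density := fun s =>
    genState_of_genComplexity_le (hK s).le
  obtain ⟨k, c, hc0, hc1, hfr⟩ := frequently_of_not_negligible hadv
  let P : ℕ → Prop := fun s => 0 < n s ∧ 2 ≤ s ∧ c ≤ (s : ℝ) ^ k * |advantage (D s)
    (amplified (Ψ.state s) (n s) 0) (amplified (Ψ.state s) (n s) 1)|
  let θ : ℕ → ℝ := fun s => (c / (s : ℝ) ^ k) ^ 2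
  have hex : ∀ s, ∃ (A : Channel (Fin (Ψ.r s)) RegFD) (γ ε : ℝ),
      complexity A ≤ (300 * (1 + N s + K s) ^ 2 : ℕ) ∧ IsDecoder γ ε A (Ψ.state s) ∧
      (P s → θ s / (2 * n s) ≤ γ ∧ 1 - ε ≤ 4 / 3 * (Real.log (2 / θ s) / n s)) ∧
      (¬ P s → 1 - ε = 0) := by
    intro s
    by_cases hP : P s
    · have hs1 : (1 : ℝ) ≤ (s : ℝ) ^ k := one_le_pow₀ (by exact_mod_cast hP.2.1.trans' one_le_two)
      have hs0 : (0 : ℝ) < (s : ℝ) ^ k := lt_of_lt_of_le one_pos hs1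
      obtain ⟨A, γ, ε, h1, h2, h3⟩ := exists_decoder_of_le_sq hP.1 (hDI s) (hΨI s) (θ := θ s)
        (by positivity) (pow_le_one₀ (by positivity) ((div_le_one hs0).2 (hc1.trans hs1)))
        (by
          rw [← sq_abs (advantage _ _ _)]
          refine pow_le_pow_left₀ (by positivity) ?_ 2
          rw [div_le_iff₀' hs0]
          exact hP.2.2)
      exact ⟨A, γ, ε, h1, h2, fun _ => h3, fun h => absurd hP h⟩
    -- Here `1 - ε = 0`, so the bound on `1 - ε` holds without information on the advantage.
    · obtain ⟨A, hA, hdec⟩ := exists_constant_decoder (hΨI s) false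
      refine ⟨A, 0, 1, hA.trans ?_, hdec, fun h => absurd h hP, fun _ => sub_self 1⟩
      exact_mod_cast Nat.mul_le_mul_left _ (Nat.pow_le_pow_left (by omega) 2)
  choose A γ ε hA hdec hP hP' using hex
  refine ⟨A, γ, ε, hdec, ?_, ?_, ?_, ?_⟩
  · refine ⟨300 * (1 + pN + pK) ^ 2, fun s => (hA s).trans ?_⟩
    have h1 : (300 * (1 + pN + pK) ^ 2).eval s = 300 * (1 + pN.eval s + pK.eval s) ^ 2 := by
      simp
    rw [h1]
    have := hpN s
    have := hpK s
    exact_mod_cast Nat.mul_le_mul_left _ (Nat.pow_le_pow_left (by omega) 2)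
  · intro s
    refine (hA s).trans (le_of_eq ?_)
    rw [hN, show genComplexity (Ψ.state s).density = K s from hK s]
    push_cast
    rfl
  · obtain ⟨m, C, hC, hm⟩ := exists_eval_le (pN + 1)
    -- From `γ ≥ θ / (2 * n)` with `θ = (c / s ^ k) ^ 2` and `n ≤ C * s ^ m`, the latter obtained
    -- from the size of the distinguisher.
    refine not_negligible_of_frequently (2 * k + m) (c := c ^ 2 / (2 * C)) (by positivity) ?_
    refine (hfr.and_eventually (hn.and (eventually_ge_atTop 2))).mono fun s hs => ?_
    have hs0 : (0 : ℝ) < s := by exact_mod_cast (show 0 < s by omega)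
    have h1 := (hP s ⟨hs.2.1, hs.2.2, hs.1⟩).1
    have h2 : n s ≤ C * s ^ m := by
      have h3 := (hDI s).card_le
      simp only [Fintype.card_sum, Fintype.card_fin, Fintype.card_unit, Fintype.card_prod] at h3
      have h4 := hm s (by omega)
      have h5 := hpN s
      simp only [Polynomial.eval_add, Polynomial.eval_one] at h4
      refine le_trans ?_ h4
      omega
    have h2' : (n s : ℝ) ≤ C * (s : ℝ) ^ m := by exact_mod_cast h2
    have hn0 : (0 : ℝ) < n s := by exact_mod_cast hs.2.1
    have h6 : 0 ≤ γ s := (hdec s).1.1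
    rw [abs_of_nonneg h6]
    have hC' : (0 : ℝ) < C := by exact_mod_cast hC
    calc c ^ 2 / (2 * C) = (s : ℝ) ^ (2 * k + m) * (θ s / (2 * (C * (s : ℝ) ^ m))) := by
          simp only [θ]
          field_simp
          ring
      _ ≤ (s : ℝ) ^ (2 * k + m) * (θ s / (2 * n s)) := by gcongr
      _ ≤ _ := by gcongr
  · have hl2 : 0 < Real.log 2 := Real.log_pos one_lt_two
    have hlc : 0 ≤ -Real.log c := neg_nonneg.2 (Real.log_nonpos hc0.le hc1)
    -- The logarithm of `2 / θ` is `log 2 + 2 * k * log s - 2 * log c`; for `s ≥ 2` each constant is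
    -- absorbed into a multiple of `log s`.
    refine IsBigO.of_bound (4 / 3 * (1 + 2 * k + 2 * (-Real.log c / Real.log 2))) ?_
    filter_upwards [eventually_ge_atTop 2] with s hs
    have hs0 : (0 : ℝ) < s := by exact_mod_cast (show 0 < s by omega)
    have hls : Real.log 2 ≤ Real.log s := Real.log_le_log two_pos (by exact_mod_cast hs)
    have hls0 : 0 ≤ Real.log s := hl2.le.trans hls
    rw [Real.norm_of_nonneg (sub_nonneg.2 (hdec s).2.1.2), Real.norm_of_nonneg (by positivity)]
    by_cases hPs : P s
    · refine ((hP s hPs).2).trans ?_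
      have hn0 : (0 : ℝ) < n s := by exact_mod_cast hPs.1
      rw [mul_assoc]
      refine mul_le_mul_of_nonneg_left ?_ (by norm_num)
      rw [← mul_div_assoc]
      refine div_le_div_of_nonneg_right ?_ hn0.le
      have h1 : Real.log (2 / θ s) = Real.log 2 + 2 * (k * Real.log s) + 2 * (-Real.log c) := by
        simp only [θ]
        rw [Real.log_div two_ne_zero (by positivity), Real.log_pow,
          Real.log_div hc0.ne' (by positivity), Real.log_pow]
        push_cast
        ring
      have h2 : -Real.log c ≤ -Real.log c / Real.log 2 * Real.log s := by
        rw [div_mul_eq_mul_div, le_div_iff₀ hl2]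
        exact mul_le_mul_of_nonneg_left hls hlc
      rw [h1]
      linarith
    · rw [hP' s hPs]
      have : 0 ≤ -Real.log c / Real.log 2 := by positivity
      positivity

end Asymptotic

/-! ### Generation of the amplified state -/

section Generation

variable {r h : ℕ}

/-- The register of the four random bits of one copy. -/
abbrev RegBits : Type := (Unit ⊕ Unit) ⊕ (Unit ⊕ Unit)

/-- A uniform bit is half of an EPR pair; four of them make the random bits of one copy. -/
theorem genState_uniform : GenState 100 ((1 / 16 : ℂ) • (1 : Op RegBits)) := by
  have h1 : GenState 9 ((1 / 2 : ℂ) • (1 : Op Unit)) := by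
    have h2 := GenState.apply (Impl.traceRight (ι := Unit) (κ := Unit)) genState_eprOp
    have h3 : traceRight eprOp = (1 / 2 : ℂ) • (1 : Op Unit) := by
      ext u v
      simp only [traceRight, Matrix.of_apply, eprOp_apply, Matrix.smul_apply, Matrix.one_apply,
        smul_eq_mul, mul_ite, mul_one, mul_zero]
      by_cases huv : u = v
      · subst huv
        simp
      · rw [if_neg huv]
        refine Finset.sum_eq_zero fun w _ => if_neg ?_
        rintro ⟨rfl, h⟩
        exact huv h.symm
    rw [h3] at h2
    exact h2.mono (by simp)
  have h2 : ∀ {ι : Type} [Fintype ι] [DecidableEq ι] (c : ℂ),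
      tensor (c • (1 : Op ι)) (c • (1 : Op ι)) = (c * c) • (1 : Op (ι ⊕ ι)) := by
    intro ι _ _ c
    rw [← tensor_one_one]
    ext u v
    simp only [tensor_apply, Matrix.smul_apply, smul_eq_mul]
    ring
  have h3 := (h1.tensor h1).tensor (h1.tensor h1)
  rw [h2, h2, show (1 / 2 * (1 / 2) * (1 / 2 * (1 / 2)) : ℂ) = 1 / 16 by norm_num] at h3
  exact h3.mono (by simp)

/-- One copy of the registers `R` and `B` together with its random bits `x`, `z`, `a`, `a'`. -/
noncomputable def siteState (ψ : PureState r h) : Op (RegRB r ⊕ RegBits) :=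
  Matrix.of fun u v => if u ∘ Sum.inr = v ∘ Sum.inr then
    1 / 16 * maskedState ψ (u (Sum.inr (Sum.inl (Sum.inl ()))))
      (u (Sum.inr (Sum.inl (Sum.inr ())))) (u ∘ Sum.inl) (v ∘ Sum.inl) else 0

theorem siteState_elim (ψ : PureState r h) (p p' : Bits (RegRB r)) (w w' : Bits RegBits) :
    siteState ψ (Sum.elim p w) (Sum.elim p' w') = if w = w' then
      1 / 16 * maskedState ψ (w (Sum.inl (Sum.inl ()))) (w (Sum.inl (Sum.inr ()))) p p' else 0 :=
  rfl

/-- The qubits that hold the masks of one copy. -/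
def maskQubits (r : ℕ) : Bool ↪ RegBits ⊕ Fin r where
  toFun b := Sum.inl (Sum.inl (if b then Sum.inr () else Sum.inl ()))
  inj' := by
    intro b b' hb
    cases b <;> cases b' <;> simp_all

/-- The mask of one copy, as a function of its random bits. -/
def siteMask (r : ℕ) (g : Bits (RegBits ⊕ Fin r)) : ZMod 2 × ZMod 2 :=
  (fun u : Bits Bool => (u false, u true)) (g ∘ maskQubits r)

/-- The order of registers in which the random bits are the last ones. -/
def siteOrder (r : ℕ) : (RegBits ⊕ Fin r) ⊕ Unit ≃ RegRB r ⊕ RegBits :=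
  (Equiv.sumAssoc RegBits (Fin r) Unit).trans (Equiv.sumComm _ _)

/-- Random masking is a Pauli controlled by uniformly random bits that are kept alongside the copy.
-/
theorem siteState_eq (ψ : PureState r h) :
    siteState ψ = relabel (siteOrder r) (ctrlPauli (siteMask r) * relabel
      (Equiv.sumAssoc RegBits (Fin r) Unit).symm
      (tensor ((1 / 16 : ℂ) • (1 : Op RegBits)) (reduced ψ)) * (ctrlPauli (siteMask r))ᴴ) := by
  ext u v
  rw [← Sum.elim_comp_inl_inr u, ← Sum.elim_comp_inl_inr v]
  generalize u ∘ Sum.inr = w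
  generalize v ∘ Sum.inr = w'
  rw [← Sum.elim_comp_inl_inr (u ∘ Sum.inl), ← Sum.elim_comp_inl_inr (v ∘ Sum.inl)]
  generalize (u ∘ Sum.inl) ∘ Sum.inl = q
  generalize (v ∘ Sum.inl) ∘ Sum.inl = q'
  generalize (u ∘ Sum.inl) ∘ Sum.inr = c
  generalize (v ∘ Sum.inl) ∘ Sum.inr = c'
  have h3 : ∀ (q : Bits (Fin r)) (c : Bits Unit) (w : Bits RegBits),
      (Sum.elim (Sum.elim q c) w : Bits (RegRB r ⊕ RegBits)) ∘ siteOrder r =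
        Sum.elim (Sum.elim w q) c := by
    intro q c w
    ext ((i | i) | i) <;> rfl
  have h4 : ∀ (q : Bits (Fin r)) (c : Bits Unit) (w : Bits RegBits),
      (Sum.elim (Sum.elim w q) c : Bits ((RegBits ⊕ Fin r) ⊕ Unit)) ∘
        (Equiv.sumAssoc RegBits (Fin r) Unit).symm = Sum.elim w (Sum.elim q c) := by
    intro q c w
    ext (i | (i | i)) <;> rfl
  rw [relabel_apply, h3, h3, ctrlPauli_conj_apply, siteState_elim,
    maskedState_elim ψ (w (Sum.inl (Sum.inl ())), w (Sum.inl (Sum.inr ())))]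
  simp only [Matrix.mul_apply, Matrix.of_apply, relabel_apply, tensor_elim, Matrix.smul_apply,
    Matrix.conjTranspose_apply, h4]
  have h5 : ∀ w, siteMask r (Sum.elim w q) = (w (Sum.inl (Sum.inl ())), w (Sum.inl (Sum.inr ()))) :=
    fun w => rfl
  have h6 : ∀ w, siteMask r (Sum.elim w q') = (w (Sum.inl (Sum.inl ())), w (Sum.inl (Sum.inr ()))) :=
    fun w => rfl
  rw [h5, h6]
  by_cases hw : w = w'
  · subst hw
    rw [if_pos rfl, Matrix.one_apply_eq, Finset.sum_comm, Finset.mul_sum]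
    refine Finset.sum_congr rfl fun b' _ => ?_
    rw [Finset.sum_mul, Finset.mul_sum]
    refine Finset.sum_congr rfl fun b _ => ?_
    simp only [reducedBlock, Matrix.of_apply, smul_eq_mul]
    ring
  · rw [if_neg hw, Matrix.one_apply_ne hw]
    simp

theorem genState_siteState {K : ℕ} {ψ : PureState r h} (hψ : GenState K ψ.density) :
    GenState (6 * K + 200) (siteState ψ) := by
  have ht : GateProd 1 (ctrlPauli (siteMask r)) := gateProd_ctrlPauli (maskQubits r) (by simp)
    fun u : Bits Bool => (u false, u true)
  have h1 := GenState.apply ((Impl.conj ht).relabel_comp (siteOrder r))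
    ((genState_uniform.tensor (genState_reduced hψ)).relabel
      (Equiv.sumAssoc RegBits (Fin r) Unit).symm)
  have h7 := hψ.card_le
  rw [siteState_eq]
  refine GenState.mono h1 ?_
  simp only [Fintype.card_sum, Fintype.card_fin, Fintype.card_unit] at h7 ⊢
  omega

/-- The register of all random bits, in the order `x`, `z`, `a`, `a'`. -/
abbrev RegAllBits (n : ℕ) : Type := (Fin n ⊕ Fin n) ⊕ (Fin n ⊕ Fin n)

/-- The classical output of the construction, as a function of all random bits. -/
def publicBits (n : ℕ) (b : ZMod 2) (u : Bits (RegAllBits n)) :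
    Bits ((Fin n ⊕ Fin n) ⊕ Unit) :=
  Sum.elim (u ∘ Sum.inr) fun _ =>
    (u ∘ Sum.inr ∘ Sum.inl) ⬝ᵥ (u ∘ Sum.inl ∘ Sum.inl) +
      (u ∘ Sum.inr ∘ Sum.inr) ⬝ᵥ (u ∘ Sum.inl ∘ Sum.inr) + b

/-- The gates are `2 * n` copies for `a` and `a'`, `2 * n` products for the two inner products, and
one for the constant `b`. -/
theorem gateProd_publicBits (n : ℕ) (b : ZMod 2) :
    GateProd (4 * n + 1) (basisPerm (xorPerm (publicBits n b))) := by
  have hcopy : ∀ (j : RegAllBits n) (k : (Fin n ⊕ Fin n) ⊕ Unit),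
      GateProd 1 (basisPerm (xorPerm fun g : Bits (RegAllBits n) => Pi.single k (g j))) :=
    fun j k => gateProd_xorPerm_single ⟨fun _ : Unit => j, fun _ _ _ => rfl⟩ (by simp)
      (fun u => u ()) k
  have hand : ∀ (j j' : RegAllBits n) (k : (Fin n ⊕ Fin n) ⊕ Unit), j ≠ j' →
      GateProd 1 (basisPerm (xorPerm fun g : Bits (RegAllBits n) => Pi.single k (g j * g j'))) :=
    fun j j' k hj => gateProd_xorPerm_single ⟨fun b : Bool => if b then j else j', by
      intro b b' hb
      cases b <;> cases b' <;> simp_all [eq_comm]⟩ (by simp) (fun u => u true * u false) k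
  have hconst : GateProd 1 (basisPerm (xorPerm fun _ : Bits (RegAllBits n) =>
      (Pi.single (Sum.inr ()) b : Bits ((Fin n ⊕ Fin n) ⊕ Unit)))) :=
    gateProd_xorPerm_single (Function.Embedding.ofIsEmpty : Fin 0 ↪ RegAllBits n) (by simp)
      (fun _ => b) _
  have h1 := gateProd_xorPerm_sum Finset.univ
    (fun (j : Fin n ⊕ Fin n) (g : Bits (RegAllBits n)) => Pi.single (Sum.inl j) (g (Sum.inr j)))
    fun j _ => hcopy _ _
  have h2 := gateProd_xorPerm_sum Finset.univ
    (fun (j : Fin n ⊕ Fin n) (g : Bits (RegAllBits n)) =>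
      (Pi.single (Sum.inr ()) (g (Sum.inr j) * g (Sum.inl j)) : Bits ((Fin n ⊕ Fin n) ⊕ Unit)))
    fun j _ => hand _ _ _ (by simp)
  have h3 := (h1.mul h2).mul hconst
  rw [basisPerm_mul, basisPerm_mul, ← xorPerm_add, ← xorPerm_add] at h3
  refine GateProd.mono (M := basisPerm (xorPerm (publicBits n b))) ?_
    (by simp; omega : (Finset.univ (α := Fin n ⊕ Fin n)).card +
      (Finset.univ (α := Fin n ⊕ Fin n)).card + 1 ≤ 4 * n + 1)
  convert h3 using 3
  ext u k
  simp only [Pi.add_apply, Finset.sum_apply]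
  rcases k with j | k
  · simp [publicBits, Pi.single_apply]
  · simp [publicBits, dotProduct]

/-- Separation of all random bits from the copies of the registers `R` and `B`. -/
def separateBits (r n : ℕ) :
    Fin n × (RegRB r ⊕ RegBits) ≃ RegAllBits n ⊕ (Fin n × RegRB r) where
  toFun a := match a with
    | (i, Sum.inl q) => Sum.inr (i, q)
    | (i, Sum.inr (Sum.inl (Sum.inl _))) => Sum.inl (Sum.inl (Sum.inl i))
    | (i, Sum.inr (Sum.inl (Sum.inr _))) => Sum.inl (Sum.inl (Sum.inr i))
    | (i, Sum.inr (Sum.inr (Sum.inl _))) => Sum.inl (Sum.inr (Sum.inl i))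
    | (i, Sum.inr (Sum.inr (Sum.inr _))) => Sum.inl (Sum.inr (Sum.inr i))
  invFun a := match a with
    | Sum.inr (i, q) => (i, Sum.inl q)
    | Sum.inl (Sum.inl (Sum.inl i)) => (i, Sum.inr (Sum.inl (Sum.inl ())))
    | Sum.inl (Sum.inl (Sum.inr i)) => (i, Sum.inr (Sum.inl (Sum.inr ())))
    | Sum.inl (Sum.inr (Sum.inl i)) => (i, Sum.inr (Sum.inr (Sum.inl ())))
    | Sum.inl (Sum.inr (Sum.inr i)) => (i, Sum.inr (Sum.inr (Sum.inr ())))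
  left_inv := by rintro ⟨i, q | ((_ | _) | (_ | _))⟩ <;> rfl
  right_inv := by rintro (((i | i) | (i | i)) | ⟨i, q⟩) <;> rfl

/-- The construction is local except for its classical output: independent copies with their own
random bits, followed by one classical function of all bits. Discarding the input of this function
erases the masks. -/
theorem amplified_eq_classical (ψ : PureState r h) (n : ℕ) (b : ZMod 2) :
    amplified ψ n b = relabel (Equiv.sumComm _ _) (ampl (classical (publicBits n b))
      (relabel (separateBits r n) (tensorFamily fun _ => siteState ψ))) := by
  ext u v
  rw [← Sum.elim_comp_inl_inr u, ← Sum.elim_comp_inl_inr v]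
  generalize u ∘ Sum.inl = p
  generalize v ∘ Sum.inl = p'
  generalize u ∘ Sum.inr = o
  generalize v ∘ Sum.inr = o'
  have h1 : ∀ (p : Bits (Fin n × RegRB r)) (o : Bits ((Fin n ⊕ Fin n) ⊕ Unit)),
      (Sum.elim p o : Bits (RegOut r n)) ∘ Equiv.sumComm ((Fin n ⊕ Fin n) ⊕ Unit)
        (Fin n × RegRB r) = Sum.elim o p := by
    intro p o
    ext (i | i) <;> rfl
  rw [relabel_apply, h1, h1, ampl_apply, classical_apply]
  simp only [amplified, Matrix.smul_apply, Matrix.sum_apply, tensor_elim, basisProj_apply,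
    Matrix.of_apply, smul_eq_mul, relabel_apply]
  have h2 : ∀ g : Bits (RegAllBits n),
      tensorFamily (fun _ => siteState ψ) (Sum.elim g p ∘ separateBits r n)
        (Sum.elim g p' ∘ separateBits r n) =
      ((2 : ℂ) ^ (4 * n))⁻¹ * tensorFamily (fun i => maskedState ψ
        (g (Sum.inl (Sum.inl i))) (g (Sum.inl (Sum.inr i)))) p p' := by
    intro g
    simp only [tensorFamily, Matrix.of_apply]
    have h3 : ∀ i : Fin n, siteState ψ
        (fun q => (Sum.elim g p ∘ separateBits r n) (i, q))
        (fun q => (Sum.elim g p' ∘ separateBits r n) (i, q)) =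
        1 / 16 * maskedState ψ (g (Sum.inl (Sum.inl i))) (g (Sum.inl (Sum.inr i)))
          (fun q => p (i, q)) (fun q => p' (i, q)) := by
      intro i
      exact if_pos (by ext ((_ | _) | (_ | _)) <;> rfl)
    simp only [h3, Finset.prod_mul_distrib, Finset.prod_const, Finset.card_univ, Fintype.card_fin]
    rw [pow_mul, one_div, inv_pow]
    norm_num
  simp only [h2, sum_bits_sum (ι := Fin n ⊕ Fin n), sum_bits_sum (ι := Fin n) (κ := Fin n),
    Finset.mul_sum]
  by_cases ho : o = o'
  · subst ho
    rw [if_pos rfl]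
    refine Finset.sum_congr rfl fun x _ => Finset.sum_congr rfl fun z _ =>
      Finset.sum_congr rfl fun a _ => Finset.sum_congr rfl fun a' _ => ?_
    rw [mul_ite, mul_ite, mul_one, mul_zero, mul_zero]
    refine if_congr ?_ rfl rfl
    rw [and_self]
    rfl
  · rw [if_neg ho]
    refine Finset.sum_eq_zero fun x _ => Finset.sum_eq_zero fun z _ =>
      Finset.sum_eq_zero fun a _ => Finset.sum_eq_zero fun a' _ => ?_
    rw [if_neg, mul_zero, mul_zero]
    rintro ⟨h3, h4⟩
    exact ho (h3.symm.trans h4)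

theorem genState_amplified {K : ℕ} {ψ : PureState r h} (hψ : GenState K ψ.density) (n : ℕ)
    (b : ZMod 2) : GenState (1000 * ((1 + n) * (1 + K))) (amplified ψ n b) := by
  rw [amplified_eq_classical]
  have h1 := (GenState.apply ((impl_classical (gateProd_publicBits n b)).ampl
    (μ := Fin n × RegRB r))
    ((GenState.tensorFamily fun _ : Fin n => genState_siteState hψ).relabel
      (separateBits r n))).relabel (Equiv.sumComm _ _)
  have h2 := hψ.card_le
  refine GenState.mono h1 ?_
  simp only [Fintype.card_sum, Fintype.card_fin, Fintype.card_unit, Fintype.card_prod] at h2 ⊢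
  have h3 : n * (r + 1) ≤ n * K := Nat.mul_le_mul_left _ (by omega)
  have h4 : n * (6 * K + 200 + (r + 1 + (1 + 1 + (1 + 1)))) ≤ n * (7 * K + 204) :=
    Nat.mul_le_mul_left _ (by omega)
  have h5 : n * (7 * K + 204) = 7 * (n * K) + 204 * n := by ring
  have h6 : (1 + n) * (1 + K) = 1 + n + K + n * K := by ring
  rw [h6]
  omega

theorem efficientlyGeneratable_amplified (Ψ : StateEnsemble) (n : ℕ → ℕ)
    (hn : PolyBounded fun s => (n s : ℕ∞))
    (hΨ : EfficientlyGeneratable fun s => (Ψ.state s).density) (b : ZMod 2) :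
    EfficientlyGeneratable fun s => amplified (Ψ.state s) (n s) b := by
  obtain ⟨K, pK, hK, hpK⟩ := PolyBounded.exists_nat hΨ
  obtain ⟨p, hp⟩ := hn
  refine ⟨1000 * ((1 + p) * (1 + pK)), fun s => ?_⟩
  refine (genState_amplified (genState_of_genComplexity_le (hK s).le) (n s) b).genComplexity_le.trans
    ?_
  have h1 : n s ≤ p.eval s := ENat.natCast_le_natCast.1 (hp s)
  have h2 := hpK s
  have h3 : (1000 * ((1 + p) * (1 + pK))).eval s =
      1000 * ((1 + p.eval s) * (1 + pK.eval s)) := by simp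
  rw [h3]
  exact_mod_cast Nat.mul_le_mul_left _ (Nat.mul_le_mul (by omega) (by omega))

end Generation

/-! ### Effects and binary measurements -/

section Effects

variable {ι κ μ : Type} [Fintype ι] [DecidableEq ι] [Fintype κ] [DecidableEq κ]
  [Fintype μ] [DecidableEq μ]

theorem posSemidef_of_dotProduct_nonneg {N : Op ι} (h : ∀ x, 0 ≤ star x ⬝ᵥ (N *ᵥ x)) :
    N.PosSemidef := by
  rw [← Matrix.isPositive_toEuclideanLin_iff, LinearMap.isPositive_iff_complex]
  intro x
  have h1 : inner ℂ (Matrix.toEuclideanLin N x) x = star (star x.ofLp ⬝ᵥ (N *ᵥ x.ofLp)) := by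
    rw [EuclideanSpace.inner_eq_star_dotProduct, Matrix.star_dotProduct, star_star,
      dotProduct_comm]
    simp [Matrix.toLpLin_apply, dotProduct_comm]
  rw [h1]
  have h2 := star_nonneg_iff.2 (h x.ofLp)
  obtain ⟨h3, h4⟩ := Complex.le_def.1 h2
  exact ⟨Complex.ext rfl h4, h3⟩

theorem trace_mul_nonneg {A B : Op ι} (hA : A.PosSemidef) (hB : B.PosSemidef) :
    0 ≤ (A * B).trace := by
  obtain ⟨m, v, rfl⟩ := Matrix.posSemidef_iff_eq_sum_vecMulVec.1 hB
  rw [Matrix.mul_sum, Matrix.trace_sum]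
  refine Finset.sum_nonneg fun i _ => ?_
  rw [Matrix.mul_vecMulVec, Matrix.trace_vecMulVec, dotProduct_comm]
  exact hA.dotProduct_mulVec_nonneg _

/-- Trace duality: the matrix of the functional is positive because its quadratic form at `x` is the
functional at the positive operator `|x⟩⟨x|`. -/
theorem exists_posSemidef_of_nonneg (L : Op ι →ₗ[ℂ] ℂ) (hL : ∀ ρ, ρ.PosSemidef → 0 ≤ L ρ) :
    ∃ N : Op ι, N.PosSemidef ∧ ∀ ρ, (N * ρ).trace = L ρ := by
  have h1 : ∀ ρ, ((Matrix.of fun p q => L (Matrix.single q p 1)) * ρ).trace = L ρ := by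
    intro ρ
    have h0 : ∀ q p c, L (Matrix.single q p c) = L (Matrix.single q p 1) * c := by
      intro q p c
      rw [mul_comm, ← smul_eq_mul, ← map_smul, Matrix.smul_single, smul_eq_mul, mul_one]
    conv_rhs => rw [Matrix.matrix_eq_sum_single ρ]
    simp only [map_sum, Matrix.trace, Matrix.diag, Matrix.mul_apply, Matrix.of_apply]
    rw [Finset.sum_comm]
    exact Finset.sum_congr rfl fun q _ => Finset.sum_congr rfl fun p _ => (h0 q p _).symm
  refine ⟨_, posSemidef_of_dotProduct_nonneg fun x => ?_, h1⟩
  have h2 := hL _ (Matrix.posSemidef_vecMulVec_self_star x)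
  rw [← h1, Matrix.mul_vecMulVec, Matrix.trace_vecMulVec, dotProduct_comm] at h2
  exact h2

/-- Each effect is a sum of rank-one operators `|v⟩⟨v|`, and the operators `|c⟩⟨v|` are Kraus
operators of the measurement. This makes an abstract binary measurement a distinguisher. -/
theorem isKraus_binary {M : Bits Unit → Op ι} (hM : ∀ c, (M c).PosSemidef) (h1 : ∑ c, M c = 1) :
    IsKraus (fun ρ : Op ι => (Matrix.of fun u v => if u = v then (M u * ρ).trace else 0 :
      Op Unit)) := by
  have h2 := fun c => Matrix.posSemidef_iff_eq_sum_vecMulVec.1 (hM c)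
  choose m v hv using h2
  let K : (Σ c, Fin (m c)) → Matrix (Bits Unit) (Bits ι) ℂ := fun a => Matrix.of fun u p =>
    if u = a.1 then star (v a.1 a.2 p) else 0
  refine ⟨Σ c, Fin (m c), inferInstance, K, fun ρ => ?_, ?_⟩
  · ext u u'
    have hK : ∀ a, (K a * ρ * (K a)ᴴ) u u' = if u = a.1 then if u' = a.1 then
        star (v a.1 a.2) ⬝ᵥ (ρ *ᵥ v a.1 a.2) else 0 else 0 := by
      intro a
      simp only [K, Matrix.mul_apply, Matrix.of_apply, Matrix.conjTranspose_apply, dotProduct,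
        Matrix.mulVec]
      split_ifs
      · simp only [Finset.sum_mul, Finset.mul_sum, star_star, Pi.star_apply]
        rw [Finset.sum_comm]
        refine Finset.sum_congr rfl fun p _ => Finset.sum_congr rfl fun q _ => ?_
        ring
      · simp
      · simp
      · simp
    simp only [Matrix.sum_apply, Fintype.sum_sigma, hK, Matrix.of_apply]
    rw [Finset.sum_eq_single u]
    · simp only [if_true, eq_comm (a := u')]
      split_ifs
      · rw [hv u, Matrix.sum_mul, Matrix.trace_sum]
        refine Finset.sum_congr rfl fun i _ => ?_
        rw [Matrix.vecMulVec_mul, Matrix.trace_vecMulVec, dotProduct_comm,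
          Matrix.dotProduct_mulVec]
      · rw [Finset.sum_const_zero]
    · intro c _ hc
      simp [hc.symm]
    · simp
  · rw [← h1, Fintype.sum_sigma]
    refine Finset.sum_congr rfl fun c _ => ?_
    rw [hv c]
    refine Finset.sum_congr rfl fun i _ => ?_
    ext p q
    simp [K, Matrix.mul_apply, Matrix.vecMulVec_apply, apply_ite star]

theorem Channel.posSemidef_tensorId (A : Channel ι κ) {ρ : Op (ι ⊕ μ)} (hρ : ρ.PosSemidef) :
    (tensorId A.map ρ).PosSemidef := by
  let e := Fintype.equivFin μ
  have h1 := posSemidef_relabel (Equiv.sumCongr (Equiv.refl κ) e.symm)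
    (A.completelyPositive _ _ (posSemidef_relabel (Equiv.sumCongr (Equiv.refl ι) e) hρ))
  convert h1 using 1
  ext u v
  have h2 : ∀ (i : Bits ι) (u : Bits (κ ⊕ μ)), (Sum.elim i
      ((u ∘ Equiv.sumCongr (Equiv.refl κ) e.symm) ∘ Sum.inr) : Bits (ι ⊕ Fin _)) ∘
        Equiv.sumCongr (Equiv.refl ι) e = Sum.elim i (u ∘ Sum.inr) := by
    intro i u
    ext (j | j) <;> simp
  simp only [relabel_apply, tensorId, Matrix.of_apply, h2]
  rfl

theorem Channel.isDensity_map (A : Channel ι κ) {ρ : Op ι} (hρ : IsDensity ρ) :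
    IsDensity (A.map ρ) := by
  refine ⟨?_, (A.trace_map ρ).trans hρ.2⟩
  have h1 := posSemidef_relabel (Equiv.sumEmpty κ Empty)
    (A.posSemidef_tensorId (posSemidef_relabel (Equiv.sumEmpty ι Empty).symm hρ.1))
  convert h1 using 1
  ext u v
  rfl

theorem advantage_le_one (D : Channel ι Unit) {ρ₀ ρ₁ : Op ι} (h₀ : IsDensity ρ₀)
    (h₁ : IsDensity ρ₁) : advantage D ρ₀ ρ₁ ≤ 1 := by
  have h2 := D.isDensity_map h₁
  have h3 : 0 ≤ (D.map ρ₀ (fun _ => 1) (fun _ => 1)).re :=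
    (Complex.le_def.1 ((D.isDensity_map h₀).1.diag_nonneg)).1
  have h4 : 0 ≤ (D.map ρ₁ (fun _ => 0) (fun _ => 0)).re :=
    (Complex.le_def.1 (h2.1.diag_nonneg)).1
  have h5 := congrArg Complex.re h2.2
  rw [Matrix.trace, sum_bits_unit] at h5
  simp only [Matrix.diag, Complex.add_re, Complex.one_re] at h5
  rw [advantage]
  linarith

/-- The bound by `1` is needed for the real supremum to dominate its members. -/
theorem le_statDist {ρ₀ ρ₁ : Op ι} (h₀ : IsDensity ρ₀) (h₁ : IsDensity ρ₁) (D : Channel ι Unit) :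
    advantage D ρ₀ ρ₁ ≤ statDist ρ₀ ρ₁ :=
  le_csSup ⟨1, by rintro _ ⟨D, rfl⟩; exact advantage_le_one D h₀ h₁⟩ ⟨D, rfl⟩

theorem tensorFamily_mul {n : ℕ} (ρ σ : Fin n → Op ι) :
    tensorFamily ρ * tensorFamily σ = tensorFamily fun i => ρ i * σ i := by
  ext u v
  simp only [tensorFamily, Matrix.mul_apply, Matrix.of_apply, ← Finset.prod_mul_distrib]
  rw [Finset.prod_univ_sum, Fintype.piFinset_univ]
  exact (Fintype.sum_equiv (Equiv.curry (Fin n) ι (ZMod 2)) _ _ fun w => rfl)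

theorem tensorFamily_one {n : ℕ} : tensorFamily (fun _ : Fin n => (1 : Op ι)) = 1 := by
  ext u v
  simp only [tensorFamily, Matrix.of_apply, Matrix.one_apply, Finset.prod_ite_zero,
    Finset.prod_const_one]
  refine if_congr ⟨fun h => ?_, ?_⟩ rfl rfl
  · ext ⟨i, q⟩
    exact congrFun (h i (Finset.mem_univ _)) q
  · rintro rfl i _
    rfl

theorem sum_tensorFamily {n : ℕ} {Y : Type} [Fintype Y] [DecidableEq Y] (N : Y → Op ι) :
    ∑ y : Fin n → Y, tensorFamily (fun i => N (y i)) = tensorFamily fun _ => ∑ t, N t := by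
  ext u v
  simp only [tensorFamily, Matrix.sum_apply, Matrix.of_apply]
  rw [Finset.prod_univ_sum, Fintype.piFinset_univ]

end Effects

/-! ### The Bell measurement after a decoder -/

section Bell

variable {r h : ℕ}

/-- The block `b`, `b'` of the register `B` of an operator. -/
def blockB (ρ : Op (RegRB r)) (b b' : Bits Unit) : Op (Fin r) :=
  Matrix.of fun i j => ρ (Sum.elim i b) (Sum.elim j b')

theorem blockB_add (ρ σ : Op (RegRB r)) (b b' : Bits Unit) :
    blockB (ρ + σ) b b' = blockB ρ b b' + blockB σ b b' := rfl

theorem blockB_smul (c : ℂ) (ρ : Op (RegRB r)) (b b' : Bits Unit) :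
    blockB (c • ρ) b b' = c • blockB ρ b b' := rfl

/-- The probability of the Bell outcome `y` after the channel `A`. -/
noncomputable def bellProb (A : Channel (Fin r) RegFD) (y : ZMod 2 × ZMod 2) :
    Op (RegRB r) →ₗ[ℂ] ℂ where
  toFun ρ := 1 / 2 * ∑ f, ∑ d, ∑ b, ∑ d', ∑ b', star (pauliMask y.1 y.2 b d) *
    pauliMask y.1 y.2 b' d' * A.map (blockB ρ b b') (Sum.elim f d) (Sum.elim f d')
  map_add' ρ σ := by
    simp only [blockB_add, map_add, Matrix.add_apply, mul_add, Finset.sum_add_distrib]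
  map_smul' c ρ := by
    simp only [blockB_smul, map_smul, Matrix.smul_apply, smul_eq_mul, RingHom.id_apply,
      Finset.mul_sum]
    refine Finset.sum_congr rfl fun f _ => Finset.sum_congr rfl fun d _ =>
      Finset.sum_congr rfl fun b _ => Finset.sum_congr rfl fun d' _ =>
      Finset.sum_congr rfl fun b' _ => ?_
    ring

theorem bellProb_apply (A : Channel (Fin r) RegFD) (y : ZMod 2 × ZMod 2) (ρ : Op (RegRB r)) :
    bellProb A y ρ = 1 / 2 * ∑ f, ∑ d, ∑ b, ∑ d', ∑ b', star (pauliMask y.1 y.2 b d) *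
      pauliMask y.1 y.2 b' d' * A.map (blockB ρ b b') (Sum.elim f d) (Sum.elim f d') := rfl

theorem bellProb_nonneg (A : Channel (Fin r) RegFD) (y : ZMod 2 × ZMod 2) {ρ : Op (RegRB r)}
    (hρ : ρ.PosSemidef) : 0 ≤ bellProb A y ρ := by
  have h1 := A.posSemidef_tensorId hρ
  rw [bellProb_apply]
  refine mul_nonneg (by rw [one_div]; exact inv_nonneg.2 zero_le_two)
    (Finset.sum_nonneg fun f _ => ?_)
  have h2 := (h1.submatrix fun u : Bits (Unit ⊕ Unit) =>
    (Sum.elim (Sum.elim f (u ∘ Sum.inl)) (u ∘ Sum.inr) : Bits (RegFD ⊕ Unit)))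
    |>.dotProduct_mulVec_nonneg fun u => pauliMask y.1 y.2 (u ∘ Sum.inr) (u ∘ Sum.inl)
  refine h2.trans (le_of_eq ?_)
  simp only [dotProduct, Matrix.mulVec, sum_bits_sum (ι := Unit) (κ := Unit), Finset.mul_sum,
    Pi.star_apply, Matrix.submatrix_apply]
  refine Finset.sum_congr rfl fun d _ => Finset.sum_congr rfl fun b _ =>
      Finset.sum_congr rfl fun d' _ => Finset.sum_congr rfl fun b' _ => ?_
  rw [mul_comm (tensorId _ _ _ _), ← mul_assoc]
  rfl

/-- Completeness of the Bell basis removes the off-diagonal blocks, and trace preservation of `A`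
does the rest. -/
theorem sum_bellProb (A : Channel (Fin r) RegFD) (ρ : Op (RegRB r)) :
    ∑ y, bellProb A y ρ = ρ.trace := by
  have h1 : ∀ b d b' d' : Bits Unit, ∑ y : ZMod 2 × ZMod 2,
      star (pauliMask y.1 y.2 b d) * pauliMask y.1 y.2 b' d' =
      if b = b' then if d = d' then 2 else 0 else 0 := by
    intro b d b' d'
    rw [← ite_and, ← sum_pauliMask_mul_star]
    simp only [star_pauliMask]
  have h2 : ∑ y, bellProb A y ρ = 1 / 2 * ∑ f, ∑ d, ∑ b, ∑ d', ∑ b',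
      (∑ y : ZMod 2 × ZMod 2, star (pauliMask y.1 y.2 b d) * pauliMask y.1 y.2 b' d') *
        A.map (blockB ρ b b') (Sum.elim f d) (Sum.elim f d') := by
    simp only [bellProb_apply]
    rw [← Finset.mul_sum]
    congr 1
    refine Finset.sum_comm.trans (Finset.sum_congr rfl fun f _ => ?_)
    refine Finset.sum_comm.trans (Finset.sum_congr rfl fun d _ => ?_)
    refine Finset.sum_comm.trans (Finset.sum_congr rfl fun b _ => ?_)
    refine Finset.sum_comm.trans (Finset.sum_congr rfl fun d' _ => ?_)
    refine Finset.sum_comm.trans (Finset.sum_congr rfl fun b' _ => ?_)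
    rw [Finset.sum_mul]
  rw [h2]
  have h5 : ∀ f d b, (∑ d', ∑ b',
      (∑ y : ZMod 2 × ZMod 2, star (pauliMask y.1 y.2 b d) * pauliMask y.1 y.2 b' d') *
        A.map (blockB ρ b b') (Sum.elim f d) (Sum.elim f d')) =
      2 * A.map (blockB ρ b b) (Sum.elim f d) (Sum.elim f d) := by
    intro f d b
    rw [Finset.sum_eq_single d, Finset.sum_eq_single b]
    · rw [h1, if_pos rfl, if_pos rfl]
    · intro b' _ hb
      rw [h1, if_neg hb.symm, zero_mul]
    · simp
    · intro d' _ hd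
      refine Finset.sum_eq_zero fun b' _ => ?_
      rw [h1, if_neg hd.symm, ite_self, zero_mul]
    · simp
  simp only [h5]
  have h3 : ∀ b, ∑ f, ∑ d, A.map (blockB ρ b b) (Sum.elim f d) (Sum.elim f d) =
      (blockB ρ b b).trace := by
    intro b
    rw [← A.trace_map, Matrix.trace, sum_bits_sum]
    rfl
  have h4 : ρ.trace = ∑ b, (blockB ρ b b).trace := by
    rw [Matrix.trace, sum_bits_sum, Finset.sum_comm]
    rfl
  rw [h4]
  simp only [← h3, ← Finset.mul_sum]
  rw [← mul_assoc, one_div, inv_mul_cancel₀ two_ne_zero, one_mul]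
  refine (Finset.sum_congr rfl fun f _ => Finset.sum_comm).trans Finset.sum_comm

/-- The Bell outcome equal to the mask undoes it by unitarity, leaving the overlap of the unmasked
decoded state with `|epr⟩`. Here `A` acts on `R` alone and commutes with the mask on `B`. -/
theorem bellProb_maskedState (A : Channel (Fin r) RegFD) (ψ : PureState r h)
    (y : ZMod 2 × ZMod 2) :
    bellProb A y (maskedState ψ y.1 y.2) = ∑ f, 1 / 2 * ∑ d, ∑ d',
      A.map (reducedBlock ψ d d') (Sum.elim f d) (Sum.elim f d') := by
  have h0 : ∀ d b, ∑ c, star (pauliMask y.1 y.2 c d) * pauliMask y.1 y.2 c b =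
      if d = b then 1 else 0 := by
    intro d b
    have := congrFun₂ (Matrix.mem_unitaryGroup_iff'.1 (pauliMask_mem_unitaryGroup y.1 y.2)) d b
    rw [Matrix.mul_apply, Matrix.one_apply] at this
    exact this
  have h1 : ∀ d d', ∑ b, ∑ b', (star (pauliMask y.1 y.2 b d) * pauliMask y.1 y.2 b' d') •
      blockB (maskedState ψ y.1 y.2) b b' = reducedBlock ψ d d' := by
    intro d d'
    ext q q'
    simp only [Matrix.sum_apply, Matrix.smul_apply, smul_eq_mul, blockB, Matrix.of_apply,
      maskedState_elim]
    have h2 : ∀ b b', star (pauliMask y.1 y.2 b d) * pauliMask y.1 y.2 b' d' *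
        ∑ c, ∑ c', pauliMask y.1 y.2 b c * star (pauliMask y.1 y.2 b' c') *
          reducedBlock ψ c c' q q' =
        ∑ c, ∑ c', (star (pauliMask y.1 y.2 b d) * pauliMask y.1 y.2 b c) *
          ((star (pauliMask y.1 y.2 b' c') * pauliMask y.1 y.2 b' d') *
            reducedBlock ψ c c' q q') := by
      intro b b'
      simp only [Finset.mul_sum]
      refine Finset.sum_congr rfl fun c _ => Finset.sum_congr rfl fun c' _ => ?_
      ring
    simp only [h2]
    have h3 : ∀ b, ∑ b', ∑ c, ∑ c', (star (pauliMask y.1 y.2 b d) * pauliMask y.1 y.2 b c) *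
          ((star (pauliMask y.1 y.2 b' c') * pauliMask y.1 y.2 b' d') *
            reducedBlock ψ c c' q q') =
        ∑ c, (star (pauliMask y.1 y.2 b d) * pauliMask y.1 y.2 b c) *
          reducedBlock ψ c d' q q' := by
      intro b
      rw [Finset.sum_comm]
      refine Finset.sum_congr rfl fun c _ => ?_
      rw [Finset.sum_comm]
      simp only [← Finset.mul_sum, ← Finset.sum_mul, h0]
      simp
    simp only [h3]
    rw [Finset.sum_comm]
    simp only [← Finset.sum_mul, h0]
    simp
  rw [bellProb_apply, Finset.mul_sum]
  refine Finset.sum_congr rfl fun f _ => ?_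
  congr 1
  refine Finset.sum_congr rfl fun d _ => ?_
  rw [Finset.sum_comm]
  refine Finset.sum_congr rfl fun d' _ => ?_
  rw [← h1]
  simp only [map_sum, map_smul, Matrix.sum_apply, Matrix.smul_apply, smul_eq_mul]

theorem bellProb_maskedState_of_isDecoder {η : ℝ} {A : Channel (Fin r) RegFD} {ψ : PureState r h}
    (hA : IsDecoder 1 (1 - η) A ψ) (y : ZMod 2 × ZMod 2) :
    1 - 3 / 4 * η ≤ (bellProb A y (maskedState ψ y.1 y.2)).re := by
  obtain ⟨-, -, γ, ρ₀, ρ₁, hγ, hρ₀, hρ₁, heq, hfid⟩ := hA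
  have hpos : (decodedState A ψ).PosSemidef :=
    posSemidef_relabel _ (A.posSemidef_tensorId (isDensity_reduced ψ).1)
  have hne : ((fun _ => 0 : Bits Unit)) ≠ fun _ => 1 := fun h => zero_ne_one (congrFun h ())
  have h1 : ∀ f f' u v, decodedState A ψ (Sum.elim f u) (Sum.elim f' v) =
      (γ : ℂ) * (basisProj (fun _ => 0) f f' * ρ₀ u v) +
        ((1 - γ : ℝ) : ℂ) * (basisProj (fun _ => 1) f f' * ρ₁ u v) := by
    intro f f' u v
    rw [heq]
    simp only [Matrix.add_apply, Matrix.smul_apply, smul_eq_mul, tensor_elim]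
  -- The definition of a decoder gives `1 ≤ γ'` only; the converse holds because the block at `F =
  -- 1` is positive with trace `1 - γ'`.
  have hγ1 : γ = 1 := by
    refine le_antisymm ?_ hγ
    have h2 : 0 ≤ ∑ u, (decodedState A ψ (Sum.elim (fun _ => 1) u) (Sum.elim (fun _ => 1) u)).re :=
      Finset.sum_nonneg fun u _ => (Complex.le_def.1 hpos.diag_nonneg).1
    have h3 : ∀ u, decodedState A ψ (Sum.elim (fun _ => 1) u) (Sum.elim (fun _ => 1) u) =
        ((1 - γ : ℝ) : ℂ) * ρ₁ u u := by
      intro u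
      rw [h1, basisProj_apply, basisProj_apply, if_neg fun h => hne h.1, if_pos ⟨rfl, rfl⟩]
      ring
    have h4 : ∑ u, (ρ₁ u u).re = 1 := by
      have := congrArg Complex.re hρ₁.2
      rw [Matrix.trace, Complex.re_sum] at this
      exact this
    simp only [h3, Complex.re_ofReal_mul] at h2
    rw [← Finset.mul_sum, h4] at h2
    linarith
  have h2 : bellProb A y (maskedState ψ y.1 y.2) =
      1 / 2 * ∑ d, ∑ d', ρ₀ (Sum.elim d d) (Sum.elim d' d') := by
    rw [bellProb_maskedState]
    have h3 : ∀ f d d', A.map (reducedBlock ψ d d') (Sum.elim f d) (Sum.elim f d') =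
        (if f = fun _ => 0 then 1 else 0) * ρ₀ (Sum.elim d d) (Sum.elim d' d') := by
      intro f d d'
      have h4 : A.map (reducedBlock ψ d d') (Sum.elim f d) (Sum.elim f d') =
        decodedState A ψ (Sum.elim f (Sum.elim d d)) (Sum.elim f (Sum.elim d' d')) := by
        have h5 : ∀ d : Bits Unit, ((Sum.elim f (Sum.elim d d) : Bits (Unit ⊕ (Unit ⊕ Unit))) ∘
            Equiv.sumAssoc Unit Unit Unit) ∘ Sum.inl = Sum.elim f d := by
          intro d
          ext (j | j) <;> rfl
        rw [decodedState, relabel_apply, tensorId, Matrix.of_apply, h5, h5]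
        rfl
      rw [h4, h1, hγ1, basisProj_apply, sub_self, Complex.ofReal_zero, zero_mul, add_zero,
        Complex.ofReal_one, one_mul]
      congr 1
      exact if_congr (by rw [and_self, eq_comm]) rfl rfl
    simp only [h3, ite_mul, one_mul, zero_mul]
    rw [Finset.sum_eq_single fun _ => 0]
    · simp
    · intro f _ hf
      simp [hf]
    · simp
  rw [h2, ← eprFidelity_eq]
  linarith

theorem exists_bellEffects {η : ℝ} {A : Channel (Fin r) RegFD} {ψ : PureState r h}
    (hA : IsDecoder 1 (1 - η) A ψ) :
    ∃ N : ZMod 2 × ZMod 2 → Op (RegRB r), (∀ y, (N y).PosSemidef) ∧ ∑ y, N y = 1 ∧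
      ∀ y, 1 - 3 / 4 * η ≤ (N y * maskedState ψ y.1 y.2).trace.re := by
  have h1 := fun y => exists_posSemidef_of_nonneg (bellProb A y) fun ρ hρ => bellProb_nonneg A y hρ
  choose N hN hNt using h1
  refine ⟨N, hN, ?_, fun y => ?_⟩
  · refine Matrix.ext_iff_trace_mul_right.2 fun ρ => ?_
    rw [Matrix.sum_mul, Matrix.trace_sum, Matrix.one_mul, ← sum_bellProb A]
    exact Finset.sum_congr rfl fun y _ => hNt y ρ
  · rw [hNt]
    exact bellProb_maskedState_of_isDecoder hA y

end Bell

/-! ### The statistical distance of the amplified states -/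

section Far

variable {r h n : ℕ}

/-- The classical output for the masks `y`, the strings `a`, `a'` and the bit `b`. -/
def publicWord (y : Fin n → ZMod 2 × ZMod 2) (a a' : Fin n → ZMod 2) (b : ZMod 2) :
    Bits ((Fin n ⊕ Fin n) ⊕ Unit) :=
  Sum.elim (Sum.elim a a') fun _ => a ⬝ᵥ (fun i => (y i).1) + a' ⬝ᵥ (fun i => (y i).2) + b

theorem sum_basisProj {ι : Type} [Fintype ι] [DecidableEq ι] :
    ∑ w : Bits ι, (basisProj w : Op ι) = 1 := by
  ext u v
  simp only [Matrix.sum_apply, basisProj_apply, Matrix.one_apply]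
  by_cases huv : u = v
  · subst huv
    simp
  · rw [if_neg huv]
    refine Finset.sum_eq_zero fun w _ => if_neg ?_
    rintro ⟨rfl, h⟩
    exact huv h

theorem sum_basisProj_publicWord (y : Fin n → ZMod 2 × ZMod 2) :
    ∑ a, ∑ a', ∑ c : Bits Unit, (basisProj (publicWord y a a' (c ())) : Op _) = 1 := by
  rw [← sum_basisProj, sum_bits_sum (ι := Fin n ⊕ Fin n), sum_bits_sum (ι := Fin n) (κ := Fin n)]
  refine Finset.sum_congr rfl fun a _ => Finset.sum_congr rfl fun a' _ => ?_
  exact Fintype.sum_equiv (Equiv.addLeft fun _ : Unit =>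
    a ⬝ᵥ (fun i => (y i).1) + a' ⬝ᵥ (fun i => (y i).2)) _ _ fun c => rfl

theorem tensor_sum_right {ι κ β : Type} (s : Finset β) (ρ : Op ι) (σ : β → Op κ) :
    tensor ρ (∑ b ∈ s, σ b) = ∑ b ∈ s, tensor ρ (σ b) := by
  ext u v
  simp only [tensor, Matrix.of_apply, Matrix.sum_apply, Finset.mul_sum]

theorem tensor_sum_left {ι κ β : Type} (s : Finset β) (ρ : β → Op ι) (σ : Op κ) :
    tensor (∑ b ∈ s, ρ b) σ = ∑ b ∈ s, tensor (ρ b) σ := by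
  ext u v
  simp only [tensor, Matrix.of_apply, Matrix.sum_apply, Finset.sum_mul]

/-- The effect of guessing the bit `c` from the outcomes of the measurement `N` of every copy. -/
noncomputable def guessEffect (N : ZMod 2 × ZMod 2 → Op (RegRB r)) (n : ℕ) (c : Bits Unit) :
    Op (RegOut r n) :=
  ∑ y : Fin n → ZMod 2 × ZMod 2, ∑ a, ∑ a',
    tensor (tensorFamily fun i => N (y i)) (basisProj (publicWord y a a' (c ())))

theorem posSemidef_guessEffect_term {N : ZMod 2 × ZMod 2 → Op (RegRB r)}
    (hN : ∀ y, (N y).PosSemidef) (y : Fin n → ZMod 2 × ZMod 2)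
    (w : Bits ((Fin n ⊕ Fin n) ⊕ Unit)) :
    (tensor (tensorFamily fun i => N (y i)) (basisProj w)).PosSemidef :=
  posSemidef_tensor (posSemidef_tensorFamily fun _ => hN _) (posSemidef_basisProj _)

theorem posSemidef_guessEffect {N : ZMod 2 × ZMod 2 → Op (RegRB r)}
    (hN : ∀ y, (N y).PosSemidef) (n : ℕ) (c : Bits Unit) : (guessEffect N n c).PosSemidef :=
  Matrix.posSemidef_sum _ fun y _ => Matrix.posSemidef_sum _ fun _ _ =>
    Matrix.posSemidef_sum _ fun _ _ => posSemidef_guessEffect_term hN y _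

theorem sum_guessEffect {N : ZMod 2 × ZMod 2 → Op (RegRB r)} (hN : ∑ y, N y = 1) (n : ℕ) :
    ∑ c, guessEffect N n c = 1 := by
  have h1 : ∑ c, guessEffect N n c = ∑ y : Fin n → ZMod 2 × ZMod 2,
      tensor (tensorFamily fun i => N (y i)) (1 : Op ((Fin n ⊕ Fin n) ⊕ Unit)) := by
    simp only [guessEffect]
    refine Finset.sum_comm.trans (Finset.sum_congr rfl fun y _ => ?_)
    rw [← sum_basisProj_publicWord y, tensor_sum_right]
    refine Finset.sum_comm.trans (Finset.sum_congr rfl fun a _ => ?_)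
    rw [tensor_sum_right]
    refine Finset.sum_comm.trans (Finset.sum_congr rfl fun a' _ => ?_)
    rw [tensor_sum_right]
  rw [h1, ← tensor_sum_left, sum_tensorFamily, hN, tensorFamily_one, tensor_one_one]

/-- Among all terms of the effect, only the one with the actual masks and public strings is kept. On
it the copies factor, and each factor is at least `q`; the dropped terms are nonnegative. -/
theorem le_trace_guessEffect {ψ : PureState r h} {N : ZMod 2 × ZMod 2 → Op (RegRB r)}
    (hN : ∀ y, (N y).PosSemidef) {q : ℝ} (hq : 0 ≤ q)
    (hNq : ∀ y, q ≤ (N y * maskedState ψ y.1 y.2).trace.re) (n : ℕ) (c : Bits Unit) :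
    q ^ n ≤ (guessEffect N n c * amplified ψ n (c ())).trace.re := by
  have hterm : ∀ (y : Fin n → ZMod 2 × ZMod 2) (a a' : Fin n → ZMod 2), q ^ n ≤
      (guessEffect N n c * tensor (maskedFamily ψ y)
        (basisProj (publicWord y a a' (c ())))).trace.re := by
    intro y a a'
    set σ := tensor (maskedFamily ψ y) (basisProj (publicWord y a a' (c ()))) with hσ
    have hσ0 : σ.PosSemidef := posSemidef_tensor (isDensity_maskedFamily ψ y).1
      (posSemidef_basisProj _)
    have h0 : ∀ (y : Fin n → ZMod 2 × ZMod 2) (a a' : Fin n → ZMod 2), 0 ≤ (tensor (tensorFamily fun i => N (y i))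
        (basisProj (publicWord y a a' (c ()))) * σ).trace.re := fun y a a' =>
      (Complex.le_def.1 (trace_mul_nonneg (posSemidef_guessEffect_term hN y _) hσ0)).1
    have h1 : (tensor (tensorFamily fun i => N (y i))
        (basisProj (publicWord y a a' (c ()))) * σ).trace.re =
        ∏ i, (N (y i) * maskedState ψ (y i).1 (y i).2).trace.re := by
      have h2 : ∀ i, (N (y i) * maskedState ψ (y i).1 (y i).2).trace =
          (((N (y i) * maskedState ψ (y i).1 (y i).2).trace.re : ℝ) : ℂ) := fun i =>
        Complex.ext rfl (Complex.le_def.1 (trace_mul_nonneg (hN _)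
          (isDensity_maskedState ψ _ _).1)).2.symm
      rw [hσ, tensor_mul_tensor, trace_tensor, maskedFamily, tensorFamily_mul, trace_tensorFamily,
        basisProj, Matrix.single_mul_single_same, mul_one, ← basisProj, trace_basisProj, mul_one,
        Finset.prod_congr rfl fun i _ => h2 i, ← Complex.ofReal_prod, Complex.ofReal_re]
    have h3 : q ^ n ≤ (tensor (tensorFamily fun i => N (y i))
        (basisProj (publicWord y a a' (c ()))) * σ).trace.re := by
      rw [h1]
      calc q ^ n = ∏ _i : Fin n, q := by simp
        _ ≤ _ := Finset.prod_le_prod (fun _ _ => hq) fun i _ => hNq (y i)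
    refine h3.trans ?_
    simp only [guessEffect, Matrix.sum_mul, Matrix.trace_sum, Complex.re_sum]
    refine le_trans ?_ (Finset.single_le_sum (fun y _ => Finset.sum_nonneg fun a _ =>
      Finset.sum_nonneg fun a' _ => h0 y a a') (Finset.mem_univ y))
    refine le_trans ?_ (Finset.single_le_sum (fun a _ =>
      Finset.sum_nonneg fun a' _ => h0 y a a') (Finset.mem_univ a))
    exact Finset.single_le_sum (fun a' _ => h0 y a a') (Finset.mem_univ a')
  have hcoef : ((2 : ℂ) ^ (4 * n))⁻¹ = (((2 : ℝ) ^ (4 * n))⁻¹ : ℝ) := by push_cast; rfl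
  have h4 : (guessEffect N n c * amplified ψ n (c ())).trace.re = ((2 : ℝ) ^ (4 * n))⁻¹ *
      ∑ y : Fin n → ZMod 2 × ZMod 2, ∑ a, ∑ a', (guessEffect N n c * tensor (maskedFamily ψ y)
        (basisProj (publicWord y a a' (c ())))).trace.re := by
    rw [amplified_eq, Matrix.mul_smul, Matrix.trace_smul, hcoef, smul_eq_mul,
      Complex.re_ofReal_mul]
    simp only [Matrix.mul_sum, Matrix.trace_sum, Complex.re_sum]
    rfl
  rw [h4, inv_mul_eq_div, le_div_iff₀ (by positivity)]
  calc q ^ n * 2 ^ (4 * n) = ∑ _y : Fin n → ZMod 2 × ZMod 2, ∑ _a : Fin n → ZMod 2,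
        ∑ _a' : Fin n → ZMod 2, q ^ n := by
        simp only [Finset.sum_const, Finset.card_univ, Fintype.card_pi, Fintype.card_prod,
          ZMod.card, Finset.prod_const, Fintype.card_fin, nsmul_eq_mul, Nat.cast_pow,
          Nat.cast_ofNat, Nat.cast_mul]
        rw [pow_mul, show (2 : ℝ) ^ 4 = 2 * 2 * 2 * 2 by norm_num, mul_pow, mul_pow, mul_pow]
        ring
    _ ≤ _ := Finset.sum_le_sum fun y _ => Finset.sum_le_sum fun a _ =>
        Finset.sum_le_sum fun a' _ => hterm y a a'

/-- Both values of `b` are guessed with probability at least `(1 - 3 / 4 * η) ^ n ≥ 1 - 3 / 4 * (n *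
η)`, by Bernoulli's inequality. An advantage is twice such a probability minus one. -/
theorem le_statDist_amplified {η : ℝ} {A : Channel (Fin r) RegFD} {ψ : PureState r h}
    (hA : IsDecoder 1 (1 - η) A ψ) (n : ℕ) :
    1 - 3 / 2 * (n * η) ≤ statDist (amplified ψ n 0) (amplified ψ n 1) := by
  obtain ⟨N, hN, hN1, hNt⟩ := exists_bellEffects hA
  have hη : η ≤ 1 := by linarith [hA.2.1.1]
  have hη0 : 0 ≤ η := by linarith [hA.2.1.2]
  have hK := isKraus_binary (posSemidef_guessEffect hN n) (sum_guessEffect hN1 n)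
  have hle := fun c => le_trace_guessEffect hN (q := 1 - 3 / 4 * η) (by linarith) hNt n c
  have hpow : 1 - n * (3 / 4 * η) ≤ (1 - 3 / 4 * η) ^ n := by
    have := one_add_mul_le_pow (a := -(3 / 4 * η)) (by linarith) n
    rw [← sub_eq_add_neg] at this
    linarith
  refine le_trans ?_ (le_statDist (isDensity_amplified ψ n 0) (isDensity_amplified ψ n 1)
    hK.channel)
  have h1 : ∀ (ρ : Op (RegOut r n)) (u : Bits Unit),
      hK.channel.map ρ u u = (guessEffect N n u * ρ).trace := fun ρ u => if_pos rfl
  have h2 : (hK.channel.map (amplified ψ n 0) (fun _ => 0) (fun _ => 0)).re +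
      (hK.channel.map (amplified ψ n 0) (fun _ => 1) (fun _ => 1)).re = 1 := by
    have := congrArg Complex.re (hK.channel.isDensity_map (isDensity_amplified ψ n 0)).2
    rw [Matrix.trace, sum_bits_unit] at this
    simpa only [Matrix.diag, Complex.add_re, Complex.one_re] using this
  have h3 := hle fun _ => 0
  have h4 := hle fun _ => 1
  rw [← h1] at h3 h4
  rw [advantage]
  linarith

end Far

/-! ### EFI pairs -/

theorem not_negligible_statDist (Ψ : StateEnsemble) (n : ℕ → ℕ) (hΨ : Ψ.StronglyDecodable)
    (hn : PolyBounded fun s => (n s : ℕ∞)) :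
    ¬ Negligible fun s => statDist (amplified (Ψ.state s) (n s) 0)
      (amplified (Ψ.state s) (n s) 1) := by
  obtain ⟨A, η, hη, hA⟩ := hΨ
  obtain ⟨p, hp⟩ := hn
  obtain ⟨m, C, hC, hm⟩ := exists_eval_le p
  have hC' : (0 : ℝ) < C := by exact_mod_cast hC
  refine not_negligible_of_frequently 0 (c := 1 / 2) (by norm_num) (Eventually.frequently ?_)
  -- With `n ≤ C * s ^ m` this gives `n * η < 1 / 3`, and then `1 - 3 / 2 * (n * η)` is above `1 /
  -- 2`.
  have h1 := Metric.tendsto_nhds.1 (hη m) (1 / (3 * C)) (by positivity)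
  filter_upwards [h1, eventually_gt_atTop 0] with s hs hs0
  have hη0 : 0 ≤ η s := by linarith [(hA s).2.1.2]
  rw [Real.dist_eq, sub_zero, abs_of_nonneg (by positivity), lt_div_iff₀ (by positivity)] at hs
  have h2 : (n s : ℝ) ≤ C * (s : ℝ) ^ m := by
    exact_mod_cast (ENat.natCast_le_natCast.1 (hp s)).trans (hm s hs0)
  have h3 : n s * η s ≤ C * (s : ℝ) ^ m * η s := mul_le_mul_of_nonneg_right h2 hη0
  have h4 := le_statDist_amplified (hA s) (n s)
  rw [pow_zero, one_mul]
  refine le_trans ?_ (le_abs_self _)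
  refine le_trans ?_ h4
  nlinarith

/-- A distinguisher of non-negligible advantage would yield a decoder with `1 - ε = O(log s / n) =
o(1)`. Eventually `ε ≥ 1 / 2`, so `γ * ε` inherits non-negligibility from `γ`, and the decoder would
be of high confidence. -/
theorem negligible_advantage (Ψ : StateEnsemble) (n : ℕ → ℕ)
    (hΨ : EfficientlyGeneratable fun s => (Ψ.state s).density)
    (hdec : ¬ ∃ A : ∀ s, Channel (Fin (Ψ.r s)) RegFD, Ψ.IsHighConfidenceDecoder A)
    (hn : (fun s : ℕ => Real.log s) =o[atTop] fun s => (n s : ℝ))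
    (D : ∀ s, Channel (RegOut (Ψ.r s) (n s)) Unit) (hD : Efficient D) :
    Negligible fun s => advantage (D s)
      (amplified (Ψ.state s) (n s) 0) (amplified (Ψ.state s) (n s) 1) := by
  by_contra hadv
  -- Since `log s` is positive for `s ≥ 2`, it cannot be bounded by `n s = 0`.
  have hn0 : ∀ᶠ s in atTop, 0 < n s := by
    filter_upwards [hn.bound one_pos, eventually_ge_atTop 2] with s hs hs2
    rcases Nat.eq_zero_or_pos (n s) with h | h
    · have h1 : 0 < Real.log s := Real.log_pos (by exact_mod_cast hs2)
      rw [h, Nat.cast_zero, norm_zero, mul_zero] at hs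
      exact absurd (norm_le_zero_iff.1 hs) h1.ne'
    · exact h
  obtain ⟨A, γ, ε, hA, hAe, -, hγ, hε⟩ := exists_decoder_ensemble Ψ n hn0 hΨ D hD hadv
  have hε1 : (fun s => 1 - ε s) =o[atTop] fun _ => (1 : ℝ) :=
    hε.trans_isLittleO ((isLittleO_one_iff ℝ).2 hn.tendsto_div_nhds_zero)
  refine hdec ⟨A, hAe, γ, ε, hA, ?_, hε1⟩
  obtain ⟨k, c, hc, -, hfr⟩ := frequently_of_not_negligible hγ
  refine not_negligible_of_frequently k (c := c / 2) (by positivity) ?_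
  refine (hfr.and_eventually (hε1.bound (c := 1 / 2) (by norm_num))).mono fun s hs => ?_
  have h1 := (hA s).1.1
  have h2 := (hA s).2.1
  have h3 : 1 / 2 ≤ ε s := by
    have := hs.2
    rw [Real.norm_of_nonneg (sub_nonneg.2 h2.2), norm_one] at this
    linarith
  rw [abs_mul, abs_of_nonneg h2.1, ← mul_assoc]
  calc c / 2 = c * (1 / 2) := by ring
    _ ≤ (s : ℝ) ^ k * |γ s| * ε s := mul_le_mul hs.1 h3 (by norm_num) (by positivity)

end BHRD

theorem mainTheorem3 :
    (∃ c k : ℕ, ∀ (Ψ : StateEnsemble) (n : ℕ → ℕ), (∀ s, 0 < n s) →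
      EfficientlyGeneratable (fun s => (Ψ.state s).density) →
      ∀ D : ∀ s, Channel (RegOut (Ψ.r s) (n s)) Unit, Efficient D →
        ¬ Negligible (fun s => advantage (D s)
            (amplified (Ψ.state s) (n s) 0) (amplified (Ψ.state s) (n s) 1)) →
        ∃ (A : ∀ s, Channel (Fin (Ψ.r s)) RegFD) (γ ε : ℕ → ℝ),
          (∀ s, IsDecoder (γ s) (ε s) (A s) (Ψ.state s)) ∧
          Efficient A ∧
          (∀ s, complexity (A s) ≤
            c * (1 + complexity (D s) + genComplexity (Ψ.state s).density) ^ k) ∧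
          ¬ Negligible γ ∧
          (fun s => 1 - ε s) =O[atTop] fun s => Real.log s / n s) ∧
    (∀ (Ψ : StateEnsemble) (n : ℕ → ℕ),
      EfficientlyGeneratable (fun s => (Ψ.state s).density) →
      Ψ.StronglyDecodable →
      (¬ ∃ A : ∀ s, Channel (Fin (Ψ.r s)) RegFD, Ψ.IsHighConfidenceDecoder A) →
      PolyBounded (fun s => (n s : ℕ∞)) →
      (fun s : ℕ => Real.log s) =o[atTop] (fun s => (n s : ℝ)) →
      IsEFI (fun s => amplified (Ψ.state s) (n s) 0)
        (fun s => amplified (Ψ.state s) (n s) 1)) := by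
  refine ⟨⟨300, 2, fun Ψ n hn hΨ D hD hadv =>
    exists_decoder_ensemble Ψ n (Eventually.of_forall hn) hΨ D hD hadv⟩,
    fun Ψ n hΨ hstrong hdec hpoly hn => ⟨?_, ?_, ?_, ?_⟩⟩
  · exact efficientlyGeneratable_amplified Ψ n hpoly hΨ 0
  · exact efficientlyGeneratable_amplified Ψ n hpoly hΨ 1
  · exact not_negligible_statDist Ψ n hstrong hpoly
  · exact negligible_advantage Ψ n hΨ hdec hn
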